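/- **Circuits.** Let $\mathcal M$ be a strict symmetric premonoidal category: objects form a monoid $(\otimes, I)$, there are functors $X\rtimes -$ and $-\ltimes X$ acting on objects by $X\otimes -$ and $-\otimes X$ (strictly compatible with the monoid structure and with each other), and there is a natural, involutive, central symmetry $X\otimes Y\to Y\otimes X$ satisfying the hexagon law; no interchange law is required. Let $W$ be a set of wire types $w$, each with an object $⟦w⟧$ of $\mathcal M$. A label context $Q=\ell_1:w_1,\dots,\ell_n:w_n$ has distinct labels, and $⟦Q⟧=⟦w_1⟧\otimes\dots\otimes⟦w_n⟧$. A circuit $C:Q\to L$ is a morphism $⟦Q⟧\to⟦L⟧$. If $L,L'$ agree up to order, $perm:L\to L'$ denotes the permutation isomorphism built from symmetries that moves each label to its position in $L'$. **Proto-Quipper-C.** Bundle types $T,U::=1\mid w\mid T\otimes U$, identified in closure annotations up to strict associativity and unit. Types $A,B::=1\mid \mathrm{Nat}\mid w\mid A\otimes B\mid\,!A\mid \mathrm{Circ}(T,U)\mid A\multimap_T B$. Parameter types $P,R::=1\mid\mathrm{Nat}\mid P\otimes R\mid\,!A\mid\mathrm{Circ}(T,U)$. Wire bundles $b,c::=*\mid\ell\mid\langle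 b,c\rangle$. Values $V::=x\mid\ell\mid *\mid n\mid\lambda x^A.N\mid\mathrm{lift}\,N\mid(b,D,c)\mid\langle V,V'\rangle$, where $D$ is a circuit. Terms $N::=V\,V'\mid\mathrm{force}\,V\mid\mathrm{box}_T V\mid\mathrm{apply}(V,V')\mid\mathrm{let}\,\langle x,y\rangle=V\,\mathrm{in}\,N\mid\mathrm{ifz}\,V\,\mathrm{then}\,N\,\mathrm{else}\,N'\mid\mathrm{return}\,V\mid\mathrm{let}\,x=N\,\mathrm{in}\,N'$. The circuit part of a type is $\sharp1=\sharp\mathrm{Nat}=\sharp!A=\sharp\mathrm{Circ}(T,U)=1$, $\sharp w=w$, $\sharp(A\otimes B)=\sharp A\otimes\sharp B$, $\sharp(A\multimap_TB)=T$. Contexts $\Gamma$ are ordered lists of labels $\ell:w$ and variables $x:A$; $\sharp\Gamma$ is the tensor of the $\sharp$ of its entries; $\Phi$ ranges over contexts all of whose entries have parameter type. *Value rules.* $\Phi\vdash *:1$; $\ \Phi\vdash n:\mathrm{Nat}$; $\ \Phi,\ell:w\vdash\ell:w$; $\ \Phi,x:A\vdash x:A$; if $\Gamma,x:A\vdash N:B$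 then $\Gamma\vdash\lambda x^A.N:A\multimap_{\sharp\Gamma}B$; if $\Phi\vdash N:A$ then $\Phi\vdash\mathrm{lift}\,N:\,!A$; if $Q\vdash b:T$, $L\vdash c:U$, and $D$ goes from $Q$ to $L$ up to reordering of the labels, then $\Phi\vdash(b,D,c):\mathrm{Circ}(T,U)$; if $\Phi,\Gamma_1\vdash V:A$ and $\Phi,\Gamma_2\vdash V':B$ then $\Phi,\Gamma_1,\Gamma_2\vdash\langle V,V'\rangle:A\otimes B$. *Computation rules.* If $\Phi,\Gamma_1\vdash V:A\multimap_TB$ and $\Phi,\Gamma_2\vdash V':A$ then $\Phi,\Gamma_1,\Gamma_2\vdash V\,V':B$; if $\Phi\vdash V:\,!A$ then $\Phi\vdash\mathrm{force}\,V:A$; if $\Phi\vdash V:T\multimap_IU$ (empty annotation) then $\Phi\vdash\mathrm{box}_TV:\mathrm{Circ}(T,U)$; if $\Phi,\Gamma_1\vdash V:\mathrm{Circ}(T,U)$ and $\Phi,\Gamma_2\vdash V':T$ then $\Phi,\Gamma_1,\Gamma_2\vdash\mathrm{apply}(V,V'):U$; if $\Phi,\Gamma_1\vdash V:A\otimes B$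 and $\Phi,\Gamma_2,x:A,y:B\vdash N:C$ then $\Phi,\Gamma_2,\Gamma_1\vdash\mathrm{let}\,\langle x,y\rangle=V\,\mathrm{in}\,N:C$; if $\Phi\vdash V:\mathrm{Nat}$, $\Phi,\Gamma\vdash N:A$ and $\Phi,\Gamma\vdash N':A$ then $\Phi,\Gamma\vdash\mathrm{ifz}\,V\,\mathrm{then}\,N\,\mathrm{else}\,N':A$; if $\Gamma\vdash V:A$ then $\Gamma\vdash\mathrm{return}\,V:A$; if $\Phi,\Gamma_1\vdash N:A$ and $\Phi,\Gamma_2,x:A\vdash N':B$ then $\Phi,\Gamma_2,\Gamma_1\vdash\mathrm{let}\,x=N\,\mathrm{in}\,N':B$; and exchange of two adjacent context entries, for computations only. *Configurations.* $Q\vdash(C,N):A;Q'$ holds if, up to reordering of its output labels, $C$ is a circuit $Q\to L,Q'$ for some $L$ with $L\vdash N:A$. Likewise $Q\vdash(C,V):A;Q'$ for values. *Evaluation* $(C,N)\Downarrow(C',V)$ is the least relation with the following rules. $(C,\mathrm{return}\,V)\Downarrow(C,V)$. Each of $(\lambda x^A.N)\,V$, $\mathrm{let}\,\langle x,y\rangle=\langle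 V,V'\rangle\,\mathrm{in}\,N$, $\mathrm{force}(\mathrm{lift}\,N)$, $\mathrm{ifz}\,0\,\mathrm{then}\,N\,\mathrm{else}\,N'$, $\mathrm{ifz}\,(n{+}1)\,\mathrm{then}\,N\,\mathrm{else}\,N'$ evaluates, from $C$, to whatever $N[V/x]$, $N[V/x,V'/y]$, $N$, $N$, $N'$ respectively evaluates to from $C$. If $(C,N)\Downarrow(C',V)$ and $(C',N'[V/x])\Downarrow(C'',X)$ then $(C,\mathrm{let}\,x=N\,\mathrm{in}\,N')\Downarrow(C'',X)$. If $K$ is a label context, $K\vdash b:T$ and $(id_K,V\,b)\Downarrow(D,c)$ with $c$ a wire bundle, then $(C,\mathrm{box}_TV)\Downarrow(C,(b,D,c))$. Finally $(C,\mathrm{apply}((b,D,c),t))\Downarrow(C',k)$, where $C'$ is $C$ followed by $D$ on the wires that $t$ lists (matched with the inputs listed by $b$), leaving the others unchanged; the resulting new wires are listed by $k$ (matched with the outputs listed by $c$), and all output labels of $C'$ are distinct. Output labels of circuits may be ordered in any way. **Interpretation.** Let $\mathcal T(T,U,X)=X\times\mathcal M(T,U)$, an indexed monad with unit $x\mapsto(x,id)$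 and multiplication given by composition in $\mathcal M$. Its Kleisli category $\mathcal K$ has objects $(X,T)$, with $X$ a set and $T$ an object of $\mathcal M$, and morphisms $(X,T)\to(Y,U)$ the functions $X\to\mathcal T(T,U,Y)$. Let $J:\mathbf{Set}\times\mathcal M\to\mathcal K$ be the identity-on-objects functor $J(f,C)(x)=(f(x),C)$. A type is interpreted as $⟦A⟧=(\flat A,⟦\sharp A⟧)$ with $\flat1=\flat w=1$, $\flat\mathrm{Nat}=\mathbb N$, $\flat(A\otimes B)=\flat A\times\flat B$, $\flat(!A)=\mathcal T(I,⟦\sharp A⟧,\flat A)$, $\flat\mathrm{Circ}(T,U)=\mathcal M(⟦T⟧,⟦U⟧)$, $\flat(A\multimap_TB)=\flat A\Rightarrow\mathcal T(⟦T⟧\otimes⟦\sharp A⟧,⟦\sharp B⟧,\flat B)$; contexts are interpreted componentwise. By recursion on derivations, a value judgment $\Gamma\vdash V:A$ denotes a morphism $⟦\Gamma⟧\to⟦A⟧$ of $\mathbf{Set}\times\mathrm{disc}(\mathrm{Ob}\,\mathcal M)$, and a computation judgment $\Gamma\vdash N:A$ denotes a morphism $⟦\Gamma⟧\to⟦A⟧$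 of $\mathcal K$. In the latter, variables are shared through the $\flat$ part; $\mathrm{return}$ is the Kleisli unit; let is Kleisli composition, with the first computation acting on the rightmost wires; application, force and apply run the denoted function, thunk or circuit; box is the isomorphism $\flat(T\multimap_IU)\cong\mathcal M(⟦T⟧,⟦U⟧)$; and exchange is precomposition with the symmetry. For configurations, with $C;perm:Q\to L,Q'$ and $L\vdash N:A$ (resp. $L\vdash V:A$), $$⟦(C,N)⟧=J(id,\,C;perm);(⟦N⟧\ltimes⟦Q'⟧):J(1,⟦Q⟧)\to J(\flat A,⟦\sharp A⟧\otimes⟦Q'⟧),$$ a morphism of $\mathcal K$, and $$⟦(C,V)⟧=(id,\,C;perm);(⟦V⟧\ltimes⟦Q'⟧),$$ a morphism of $\mathbf{Set}\times\mathcal M$. **Theorem (soundness).** Suppose $Q\vdash(C,N):A;Q'$ and $(C,N)\Downarrow(C',V)$. Then $Q\vdash(C',V):A;Q'$ and $$⟦(C,N)⟧=J(⟦(C',V)⟧).$$ More precisely, since meanings are defined on derivations: for every derivation of $Q\vdash(C,N):A;Q'$ there is a derivation of $Q\vdash(C',V):A;Q'$ such that the two meanings satisfy this equation. -/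

import Mathlib

open CategoryTheory

universe v u w

/-! ### Circuits: strict symmetric premonoidal categories -/

/-- A strict symmetric premonoidal category.  The tensor of objects is the multiplication of a monoid
(so that it is strictly associative and unital), `lwhisk X f` is `X ⋊ f`, `rwhisk f X` is `f ⋉ X`, and
`braid X Y : X ⊗ Y ⟶ Y ⊗ X` is the symmetry, which is central.  No interchange law is required.
Heterogeneous equalities and `eqToHom`s only account for the strict object equalities. -/
class StrictSymmPremonoidal (M : Type u) extends Category.{v} M, Monoid M where
  lwhisk (X : M) {Y Z : M} (f : Y ⟶ Z) : (X * Y ⟶ X * Z)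
  rwhisk {Y Z : M} (f : Y ⟶ Z) (X : M) : (Y * X ⟶ Z * X)
  braid (X Y : M) : (X * Y ⟶ Y * X)
  lwhisk_id (X Y : M) : lwhisk X (𝟙 Y) = 𝟙 (X * Y)
  rwhisk_id (X Y : M) : rwhisk (𝟙 Y) X = 𝟙 (Y * X)
  lwhisk_comp (X : M) {Y Z Z' : M} (f : Y ⟶ Z) (g : Z ⟶ Z') :
    lwhisk X (f ≫ g) = lwhisk X f ≫ lwhisk X g
  rwhisk_comp (X : M) {Y Z Z' : M} (f : Y ⟶ Z) (g : Z ⟶ Z') :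
    rwhisk (f ≫ g) X = rwhisk f X ≫ rwhisk g X
  one_lwhisk {Y Z : M} (f : Y ⟶ Z) : lwhisk 1 f ≍ f
  rwhisk_one {Y Z : M} (f : Y ⟶ Z) : rwhisk f 1 ≍ f
  mul_lwhisk (X X' : M) {Y Z : M} (f : Y ⟶ Z) : lwhisk (X * X') f ≍ lwhisk X (lwhisk X' f)
  rwhisk_mul (X X' : M) {Y Z : M} (f : Y ⟶ Z) : rwhisk f (X * X') ≍ rwhisk (rwhisk f X) X'
  lwhisk_rwhisk (X X' : M) {Y Z : M} (f : Y ⟶ Z) :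
    rwhisk (lwhisk X f) X' ≍ lwhisk X (rwhisk f X')
  braid_braid (X Y : M) : braid X Y ≫ braid Y X = 𝟙 (X * Y)
  braid_naturality {X X' : M} (f : X ⟶ X') (Y : M) :
    rwhisk f Y ≫ braid X' Y = braid X Y ≫ lwhisk Y f
  hexagon (X Y Z : M) :
    braid X (Y * Z) = eqToHom (mul_assoc X Y Z).symm ≫ rwhisk (braid X Y) Z ≫
      eqToHom (mul_assoc Y X Z) ≫ lwhisk Y (braid X Z) ≫ eqToHom (mul_assoc Y Z X).symm
  braid_central_left (X Y : M) {A B : M} (f : A ⟶ B) :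
    rwhisk (braid X Y) A ≫ lwhisk (Y * X) f = lwhisk (X * Y) f ≫ rwhisk (braid X Y) B
  braid_central_right (X Y : M) {A B : M} (f : A ⟶ B) :
    lwhisk A (braid X Y) ≫ rwhisk f (Y * X) = rwhisk f (X * Y) ≫ lwhisk B (braid X Y)

namespace ProtoQuipperC

open StrictSymmPremonoidal

/-! ### The circuit monad and its Kleisli category -/

section Monad

variable {M : Type u} [StrictSymmPremonoidal.{v} M]

/-- The category-action indexed monad `T(T, U, X) = X × M(T, U)`. -/
abbrev Circ (T U : M) (X : Type v) : Type v := X × (T ⟶ U)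

namespace Circ

variable {S T T' U V : M} {X Y : Type v}

/-- Unit of the indexed monad. -/
def eta (T : M) (x : X) : Circ T T X := (x, 𝟙 T)

/-- Functorial action of the indexed monad in its third argument. -/
def map (f : X → Y) (m : Circ T U X) : Circ T U Y := (f m.1, m.2)

/-- Multiplication of the indexed monad. -/
def mu (m : Circ T U (Circ U V X)) : Circ T V X := (m.1.1, m.2 ≫ m.1.2)

/-- Kleisli extension. -/
def bind (m : Circ T U X) (k : X → Circ U V Y) : Circ T V Y := mu (map k m)

/-- Contravariant action of the indexed monad in its first argument. -/
def pre (f : T' ⟶ T) (m : Circ T U X) : Circ T' U X := (m.1, f ≫ m.2)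

/-- Covariant action of the indexed monad in its second argument. -/
def post (m : Circ T U X) (f : U ⟶ V) : Circ T V X := (m.1, m.2 ≫ f)

/-- Lifting of `S ⋊ -` to the indexed monad. -/
def liftL (S : M) (m : Circ T U X) : Circ (S * T) (S * U) X := (m.1, lwhisk S m.2)

/-- Lifting of `- ⋉ S` to the indexed monad. -/
def liftR (m : Circ T U X) (S : M) : Circ (T * S) (U * S) X := (m.1, rwhisk m.2 S)

end Circ

/-- Objects `(X, T)` of the Kleisli category of the circuit monad. -/
structure Kl (M : Type u) where
  /-- the set of parameters -/
  val : Type v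
  /-- the circuit interface -/
  cir : M

/-- The Kleisli category: a morphism `(X, T) ⟶ (Y, U)` is a function `X → Y × M(T, U)`. -/
instance : Category (Kl.{v, u} M) where
  Hom P R := P.val → Circ P.cir R.cir R.val
  id P := fun x => Circ.eta P.cir x
  comp f g := fun x => Circ.bind (f x) g
  id_comp f := by funext x; simp [Circ.bind, Circ.mu, Circ.map, Circ.eta]
  comp_id f := by funext x; simp [Circ.bind, Circ.mu, Circ.map, Circ.eta]
  assoc f g h := by funext x; simp [Circ.bind, Circ.mu, Circ.map]

/-- The identity-on-objects functor `J : Set × M ⥤ Kl` of the parameterized Freyd category. -/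
def J : Type v × M ⥤ Kl.{v, u} M where
  obj P := ⟨P.1, P.2⟩
  map f := fun x => (f.1 x, f.2)
  map_id P := by funext x; rfl
  map_comp f g := by funext x; rfl

/-- The lifting of `- ⋉ S` to the Kleisli category. -/
def liftR {P R : Kl.{v, u} M} (f : P ⟶ R) (S : M) :
    (⟨P.val, P.cir * S⟩ : Kl.{v, u} M) ⟶ ⟨R.val, R.cir * S⟩ :=
  fun x => Circ.liftR (f x) S

/-- The inclusion of the category `Set × disc(Ob M)`, where values are interpreted,
into `Set × M`. -/
def valIncl : Type v × Discrete M ⥤ Type v × M := (𝟭 (Type v)).prod (Discrete.functor id)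

end Monad

/-! ### Types and contexts -/

section Types

/-- Bundle types `T, U ::= 1 | w | T ⊗ U` over a set `W` of wire types. -/
inductive BTy (W : Type w) : Type w
  | unit
  | wire (a : W)
  | tensor (T U : BTy W)

/-- Types.  The closure annotation `T` of an arrow type `A ⊸_T B` is a bundle type up to the strict
associativity and unit laws of the tensor, i.e. a word of wire types. -/
inductive Ty (W : Type w) : Type w
  | unit
  | nat
  | wire (a : W)
  | tensor (A B : Ty W)
  | bang (A : Ty W)
  | circ (T U : BTy W)
  | arrow (A B : Ty W) (T : List W)

variable {W : Type w}

/-- Bundle types are types. -/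
def BTy.toTy : BTy W → Ty W
  | .unit => .unit
  | .wire a => .wire a
  | .tensor T U => .tensor T.toTy U.toTy

/-- Parameter types `P, R ::= 1 | Nat | P ⊗ R | !A | Circ(T, U)`. -/
def Ty.IsParam : Ty W → Prop
  | .unit => True
  | .nat => True
  | .wire _ => False
  | .tensor A B => A.IsParam ∧ B.IsParam
  | .bang _ => True
  | .circ _ _ => True
  | .arrow _ _ _ => False

/-- The circuit part `♯A` of a type, as a word of wire types. -/
def Ty.sharp : Ty W → List W
  | .unit => []
  | .nat => []
  | .wire a => [a]
  | .tensor A B => A.sharp ++ B.sharp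
  | .bang _ => []
  | .circ _ _ => []
  | .arrow _ _ T => T

/-- A context entry: a label `ℓ : w`, or the variable of de Bruijn index `i` with its type.
The order of the entries in a context is independent of the indices. -/
inductive Entry (W : Type w) : Type w
  | lab (l : ℕ) (a : W)
  | var (i : ℕ) (A : Ty W)

/-- The type of a context entry. -/
def Entry.ty : Entry W → Ty W
  | .lab _ a => .wire a
  | .var _ A => A

/-- Shift the variable of an entry under `k` binders. -/
def Entry.shift (k : ℕ) : Entry W → Entry W
  | .lab l a => .lab l a
  | .var i A => .var (i + k) A

/-- (Ordered) typing contexts. -/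
abbrev Ctx (W : Type w) : Type w := List (Entry W)

/-- Shift all variables of a context under `k` binders. -/
def Ctx.shift (k : ℕ) : Ctx W → Ctx W := List.map (Entry.shift k)

/-- Parameter contexts `Φ`: all entries have a parameter type. -/
def Ctx.IsParam (Γ : Ctx W) : Prop := ∀ e ∈ Γ, e.ty.IsParam

/-- The circuit part `♯Γ` of a context. -/
def Ctx.sharp (Γ : Ctx W) : List W := Γ.flatMap fun e => e.ty.sharp

/-- Lists of labels with their wire types. -/
abbrev LabCtx (W : Type w) : Type w := List (ℕ × W)

/-- A label context has pairwise distinct labels. -/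
def LabCtx.Valid (Q : LabCtx W) : Prop := (Q.map Prod.fst).Nodup

/-- A label context as a typing context. -/
def LabCtx.toCtx (Q : LabCtx W) : Ctx W := Q.map fun p => .lab p.1 p.2

theorem Ty.IsParam.sharp_eq : {A : Ty W} → A.IsParam → A.sharp = []
  | .unit, _ => rfl
  | .nat, _ => rfl
  | .tensor A B, h => by simp [Ty.sharp, Ty.IsParam.sharp_eq h.1, Ty.IsParam.sharp_eq h.2]
  | .bang _, _ => rfl
  | .circ _ _, _ => rfl

theorem Ctx.sharp_append (Γ Δ : Ctx W) : Ctx.sharp (Γ ++ Δ) = Ctx.sharp Γ ++ Ctx.sharp Δ := by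
  simp [Ctx.sharp]

theorem Ctx.IsParam.sharp_eq {Γ : Ctx W} (h : Ctx.IsParam Γ) : Ctx.sharp Γ = [] := by
  simp only [Ctx.sharp, List.flatMap_eq_nil_iff]
  exact fun e he => (h e he).sharp_eq

theorem Ctx.sharp_shift (k : ℕ) (Γ : Ctx W) : Ctx.sharp (Ctx.shift k Γ) = Ctx.sharp Γ := by
  simp only [Ctx.sharp, Ctx.shift, List.flatMap_map]
  congr 1
  funext e
  cases e <;> rfl

theorem LabCtx.sharp_toCtx (Q : LabCtx W) : Ctx.sharp Q.toCtx = Q.map Prod.snd := by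
  induction Q with
  | nil => rfl
  | cons p Q ih =>
    simp only [Ctx.sharp, LabCtx.toCtx, List.map_cons, List.flatMap_cons] at ih ⊢
    rw [ih]
    rfl

end Types

/-! ### Interfaces and permutations -/

section Interfaces

variable {W : Type w} {M : Type u} [StrictSymmPremonoidal.{v} M] (ob : W → M)

/-- The object of `M` denoted by a word of wire types. -/
def obj : List W → M
  | [] => 1
  | a :: T => ob a * obj T

theorem obj_append (S T : List W) : obj ob (S ++ T) = obj ob S * obj ob T := by
  induction S with
  | nil => simp [obj]
  | cons a S ih => simp [obj, ih, mul_assoc]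

/-- The object `⟦Q⟧` of `M` denoted by a label context. -/
def labObj (Q : LabCtx W) : M := obj ob (Q.map Prod.snd)

theorem labObj_append (Q R : LabCtx W) : labObj ob (Q ++ R) = labObj ob Q * labObj ob R := by
  simp [labObj, obj_append]

/-- `IsPerm ob p` says that `p : ⟦Q⟧ ⟶ ⟦Q'⟧` is a permutation isomorphism between two label contexts
that agree up to order: a composite of whiskered symmetries of adjacent wires that moves every
label of `Q` to its position in `Q'`. -/
inductive IsPerm : {Q Q' : LabCtx W} → (labObj ob Q ⟶ labObj ob Q') → Prop
  | nil : IsPerm (Q := []) (Q' := []) (𝟙 _)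
  | cons (a : ℕ × W) {Q Q' : LabCtx W} {p : labObj ob Q ⟶ labObj ob Q'} :
      IsPerm p → IsPerm (Q := a :: Q) (Q' := a :: Q') (lwhisk (ob a.2) p)
  | swap (a b : ℕ × W) (Q : LabCtx W) :
      IsPerm (Q := a :: b :: Q) (Q' := b :: a :: Q)
        (eqToHom (mul_assoc (ob a.2) (ob b.2) (labObj ob Q)).symm ≫
          rwhisk (braid (ob a.2) (ob b.2)) (labObj ob Q) ≫
          eqToHom (mul_assoc (ob b.2) (ob a.2) (labObj ob Q)))
  | trans {Q Q' Q'' : LabCtx W} {p : labObj ob Q ⟶ labObj ob Q'}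
      {q : labObj ob Q' ⟶ labObj ob Q''} : IsPerm p → IsPerm q → IsPerm (p ≫ q)

/-- Circuits `D : Q → L` between label contexts are morphisms `⟦Q⟧ ⟶ ⟦L⟧` of `M`. -/
structure Circuit where
  dom : LabCtx W
  cod : LabCtx W
  hom : labObj ob dom ⟶ labObj ob cod

end Interfaces

/-! ### Grammar of the calculus -/

section Grammar

/-- Wire bundles: `* | ℓ | ⟨b, c⟩`. -/
inductive Bdl : Type
  | unit
  | lab (l : ℕ)
  | pair (b c : Bdl)

/-- Typing of wire bundles, `Q ⊢ b : T` (the value typing rules restricted to wire bundles). -/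
inductive BdlTy {W : Type w} : LabCtx W → Bdl → BTy W → Prop
  | unit : BdlTy [] .unit .unit
  | lab (l : ℕ) (a : W) : BdlTy [(l, a)] (.lab l) (.wire a)
  | pair {Q R : LabCtx W} {b c : Bdl} {T U : BTy W} :
      BdlTy Q b T → BdlTy R c U → BdlTy (Q ++ R) (.pair b c) (.tensor T U)

theorem BdlTy.map_snd {W : Type w} {Q : LabCtx W} {b : Bdl} {T : BTy W} (h : BdlTy Q b T) :
    Q.map Prod.snd = T.toTy.sharp := by
  induction h with
  | unit => rfl
  | lab l a => rfl
  | pair _ _ ih1 ih2 => simp [BTy.toTy, Ty.sharp, ih1, ih2]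

variable {W : Type w} {M : Type u} [StrictSymmPremonoidal.{v} M] (ob : W → M)

mutual

/-- Values (variables are de Bruijn indices). -/
inductive Val : Type (max v w)
  | var (i : ℕ)
  | lab (l : ℕ)
  | unit
  | nat (n : ℕ)
  | lam (A : Ty W) (N : Tm)
  | lift (N : Tm)
  | boxed (b : Bdl) (D : Circuit ob) (c : Bdl)
  | pair (V V' : Val)

/-- Terms.  `dest V N` is `let ⟨x, y⟩ = V in N`, where `y` is index `0` and `x` is index `1` of `N`;
`letin N N'` is `let x = N in N'`, where `x` is index `0` of `N'`. -/
inductive Tm : Type (max v w)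
  | app (V V' : Val)
  | force (V : Val)
  | box (T : BTy W) (V : Val)
  | apply (V V' : Val)
  | dest (V : Val) (N : Tm)
  | ifz (V : Val) (N N' : Tm)
  | ret (V : Val)
  | letin (N N' : Tm)

end

variable {ob}

/-- Wire bundles are values. -/
def Bdl.toVal : Bdl → Val ob
  | .unit => .unit
  | .lab l => .lab l
  | .pair b c => .pair b.toVal c.toVal

/-- Lift a renaming under a binder. -/
def liftRen (r : ℕ → ℕ) : ℕ → ℕ
  | 0 => 0
  | i + 1 => r i + 1

mutual

/-- Renaming of variables in values. -/
def Val.ren (r : ℕ → ℕ) : Val ob → Val ob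
  | .var i => .var (r i)
  | .lab l => .lab l
  | .unit => .unit
  | .nat n => .nat n
  | .lam A N => .lam A (N.ren (liftRen r))
  | .lift N => .lift (N.ren r)
  | .boxed b D c => .boxed b D c
  | .pair V V' => .pair (V.ren r) (V'.ren r)

/-- Renaming of variables in terms. -/
def Tm.ren (r : ℕ → ℕ) : Tm ob → Tm ob
  | .app V V' => .app (V.ren r) (V'.ren r)
  | .force V => .force (V.ren r)
  | .box T V => .box T (V.ren r)
  | .apply V V' => .apply (V.ren r) (V'.ren r)
  | .dest V N => .dest (V.ren r) (N.ren (liftRen (liftRen r)))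
  | .ifz V N N' => .ifz (V.ren r) (N.ren r) (N'.ren r)
  | .ret V => .ret (V.ren r)
  | .letin N N' => .letin (N.ren r) (N'.ren (liftRen r))

end

/-- Lift a substitution under a binder. -/
def liftSub (s : ℕ → Val ob) : ℕ → Val ob
  | 0 => .var 0
  | i + 1 => (s i).ren Nat.succ

mutual

/-- Capture-avoiding simultaneous substitution in values. -/
def Val.sub (s : ℕ → Val ob) : Val ob → Val ob
  | .var i => s i
  | .lab l => .lab l
  | .unit => .unit
  | .nat n => .nat n
  | .lam A N => .lam A (N.sub (liftSub s))
  | .lift N => .lift (N.sub s)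
  | .boxed b D c => .boxed b D c
  | .pair V V' => .pair (V.sub s) (V'.sub s)

/-- Capture-avoiding simultaneous substitution in terms. -/
def Tm.sub (s : ℕ → Val ob) : Tm ob → Tm ob
  | .app V V' => .app (V.sub s) (V'.sub s)
  | .force V => .force (V.sub s)
  | .box T V => .box T (V.sub s)
  | .apply V V' => .apply (V.sub s) (V'.sub s)
  | .dest V N => .dest (V.sub s) (N.sub (liftSub (liftSub s)))
  | .ifz V N N' => .ifz (V.sub s) (N.sub s) (N'.sub s)
  | .ret V => .ret (V.sub s)
  | .letin N N' => .letin (N.sub s) (N'.sub (liftSub s))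

end

/-- The substitution of `V` for the variable `0`. -/
def single (V : Val ob) : ℕ → Val ob
  | 0 => V
  | i + 1 => .var i

/-- The substitution of `V` for the variable `1` and of `V'` for the variable `0`. -/
def double (V V' : Val ob) : ℕ → Val ob
  | 0 => V'
  | 1 => V
  | i + 2 => .var i

end Grammar

/-! ### Typing -/

section Typing

variable {W : Type w} {M : Type u} [StrictSymmPremonoidal.{v} M] {ob : W → M}

mutual

/-- Derivations of the value judgment `Γ ⊢ V : A`. -/
inductive VTy : Ctx W → Val ob → Ty W → Type (max v w)
  | unit {Φ : Ctx W} (hΦ : Ctx.IsParam Φ) : VTy Φ .unit .unit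
  | nat {Φ : Ctx W} (hΦ : Ctx.IsParam Φ) (n : ℕ) : VTy Φ (.nat n) .nat
  | lab {Φ : Ctx W} (hΦ : Ctx.IsParam Φ) (l : ℕ) (a : W) :
      VTy (Φ ++ [.lab l a]) (.lab l) (.wire a)
  | var {Φ : Ctx W} (hΦ : Ctx.IsParam Φ) (i : ℕ) (A : Ty W) :
      VTy (Φ ++ [.var i A]) (.var i) A
  | abs {Γ : Ctx W} {A B : Ty W} {N : Tm ob} :
      CTy (Ctx.shift 1 Γ ++ [.var 0 A]) N B → VTy Γ (.lam A N) (.arrow A B (Ctx.sharp Γ))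
  | lift {Φ : Ctx W} (hΦ : Ctx.IsParam Φ) {A : Ty W} {N : Tm ob} :
      CTy Φ N A → VTy Φ (.lift N) (.bang A)
  | circ {Φ : Ctx W} (hΦ : Ctx.IsParam Φ) {b c : Bdl} {D : Circuit ob} {T U : BTy W}
      {Q L : LabCtx W} (hdom : D.dom.Valid) (hcod : D.cod.Valid)
      (hb : BdlTy Q b T) (hc : BdlTy L c U)
      (p : labObj ob Q ⟶ labObj ob D.dom) (hp : IsPerm ob p)
      (q : labObj ob D.cod ⟶ labObj ob L) (hq : IsPerm ob q) :
      VTy Φ (.boxed b D c) (.circ T U)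
  | pair {Φ Γ₁ Γ₂ : Ctx W} (hΦ : Ctx.IsParam Φ) {V V' : Val ob} {A B : Ty W} :
      VTy (Φ ++ Γ₁) V A → VTy (Φ ++ Γ₂) V' B → VTy (Φ ++ Γ₁ ++ Γ₂) (.pair V V') (.tensor A B)

/-- Derivations of the computation judgment `Γ ⊢ N : A`. -/
inductive CTy : Ctx W → Tm ob → Ty W → Type (max v w)
  | app {Φ Γ₁ Γ₂ : Ctx W} (hΦ : Ctx.IsParam Φ) {V V' : Val ob} {A B : Ty W} {T : List W} :
      VTy (Φ ++ Γ₁) V (.arrow A B T) → VTy (Φ ++ Γ₂) V' A → CTy (Φ ++ Γ₁ ++ Γ₂) (.app V V') B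
  | force {Φ : Ctx W} (hΦ : Ctx.IsParam Φ) {V : Val ob} {A : Ty W} :
      VTy Φ V (.bang A) → CTy Φ (.force V) A
  | box {Φ : Ctx W} (hΦ : Ctx.IsParam Φ) {V : Val ob} {T U : BTy W} :
      VTy Φ V (.arrow T.toTy U.toTy []) → CTy Φ (.box T V) (.circ T U)
  | apply {Φ Γ₁ Γ₂ : Ctx W} (hΦ : Ctx.IsParam Φ) {V V' : Val ob} {T U : BTy W} :
      VTy (Φ ++ Γ₁) V (.circ T U) → VTy (Φ ++ Γ₂) V' T.toTy →
      CTy (Φ ++ Γ₁ ++ Γ₂) (.apply V V') U.toTy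
  | dest {Φ Γ₁ Γ₂ : Ctx W} (hΦ : Ctx.IsParam Φ) {V : Val ob} {N : Tm ob} {A B C : Ty W} :
      VTy (Φ ++ Γ₁) V (.tensor A B) →
      CTy (Ctx.shift 2 (Φ ++ Γ₂) ++ [.var 1 A, .var 0 B]) N C →
      CTy (Φ ++ Γ₂ ++ Γ₁) (.dest V N) C
  | ifz {Φ Γ : Ctx W} (hΦ : Ctx.IsParam Φ) {V : Val ob} {N N' : Tm ob} {A : Ty W} :
      VTy Φ V .nat → CTy (Φ ++ Γ) N A → CTy (Φ ++ Γ) N' A → CTy (Φ ++ Γ) (.ifz V N N') A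
  | ret {Γ : Ctx W} {V : Val ob} {A : Ty W} : VTy Γ V A → CTy Γ (.ret V) A
  | letin {Φ Γ₁ Γ₂ : Ctx W} (hΦ : Ctx.IsParam Φ) {N N' : Tm ob} {A B : Ty W} :
      CTy (Φ ++ Γ₁) N A → CTy (Ctx.shift 1 (Φ ++ Γ₂) ++ [.var 0 A]) N' B →
      CTy (Φ ++ Γ₂ ++ Γ₁) (.letin N N') B
  | ex {Γ₁ Γ₂ : Ctx W} {a b : Entry W} {N : Tm ob} {C : Ty W} :
      CTy (Γ₁ ++ a :: b :: Γ₂) N C → CTy (Γ₁ ++ b :: a :: Γ₂) N C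

end

/-- The circuit parts of the context and of the type of a value agree. -/
theorem VTy.sharp_eq : {Γ : Ctx W} → {V : Val ob} → {A : Ty W} → VTy Γ V A →
    Ctx.sharp Γ = A.sharp
  | _, _, _, .unit hΦ => hΦ.sharp_eq
  | _, _, _, .nat hΦ _ => hΦ.sharp_eq
  | _, _, _, .lab hΦ _ _ => by rw [Ctx.sharp_append, hΦ.sharp_eq]; rfl
  | _, _, _, .var hΦ _ _ => by rw [Ctx.sharp_append, hΦ.sharp_eq]; simp [Ctx.sharp, Entry.ty]
  | _, _, _, .abs _ => rfl
  | _, _, _, .lift hΦ _ => hΦ.sharp_eq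
  | _, _, _, .circ hΦ _ _ _ _ _ _ _ _ => hΦ.sharp_eq
  | _, _, _, .pair hΦ d d' => by
      have h := VTy.sharp_eq d
      have h' := VTy.sharp_eq d'
      rw [Ctx.sharp_append, hΦ.sharp_eq, List.nil_append] at h h'
      rw [Ctx.sharp_append, Ctx.sharp_append, hΦ.sharp_eq, List.nil_append, h, h']
      rfl

end Typing

/-! ### Evaluation -/

section Evaluation

variable {W : Type w} {M : Type u} [StrictSymmPremonoidal.{v} M] {ob : W → M}

theorem BdlTy.labObj_eq (ob : W → M) {Q : LabCtx W} {b : Bdl} {T : BTy W} (h : BdlTy Q b T) :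
    labObj ob Q = obj ob T.toTy.sharp := by
  rw [labObj, h.map_snd]

/-- The morphism `⟦T⟧ ⟶ ⟦U⟧` denoted by a boxed circuit `(b, D, c)`, where `b : T` and `c : U` are
wire bundles listing the inputs and the outputs of `D`, and `p`, `q` are the permutation isomorphisms
from the order of the labels in `b` to that in `D.dom`, and from `D.cod` to that in `c`. -/
def boxHom {Q L : LabCtx W} {b c : Bdl} {D : Circuit ob} {T U : BTy W}
    (hb : BdlTy Q b T) (hc : BdlTy L c U)
    (p : labObj ob Q ⟶ labObj ob D.dom) (q : labObj ob D.cod ⟶ labObj ob L) :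
    obj ob T.toTy.sharp ⟶ obj ob U.toTy.sharp :=
  eqToHom (hb.labObj_eq ob).symm ≫ p ≫ D.hom ≫ q ≫ eqToHom (hc.labObj_eq ob)

/-- Append to `C : Q → L` a morphism `E : ⟦T⟧ ⟶ ⟦U⟧` on the wires listed by the bundle `t : T`,
leaving the remaining wires `R` untouched; the new wires are listed by the bundle `k : U`.
Here `s` rearranges `L` into `Qt, R`, and `s'` rearranges `Qk, R` into `L'`. -/
def append {Q L L' Qt Qk R : LabCtx W} {t k : Bdl} {T U : BTy W}
    (ht : BdlTy Qt t T) (hk : BdlTy Qk k U)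
    (C : labObj ob Q ⟶ labObj ob L) (s : labObj ob L ⟶ labObj ob (Qt ++ R))
    (E : obj ob T.toTy.sharp ⟶ obj ob U.toTy.sharp)
    (s' : labObj ob (Qk ++ R) ⟶ labObj ob L') : labObj ob Q ⟶ labObj ob L' :=
  C ≫ s ≫ eqToHom (by rw [labObj_append, ht.labObj_eq ob]) ≫ rwhisk E (labObj ob R) ≫
    eqToHom (by rw [labObj_append, hk.labObj_eq ob]) ≫ s'

/-- Big-step evaluation `(C, N) ⇓ (C', V)`, where `C : Q → L` and `C' : Q → L'`. -/
inductive Eval : {Q L L' : LabCtx W} → (labObj ob Q ⟶ labObj ob L) → Tm ob →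
    (labObj ob Q ⟶ labObj ob L') → Val ob → Prop
  | app {Q L L' : LabCtx W} {C : labObj ob Q ⟶ labObj ob L} {C' : labObj ob Q ⟶ labObj ob L'}
      {A : Ty W} {N : Tm ob} {V X : Val ob} :
      Eval C (N.sub (single V)) C' X → Eval C (.app (.lam A N) V) C' X
  | dest {Q L L' : LabCtx W} {C : labObj ob Q ⟶ labObj ob L} {C' : labObj ob Q ⟶ labObj ob L'}
      {N : Tm ob} {V V' X : Val ob} :
      Eval C (N.sub (double V V')) C' X → Eval C (.dest (.pair V V') N) C' X
  | force {Q L L' : LabCtx W} {C : labObj ob Q ⟶ labObj ob L} {C' : labObj ob Q ⟶ labObj ob L'}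
      {N : Tm ob} {X : Val ob} :
      Eval C N C' X → Eval C (.force (.lift N)) C' X
  | ifz_zero {Q L L' : LabCtx W} {C : labObj ob Q ⟶ labObj ob L}
      {C' : labObj ob Q ⟶ labObj ob L'} {N N' : Tm ob} {X : Val ob} :
      Eval C N C' X → Eval C (.ifz (.nat 0) N N') C' X
  | ifz_succ {Q L L' : LabCtx W} {C : labObj ob Q ⟶ labObj ob L}
      {C' : labObj ob Q ⟶ labObj ob L'} {n : ℕ} {N N' : Tm ob} {X : Val ob} :
      Eval C N' C' X → Eval C (.ifz (.nat (n + 1)) N N') C' X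
  | ret {Q L : LabCtx W} {C : labObj ob Q ⟶ labObj ob L} {V : Val ob} : Eval C (.ret V) C V
  | letin {Q L L' L'' : LabCtx W} {C : labObj ob Q ⟶ labObj ob L}
      {C' : labObj ob Q ⟶ labObj ob L'} {C'' : labObj ob Q ⟶ labObj ob L''}
      {N N' : Tm ob} {V X : Val ob} :
      Eval C N C' V → Eval C' (N'.sub (single V)) C'' X → Eval C (.letin N N') C'' X
  | box {Q L K K' : LabCtx W} {C : labObj ob Q ⟶ labObj ob L} {T : BTy W} {V : Val ob}
      {b c : Bdl} {D : labObj ob K ⟶ labObj ob K'} :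
      K.Valid → BdlTy K b T → Eval (𝟙 (labObj ob K)) (.app V b.toVal) D c.toVal →
      Eval C (.box T V) C (.boxed b ⟨K, K', D⟩ c)
  | apply {Q L L' Qb Qc Qt Qk R : LabCtx W} {C : labObj ob Q ⟶ labObj ob L}
      {b c t k : Bdl} {D : Circuit ob} {T U : BTy W}
      (hb : BdlTy Qb b T) (hc : BdlTy Qc c U) (ht : BdlTy Qt t T) (hk : BdlTy Qk k U)
      {p : labObj ob Qb ⟶ labObj ob D.dom} {q : labObj ob D.cod ⟶ labObj ob Qc}
      {s : labObj ob L ⟶ labObj ob (Qt ++ R)} {s' : labObj ob (Qk ++ R) ⟶ labObj ob L'} :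
      IsPerm ob p → IsPerm ob q → IsPerm ob s → IsPerm ob s' → L'.Valid →
      Eval C (.apply (.boxed b D c) t.toVal) (append ht hk C s (boxHom hb hc p q) s') k.toVal

/-- Derivations of `Q ⊢ (C, N) : A; Q'` for a configuration with `C : Q → L₀`: up to a permutation of
its outputs, `C` goes from `Q` to `L, Q'` for a label context `L` such that `L ⊢ N : A`. -/
structure ConfigTy {Q L₀ : LabCtx W} (C : labObj ob Q ⟶ labObj ob L₀) (N : Tm ob) (A : Ty W)
    (Q' : LabCtx W) where
  valid_dom : Q.Valid
  valid_cod : L₀.Valid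
  L : LabCtx W
  perm : labObj ob L₀ ⟶ labObj ob (L ++ Q')
  isPerm : IsPerm ob perm
  typing : CTy L.toCtx N A

/-- Derivations of `Q ⊢ (C, V) : A; Q'` for a configuration whose second component is a value. -/
structure ValConfigTy {Q L₀ : LabCtx W} (C : labObj ob Q ⟶ labObj ob L₀) (V : Val ob) (A : Ty W)
    (Q' : LabCtx W) where
  valid_dom : Q.Valid
  valid_cod : L₀.Valid
  L : LabCtx W
  perm : labObj ob L₀ ⟶ labObj ob (L ++ Q')
  isPerm : IsPerm ob perm
  typing : VTy L.toCtx V A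

end Evaluation

/-! ### Interpretation -/

section Interpretation

variable {W : Type w} {M : Type u} [StrictSymmPremonoidal.{v} M] (ob : W → M)

/-- The parameter part `♭⟦A⟧` of a type.  The circuit part `♯⟦A⟧` is `obj ob A.sharp`. -/
def flat : Ty W → Type v
  | .unit => PUnit
  | .nat => ULift ℕ
  | .wire _ => PUnit
  | .tensor A B => flat A × flat B
  | .bang A => PUnit.{v + 1} → Circ 1 (obj ob A.sharp) (flat A)
  | .circ T U => (obj ob T.toTy.sharp ⟶ obj ob U.toTy.sharp)
  | .arrow A B T => flat A → Circ (obj ob T * obj ob A.sharp) (obj ob B.sharp) (flat B)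

/-- The unique element of the parameter part of a bundle type. -/
def BTy.pt : (T : BTy W) → flat ob T.toTy
  | .unit => PUnit.unit
  | .wire _ => PUnit.unit
  | .tensor T U => (BTy.pt T, BTy.pt U)

/-- The parameter part `♭⟦Γ⟧` of a context: the product of the parameter parts of its entries. -/
def flatCtx : Ctx W → Type v
  | [] => PUnit
  | e :: Γ => flat ob e.ty × flatCtx Γ

variable {ob}

/-- `♭⟦Γ⟧ × ♭⟦Δ⟧ → ♭⟦Γ, Δ⟧`. -/
def join : {Γ Δ : Ctx W} → flatCtx ob Γ → flatCtx ob Δ → flatCtx ob (Γ ++ Δ)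
  | [], _, _, y => y
  | _ :: _, _, x, y => (x.1, join x.2 y)

/-- `♭⟦Γ, Δ⟧ → ♭⟦Γ⟧ × ♭⟦Δ⟧`. -/
def split : {Γ Δ : Ctx W} → flatCtx ob (Γ ++ Δ) → flatCtx ob Γ × flatCtx ob Δ
  | [], _, x => (PUnit.unit, x)
  | _ :: _, _, x => ((x.1, (split x.2).1), (split x.2).2)

/-- Shifting variables does not change the parameter part of a context. -/
def shiftEnv (k : ℕ) : {Γ : Ctx W} → flatCtx ob Γ → flatCtx ob (Ctx.shift k Γ)
  | [], _ => PUnit.unit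
  | .lab _ _ :: _, x => (x.1, shiftEnv k x.2)
  | .var _ _ :: _, x => (x.1, shiftEnv k x.2)

/-- The unique element of the parameter part of a label context. -/
def labEnv : (Q : LabCtx W) → flatCtx ob Q.toCtx
  | [] => PUnit.unit
  | _ :: Q => (PUnit.unit, labEnv Q)

/-- The isomorphism `♭⟦T ⊸_I U⟧ ≅ M(⟦T⟧, ⟦U⟧)`, from left to right. -/
def boxMap {T U : BTy W} (f : flat ob (.arrow T.toTy U.toTy [])) : flat ob (.circ T U) :=
  eqToHom (one_mul _).symm ≫ (f (BTy.pt ob T)).2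

mutual

/-- The function `♭⟦Γ⟧ → ♭⟦A⟧` that is the `Set` component of the interpretation of a value. -/
def VTy.fn : {Γ : Ctx W} → {V : Val ob} → {A : Ty W} → VTy Γ V A → flatCtx ob Γ → flat ob A
  | _, _, _, .unit _ => fun _ => PUnit.unit
  | _, _, _, .nat _ n => fun _ => ULift.up n
  | _, _, _, .lab _ _ _ => fun _ => PUnit.unit
  | _, _, _, .var (Φ := Φ) _ i A => fun x => (split (Γ := Φ) (Δ := [.var i A]) x).2.1
  | _, _, _, .abs (Γ := Γ) (A := A) d => fun x a =>
      Circ.pre (eqToHom (by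
          change obj ob (Ctx.sharp Γ) * obj ob A.sharp =
            obj ob (Ctx.sharp (Ctx.shift 1 Γ ++ [.var 0 A]))
          rw [Ctx.sharp_append, Ctx.sharp_shift, obj_append]
          simp [Ctx.sharp, Entry.ty]))
        (d.sem (join (Δ := [.var 0 A]) (shiftEnv 1 x) (a, PUnit.unit)))
  | _, _, _, .lift hΦ d => fun x _ => Circ.pre (eqToHom (by simp [hΦ.sharp_eq, obj])) (d.sem x)
  | _, _, _, .circ _ _ _ hb hc p _ q _ => fun _ => boxHom hb hc p q
  | _, _, _, .pair (Φ := Φ) (Γ₁ := Γ₁) (Γ₂ := Γ₂) _ d d' => fun x =>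
      let y := split (Γ := Φ ++ Γ₁) (Δ := Γ₂) x
      let z := split (Γ := Φ) (Δ := Γ₁) y.1
      (d.fn y.1, d'.fn (join z.1 y.2))

/-- The interpretation of a computation judgment, a morphism
`(♭⟦Γ⟧, ♯⟦Γ⟧) ⟶ (♭⟦A⟧, ♯⟦A⟧)` of the Kleisli category of the circuit monad. -/
def CTy.sem : {Γ : Ctx W} → {N : Tm ob} → {A : Ty W} → CTy Γ N A →
    ((⟨flatCtx ob Γ, obj ob (Ctx.sharp Γ)⟩ : Kl.{v, u} M) ⟶ ⟨flat ob A, obj ob A.sharp⟩)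
  | _, _, _, .app (Φ := Φ) (Γ₁ := Γ₁) (Γ₂ := Γ₂) hΦ d d' => fun x =>
      let y := split (Γ := Φ ++ Γ₁) (Δ := Γ₂) x
      let z := split (Γ := Φ) (Δ := Γ₁) y.1
      Circ.pre (eqToHom (by
          have h := d.sharp_eq
          have h' := d'.sharp_eq
          rw [Ctx.sharp_append, hΦ.sharp_eq, List.nil_append] at h'
          rw [Ctx.sharp_append, h, h', obj_append]
          rfl))
        (d.fn y.1 (d'.fn (join z.1 y.2)))
  | _, _, _, .force hΦ d => fun x =>
      Circ.pre (eqToHom (by simp [hΦ.sharp_eq, obj])) (d.fn x PUnit.unit)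
  | _, _, _, .box hΦ d => fun x =>
      Circ.pre (eqToHom (by simp [hΦ.sharp_eq, Ty.sharp])) (Circ.eta _ (boxMap (d.fn x)))
  | _, _, _, .apply (Φ := Φ) (Γ₁ := Γ₁) (Γ₂ := Γ₂) (U := U) hΦ d d' => fun x =>
      let y := split (Γ := Φ ++ Γ₁) (Δ := Γ₂) x
      (BTy.pt ob U, eqToHom (by
          have h := d.sharp_eq
          have h' := d'.sharp_eq
          rw [Ctx.sharp_append, hΦ.sharp_eq, List.nil_append] at h'
          rw [Ctx.sharp_append, h, h']
          rfl) ≫ d.fn y.1)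
  | _, _, _, .dest (Φ := Φ) (Γ₁ := Γ₁) (Γ₂ := Γ₂) (A := A) (B := B) hΦ d d' => fun x =>
      let y := split (Γ := Φ ++ Γ₂) (Δ := Γ₁) x
      let z := split (Γ := Φ) (Δ := Γ₂) y.1
      let a := d.fn (join z.1 y.2)
      Circ.pre (eqToHom (by
          have h := d.sharp_eq
          rw [Ctx.sharp_append, hΦ.sharp_eq, List.nil_append] at h
          change obj ob (Ctx.sharp (Φ ++ Γ₂ ++ Γ₁)) =
            obj ob (Ctx.sharp (Ctx.shift 2 (Φ ++ Γ₂) ++ [.var 1 A, .var 0 B]))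
          rw [Ctx.sharp_append (Φ ++ Γ₂), h, Ctx.sharp_append (Ctx.shift 2 _), Ctx.sharp_shift]
          simp [Ctx.sharp, Entry.ty, Ty.sharp]))
        (d'.sem (join (Δ := [.var 1 A, .var 0 B]) (shiftEnv 2 y.1) (a.1, a.2, PUnit.unit)))
  | _, _, _, .ifz (Φ := Φ) (Γ := Γ) _ d d₁ d₂ => fun x =>
      match (d.fn (split (Γ := Φ) (Δ := Γ) x).1).down with
      | 0 => d₁.sem x
      | _ + 1 => d₂.sem x
  | _, _, _, .ret d => fun x => Circ.pre (eqToHom (by rw [d.sharp_eq])) (Circ.eta _ (d.fn x))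
  | _, _, _, .letin (Φ := Φ) (Γ₁ := Γ₁) (Γ₂ := Γ₂) (A := A) hΦ d d' => fun x =>
      let y := split (Γ := Φ ++ Γ₂) (Δ := Γ₁) x
      let z := split (Γ := Φ) (Δ := Γ₂) y.1
      Circ.pre (eqToHom (by simp [Ctx.sharp_append, hΦ.sharp_eq, obj_append]))
        (Circ.bind (Circ.liftL (obj ob (Ctx.sharp Γ₂)) (d.sem (join z.1 y.2))) fun a =>
          Circ.pre (eqToHom (by
              rw [Ctx.sharp_append, Ctx.sharp_shift, Ctx.sharp_append, hΦ.sharp_eq,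
                List.nil_append, obj_append]
              simp [Ctx.sharp, Entry.ty]))
            (d'.sem (join (Δ := [.var 0 A]) (shiftEnv 1 y.1) (a, PUnit.unit))))
  | _, _, _, .ex (Γ₁ := Γ₁) (Γ₂ := Γ₂) (a := a) (b := b) d => fun x =>
      let y := split (Γ := Γ₁) (Δ := b :: a :: Γ₂) x
      Circ.pre
        (eqToHom (by simp [Ctx.sharp, obj_append, mul_assoc]) ≫
          lwhisk (obj ob (Ctx.sharp Γ₁))
            (rwhisk (braid (obj ob b.ty.sharp) (obj ob a.ty.sharp)) (obj ob (Ctx.sharp Γ₂))) ≫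
          eqToHom (by simp [Ctx.sharp, obj_append, mul_assoc]))
        (d.sem (join (Δ := a :: b :: Γ₂) y.1 (y.2.2.1, y.2.1, y.2.2.2)))

end

/-- The interpretation of a value judgment, a morphism `(♭⟦Γ⟧, ♯⟦Γ⟧) ⟶ (♭⟦A⟧, ♯⟦A⟧)` of
`Set × disc(Ob M)`. -/
def VTy.sem {Γ : Ctx W} {V : Val ob} {A : Ty W} (d : VTy Γ V A) :
    ((flatCtx ob Γ, ⟨obj ob (Ctx.sharp Γ)⟩) : Type v × Discrete M) ⟶
      (flat ob A, ⟨obj ob A.sharp⟩) :=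
  (TypeCat.ofHom d.fn, Discrete.eqToHom (by rw [d.sharp_eq]))

/-- The morphism `(1, ⟦Q⟧) ⟶ (♭⟦L⟧, ♯⟦L⟧ ⊗ ⟦Q'⟧)` of `Set × M` given by a circuit
`Q → L, Q'`. -/
def circuitMap {Q L Q' : LabCtx W} (C : labObj ob Q ⟶ labObj ob (L ++ Q')) :
    ((PUnit.{v + 1}, labObj ob Q) : Type v × M) ⟶
      (flatCtx ob L.toCtx, obj ob (Ctx.sharp L.toCtx) * labObj ob Q') :=
  (TypeCat.ofHom fun _ => labEnv L,
    C ≫ eqToHom (by rw [labObj_append, LabCtx.sharp_toCtx]; rfl))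

/-- `⟦(C, N)⟧ = J(1, C; perm); (⟦N⟧ ⋉ ⟦Q'⟧)`, a morphism of the Kleisli category. -/
def ConfigTy.sem {Q L₀ Q' : LabCtx W} {C : labObj ob Q ⟶ labObj ob L₀} {N : Tm ob} {A : Ty W}
    (d : ConfigTy C N A Q') :
    J.obj (PUnit.{v + 1}, labObj ob Q) ⟶ J.obj (flat ob A, obj ob A.sharp * labObj ob Q') :=
  J.map (circuitMap (C ≫ d.perm)) ≫ liftR d.typing.sem (labObj ob Q')

/-- `⟦(C, V)⟧ = (1, C; perm); (⟦V⟧ ⋉ ⟦Q'⟧)`, a morphism of `Set × M`. -/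
def ValConfigTy.sem {Q L₀ Q' : LabCtx W} {C : labObj ob Q ⟶ labObj ob L₀} {V : Val ob}
    {A : Ty W} (d : ValConfigTy C V A Q') :
    ((PUnit.{v + 1}, labObj ob Q) : Type v × M) ⟶ (flat ob A, obj ob A.sharp * labObj ob Q') :=
  circuitMap (C ≫ d.perm) ≫
    ((valIncl.map d.typing.sem).1, rwhisk (valIncl.map d.typing.sem).2 (labObj ob Q'))

end Interpretation

end ProtoQuipperC

namespace ProtoQuipperC

open StrictSymmPremonoidal

section Premonoidal

variable {M : Type u} [StrictSymmPremonoidal.{v} M]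

theorem heq_iff_eqToHom {X Y X' Y' : M} {f : X ⟶ Y} {g : X' ⟶ Y'} (hX : X = X') (hY : Y = Y') :
    f ≍ g ↔ f = eqToHom hX ≫ g ≫ eqToHom hY.symm := by
  subst hX hY; simp

@[simp] theorem lwhisk_eqToHom (X : M) {Y Z : M} (h : Y = Z) :
    lwhisk X (eqToHom h) = eqToHom (by rw [h]) := by
  subst h; simp [lwhisk_id]

@[simp] theorem rwhisk_eqToHom (X : M) {Y Z : M} (h : Y = Z) :
    rwhisk (eqToHom h) X = eqToHom (by rw [h]) := by
  subst h; simp [rwhisk_id]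

theorem one_lwhisk_eq {Y Z : M} (f : Y ⟶ Z) :
    lwhisk 1 f = eqToHom (one_mul Y) ≫ f ≫ eqToHom (one_mul Z).symm :=
  (heq_iff_eqToHom _ (one_mul Z)).1 (one_lwhisk f)

theorem rwhisk_one_eq {Y Z : M} (f : Y ⟶ Z) :
    rwhisk f 1 = eqToHom (mul_one Y) ≫ f ≫ eqToHom (mul_one Z).symm :=
  (heq_iff_eqToHom _ (mul_one Z)).1 (rwhisk_one f)

theorem mul_lwhisk_eq (X X' : M) {Y Z : M} (f : Y ⟶ Z) :
    lwhisk (X * X') f =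
      eqToHom (mul_assoc X X' Y) ≫ lwhisk X (lwhisk X' f) ≫ eqToHom (mul_assoc X X' Z).symm :=
  (heq_iff_eqToHom _ (mul_assoc X X' Z)).1 (mul_lwhisk X X' f)

theorem rwhisk_mul_eq (X X' : M) {Y Z : M} (f : Y ⟶ Z) :
    rwhisk f (X * X') =
      eqToHom (mul_assoc Y X X').symm ≫ rwhisk (rwhisk f X) X' ≫ eqToHom (mul_assoc Z X X') :=
  (heq_iff_eqToHom _ (mul_assoc Z X X').symm).1 (rwhisk_mul X X' f)

theorem rwhisk_lwhisk_eq (X X' : M) {Y Z : M} (f : Y ⟶ Z) :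
    rwhisk (lwhisk X f) X' =
      eqToHom (mul_assoc X Y X') ≫ lwhisk X (rwhisk f X') ≫ eqToHom (mul_assoc X Z X').symm :=
  (heq_iff_eqToHom _ (mul_assoc X Z X')).1 (lwhisk_rwhisk X X' f)

theorem lwhisk_congr {X X' : M} (h : X = X') {Y Z : M} (f : Y ⟶ Z) :
    lwhisk X f = eqToHom (by rw [h]) ≫ lwhisk X' f ≫ eqToHom (by rw [h]) := by
  subst h; simp

/-- The symmetry of two adjacent wires `X`, `Y` in front of `Z`. -/
def sw (X Y Z : M) : X * (Y * Z) ⟶ Y * (X * Z) :=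
  eqToHom (mul_assoc X Y Z).symm ≫ rwhisk (braid X Y) Z ≫ eqToHom (mul_assoc Y X Z)

theorem sw_congr {X X' Y Y' Z Z' : M} (h : X = X') (h' : Y = Y') (h'' : Z = Z') :
    sw X Y Z = eqToHom (by rw [h, h', h'']) ≫ sw X' Y' Z' ≫ eqToHom (by rw [h, h', h'']) := by
  subst h h' h''; simp

theorem sw_sw (X Y Z : M) : sw X Y Z ≫ sw Y X Z = 𝟙 _ := by
  have h := congrArg (fun f => rwhisk f Z) (braid_braid X Y)
  simp only [rwhisk_comp, rwhisk_id] at h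
  simp [sw, reassoc_of% h]

theorem sw_sw_assoc (X Y Z : M) {R : M} (f : X * (Y * Z) ⟶ R) :
    sw X Y Z ≫ sw Y X Z ≫ f = f := by
  rw [← Category.assoc, sw_sw, Category.id_comp]

theorem sw_natural (X Y : M) {Z Z' : M} (f : Z ⟶ Z') :
    lwhisk X (lwhisk Y f) ≫ sw X Y Z' = sw X Y Z ≫ lwhisk Y (lwhisk X f) := by
  have h := braid_central_left X Y f
  rw [mul_lwhisk_eq, mul_lwhisk_eq] at h
  have h' := congrArg (fun g => eqToHom (mul_assoc X Y Z).symm ≫ g ≫ eqToHom (mul_assoc Y X Z')) h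
  simp only [Category.assoc, eqToHom_trans, eqToHom_refl, Category.comp_id,
    eqToHom_trans_assoc, Category.id_comp] at h'
  simp only [sw, Category.assoc]
  exact h'.symm

theorem sw_natural_left {X X' : M} (f : X ⟶ X') (Y Z : M) :
    rwhisk f (Y * Z) ≫ sw X' Y Z = sw X Y Z ≫ lwhisk Y (rwhisk f Z) := by
  have h := congrArg (fun g => rwhisk g Z) (braid_naturality f Y)
  simp only [rwhisk_comp, rwhisk_lwhisk_eq] at h
  simp only [sw, rwhisk_mul_eq, Category.assoc, eqToHom_trans_assoc, eqToHom_refl,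
    Category.id_comp]
  rw [reassoc_of% h]
  simp

theorem sw_natural_right {Y Y' : M} (f : Y ⟶ Y') (X Z : M) :
    lwhisk X (rwhisk f Z) ≫ sw X Y' Z = sw X Y Z ≫ rwhisk f (X * Z) := by
  have h := congrArg (fun g => sw X Y Z ≫ g ≫ sw X Y' Z) (sw_natural_left f X Z)
  simp only [Category.assoc, sw_sw, sw_sw_assoc, Category.comp_id] at h
  exact h.symm

theorem sw_mul_right (X Y Y' Z : M) :
    sw X (Y * Y') Z = eqToHom (by simp only [mul_assoc]) ≫ sw X Y (Y' * Z) ≫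
      lwhisk Y (sw X Y' Z) ≫ eqToHom (by simp only [mul_assoc]) := by
  simp only [sw, hexagon, rwhisk_comp, lwhisk_comp, rwhisk_eqToHom, lwhisk_eqToHom,
    rwhisk_mul_eq, rwhisk_lwhisk_eq, Category.assoc, eqToHom_trans, eqToHom_trans_assoc]

theorem sw_mul_left (X X' Y Z : M) :
    sw (X * X') Y Z = eqToHom (by simp only [mul_assoc]) ≫ lwhisk X (sw X' Y Z) ≫
      sw X Y (X' * Z) ≫ eqToHom (by simp only [mul_assoc]) := by
  have h := sw_mul_right Y X X' Z
  have h1 : sw (X * X') Y Z ≫ sw Y (X * X') Z ≫ eqToHom (by simp only [mul_assoc]) ≫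
      lwhisk X (sw X' Y Z) ≫ sw X Y (X' * Z) =
        sw (X * X') Y Z ≫ eqToHom (by simp only [mul_assoc]) := by
    rw [h]
    have h2 := congrArg (lwhisk X) (sw_sw Y X' Z)
    rw [lwhisk_comp, lwhisk_id] at h2
    simp [reassoc_of% h2, sw_sw]
  rw [sw_sw_assoc] at h1
  calc _ = (sw (X * X') Y Z ≫ eqToHom (by simp only [mul_assoc] : _ = Y * (X * (X' * Z)))) ≫
        eqToHom (by simp only [mul_assoc]) := by simp
    _ = _ := by rw [← h1]; simp

theorem rwhisk_braid_eq (X Y Z : M) :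
    rwhisk (braid X Y) Z =
      eqToHom (mul_assoc X Y Z) ≫ sw X Y Z ≫ eqToHom (mul_assoc Y X Z).symm := by
  simp [sw]

theorem yang_baxter (X Y Z R : M) :
    sw X Y (Z * R) ≫ lwhisk Y (sw X Z R) ≫ sw Y Z (X * R) =
      lwhisk X (sw Y Z R) ≫ sw X Z (Y * R) ≫ lwhisk Z (sw X Y R) := by
  have h := sw_natural_right (braid Y Z) X R
  rw [sw_mul_right, sw_mul_right, rwhisk_braid_eq, rwhisk_braid_eq] at h
  simp only [lwhisk_comp, Category.assoc, eqToHom_trans_assoc, lwhisk_eqToHom,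
    eqToHom_comp_iff, eqToHom_refl, Category.id_comp] at h
  simp only [← Category.assoc, cancel_mono] at h
  simpa using h.symm

theorem sw_one_right (X Z : M) : sw X 1 Z = eqToHom (by simp only [one_mul]) := by
  have h := sw_mul_right X 1 1 Z
  rw [sw_congr rfl (one_mul (1 : M)) rfl, sw_congr (X := X) (Z := 1 * Z) rfl rfl (one_mul Z),
    one_lwhisk_eq] at h
  have h1 : sw X 1 Z ≫ 𝟙 _ = sw X 1 Z ≫ eqToHom (by simp only [one_mul]) ≫ sw X 1 Z ≫
      eqToHom (by simp only [one_mul]) := by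
    simp only [Category.assoc, eqToHom_trans_assoc, eqToHom_comp_iff, eqToHom_refl,
      Category.id_comp] at h
    rw [comp_eqToHom_iff] at h
    rw [Category.comp_id]
    refine h.trans ?_
    simp
  have h2 := congrArg (fun f => sw 1 X Z ≫ f) h1
  simp only [sw_sw_assoc] at h2
  rw [eq_comm, eqToHom_comp_iff, comp_eqToHom_iff] at h2
  simpa using h2

theorem sw_one_left (Y Z : M) : sw 1 Y Z = eqToHom (by simp only [one_mul]) := by
  have h := sw_sw Y 1 Z
  rw [sw_one_right] at h
  simpa [eqToHom_comp_iff] using h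

theorem extract_there (A : M) {B Z Z' Z₀ Z₀' : M} {p : Z ⟶ Z'} {e : Z ⟶ B * Z₀} {e' : Z' ⟶ B * Z₀'}
    {p' : Z₀ ⟶ Z₀'} (h : p ≫ e' = e ≫ lwhisk B p') :
    lwhisk A p ≫ lwhisk A e' ≫ sw A B Z₀' =
      (lwhisk A e ≫ sw A B Z₀) ≫ lwhisk B (lwhisk A p') := by
  rw [Category.assoc, ← sw_natural, ← Category.assoc, ← lwhisk_comp, h, lwhisk_comp, Category.assoc]

theorem extract_swap_fst (X Y Z : M) :
    sw X Y Z ≫ lwhisk Y (𝟙 (X * Z)) ≫ sw Y X Z = 𝟙 _ ≫ lwhisk X (𝟙 (Y * Z)) := by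
  simp [lwhisk_id, sw_sw]

theorem extract_swap_snd (X Y Z : M) :
    sw X Y Z ≫ 𝟙 _ = (lwhisk X (𝟙 (Y * Z)) ≫ sw X Y Z) ≫ lwhisk Y (𝟙 (X * Z)) := by
  simp [lwhisk_id]

theorem extract_swap (X Y : M) {B Z Z₀ : M} (e : Z ⟶ B * Z₀) :
    sw X Y Z ≫ lwhisk Y (lwhisk X e ≫ sw X B Z₀) ≫ sw Y B (X * Z₀) =
      (lwhisk X (lwhisk Y e ≫ sw Y B Z₀) ≫ sw X B (Y * Z₀)) ≫ lwhisk B (sw X Y Z₀) := by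
  simp only [lwhisk_comp, Category.assoc]
  rw [← yang_baxter, ← Category.assoc, ← sw_natural, Category.assoc]

/-- A morphism is central when it interchanges with every morphism on its left. -/
def Central {X Y : M} (p : X ⟶ Y) : Prop :=
  ∀ ⦃A B : M⦄ (f : A ⟶ B), lwhisk A p ≫ rwhisk f Y = rwhisk f X ≫ lwhisk B p

theorem Central.id (X : M) : Central (𝟙 X) := fun A B f => by simp [lwhisk_id]

theorem Central.comp {X Y Z : M} {p : X ⟶ Y} {q : Y ⟶ Z} (hp : Central p) (hq : Central q) :
    Central (p ≫ q) := fun A B f => by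
  rw [lwhisk_comp, Category.assoc, hq, ← Category.assoc, hp, Category.assoc, lwhisk_comp]

theorem Central.eqToHom {X Y : M} (h : X = Y) : Central (eqToHom h) := by
  subst h; exact .id X

theorem Central.braid (X Y : M) : Central (braid X Y) := fun A _ f =>
  braid_central_right X Y (A := A) f

theorem Central.lwhisk {X Y : M} {p : X ⟶ Y} (hp : Central p) (Z : M) :
    Central (lwhisk Z p) := fun A B f => by
  have h := hp (rwhisk f Z)
  rw [mul_lwhisk_eq, mul_lwhisk_eq] at h
  rw [rwhisk_mul_eq, rwhisk_mul_eq]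
  simp only [Category.assoc, eqToHom_comp_iff] at h
  rw [← cancel_mono (CategoryTheory.eqToHom (mul_assoc B Z Y).symm)]
  simp only [Category.assoc, eqToHom_trans, eqToHom_refl, Category.comp_id]
  rw [h]

theorem Central.rwhisk {X Y : M} {p : X ⟶ Y} (hp : Central p) (Z : M) :
    Central (rwhisk p Z) := fun A B f => by
  have h := congrArg (fun g => StrictSymmPremonoidal.rwhisk g Z) (hp f)
  simp only [rwhisk_comp, rwhisk_lwhisk_eq, Category.assoc, eqToHom_comp_iff] at h
  rw [rwhisk_mul_eq, rwhisk_mul_eq]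
  rw [← cancel_mono (CategoryTheory.eqToHom (mul_assoc B Y Z).symm)]
  simp only [Category.assoc, eqToHom_trans, eqToHom_refl, Category.comp_id]
  rw [h]

theorem Central.sw (X Y Z : M) : Central (sw X Y Z) :=
  (Central.eqToHom _).comp (((Central.braid X Y).rwhisk Z).comp (.eqToHom _))

end Premonoidal

section Permutations

variable {W : Type w} {M : Type u} [StrictSymmPremonoidal.{v} M] {ob : W → M}

theorem IsPerm.refl : (Q : LabCtx W) → IsPerm ob (𝟙 (labObj ob Q))
  | [] => .nil
  | a :: Q => by
      have h := IsPerm.cons a (IsPerm.refl Q)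
      exact (lwhisk_id (ob a.2) (labObj ob Q)) ▸ h

theorem IsPerm.eqToHom {Q Q' : LabCtx W} (h : Q = Q') :
    IsPerm ob (eqToHom (by rw [h]) : labObj ob Q ⟶ labObj ob Q') := by
  subst h; exact .refl Q

theorem IsPerm.listPerm {Q Q' : LabCtx W} {p : labObj ob Q ⟶ labObj ob Q'} (h : IsPerm ob p) :
    Q.Perm Q' := by
  induction h with
  | nil => exact .nil
  | cons a _ ih => exact ih.cons a
  | swap a b Q => exact .swap b a Q
  | trans _ _ ih1 ih2 => exact ih1.trans ih2

variable (ob) in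
theorem exists_isPerm {Q Q' : LabCtx W} (h : Q.Perm Q') :
    ∃ p : labObj ob Q ⟶ labObj ob Q', IsPerm ob p := by
  induction h with
  | nil => exact ⟨_, .nil⟩
  | cons a _ ih => exact ⟨_, ih.choose_spec.cons a⟩
  | swap a b Q => exact ⟨_, .swap b a Q⟩
  | trans _ _ ih1 ih2 => exact ⟨_, ih1.choose_spec.trans ih2.choose_spec⟩

theorem IsPerm.exists_inv {Q Q' : LabCtx W} {p : labObj ob Q ⟶ labObj ob Q'} (h : IsPerm ob p) :
    ∃ q : labObj ob Q' ⟶ labObj ob Q, IsPerm ob q ∧ p ≫ q = 𝟙 _ := by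
  induction h with
  | nil => exact ⟨_, .nil, by simp⟩
  | cons a _ ih =>
    obtain ⟨q, hq, e⟩ := ih
    exact ⟨_, hq.cons a,
      (lwhisk_comp _ _ _).symm.trans ((congrArg _ e).trans (lwhisk_id _ _))⟩
  | swap a b Q => exact ⟨_, .swap b a Q, sw_sw _ _ _⟩
  | trans _ _ ih1 ih2 =>
    obtain ⟨q1, hq1, e1⟩ := ih1
    obtain ⟨q2, hq2, e2⟩ := ih2
    exact ⟨_, hq2.trans hq1, by rw [Category.assoc, reassoc_of% e2, e1]⟩

/-- `Extract b Q Q₀ e` says that `Q₀` is `Q` without one occurrence of `b`, and that `e` moves the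
wire of this occurrence to the front. -/
inductive Extract (ob : W → M) (b : ℕ × W) :
    (Q Q₀ : LabCtx W) → (labObj ob Q ⟶ ob b.2 * labObj ob Q₀) → Prop
  | here (Q : LabCtx W) : Extract ob b (b :: Q) Q (𝟙 _)
  | there (a : ℕ × W) {Q Q₀ : LabCtx W} {e : labObj ob Q ⟶ ob b.2 * labObj ob Q₀} :
      Extract ob b Q Q₀ e →
      Extract ob b (a :: Q) (a :: Q₀) (lwhisk (ob a.2) e ≫ sw (ob a.2) (ob b.2) (labObj ob Q₀))

theorem Extract.mem {b : ℕ × W} {Q Q₀ : LabCtx W} {e : labObj ob Q ⟶ ob b.2 * labObj ob Q₀}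
    (h : Extract ob b Q Q₀ e) : b ∈ Q := by
  induction h with
  | here => simp
  | there a _ ih => simp [ih]

theorem Extract.exists_of_mem {b : ℕ × W} : {Q : LabCtx W} → b ∈ Q →
    ∃ (Q₀ : LabCtx W) (e : labObj ob Q ⟶ ob b.2 * labObj ob Q₀), Extract ob b Q Q₀ e
  | a :: Q, h => by
      rcases List.mem_cons.1 h with rfl | h
      · exact ⟨_, _, .here Q⟩
      · obtain ⟨Q₀, e, he⟩ := Extract.exists_of_mem h
        exact ⟨_, _, .there a he⟩

theorem IsPerm.extract {Q Q' : LabCtx W} {p : labObj ob Q ⟶ labObj ob Q'} (h : IsPerm ob p)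
    {b : ℕ × W} {Q₀ : LabCtx W} {e : labObj ob Q ⟶ ob b.2 * labObj ob Q₀}
    (he : Extract ob b Q Q₀ e) :
    ∃ (Q₀' : LabCtx W) (e' : labObj ob Q' ⟶ ob b.2 * labObj ob Q₀')
      (p' : labObj ob Q₀ ⟶ labObj ob Q₀'),
      Extract ob b Q' Q₀' e' ∧ IsPerm ob p' ∧ p ≫ e' = e ≫ lwhisk (ob b.2) p' := by
  induction h generalizing Q₀ with
  | nil => cases he
  | cons a hp ih =>
    cases he with
    | here Q => exact ⟨_, _, _, .here _, hp,
        (Category.comp_id _).trans (Category.id_comp _).symm⟩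
    | there _ he =>
      obtain ⟨Q₀', e', p', he', hp', h⟩ := ih he
      exact ⟨_, _, _, .there a he', hp'.cons a, extract_there _ h⟩
  | swap a c Q =>
    cases he with
    | here => exact ⟨_, _, _, .there c (.here Q), .refl _, extract_swap_fst _ _ _⟩
    | there _ he =>
      cases he with
      | here => exact ⟨_, _, _, .here _, .refl _, extract_swap_snd _ _ _⟩
      | there _ he => exact ⟨_, _, _, .there c (.there a he), .swap a c _, extract_swap _ _ _⟩
  | trans _ _ ih1 ih2 =>
    obtain ⟨Q₁, e₁, p₁, he₁, hp₁, h₁⟩ := ih1 he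
    obtain ⟨Q₂, e₂, p₂, he₂, hp₂, h₂⟩ := ih2 he₁
    exact ⟨_, _, _, he₂, hp₁.trans hp₂, by
      rw [Category.assoc, h₂, reassoc_of% h₁, lwhisk_comp]⟩

theorem IsPerm.eq_id_of_nil {Q Q' : LabCtx W} {p : labObj ob Q ⟶ labObj ob Q'} (hp : IsPerm ob p)
    (hQ : Q = []) (hQ' : Q' = []) : p = CategoryTheory.eqToHom (by rw [hQ, hQ']) := by
  induction hp with
  | nil => rfl
  | cons => cases hQ
  | swap => cases hQ
  | trans h _ ih1 ih2 =>
    subst hQ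
    rw [ih1 rfl h.listPerm.nil_eq.symm, ih2 h.listPerm.nil_eq.symm hQ', eqToHom_trans]

/-- Coherence: a permutation isomorphism between lists without repetitions is determined by its
source and its target. -/
theorem IsPerm.unique_of_nodup {Q Q' : LabCtx W} (hQ : Q'.Nodup) {p q : labObj ob Q ⟶ labObj ob Q'}
    (hp : IsPerm ob p) (hq : IsPerm ob q) : p = q := by
  induction Q' generalizing Q with
  | nil =>
    obtain rfl := hp.listPerm.eq_nil
    rw [hp.eq_id_of_nil rfl rfl, hq.eq_id_of_nil rfl rfl]
  | cons b R ih =>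
    have hb : b ∈ Q := hp.listPerm.mem_iff.2 (by simp)
    obtain ⟨Q₀, e, he⟩ := Extract.exists_of_mem (ob := ob) hb
    rw [List.nodup_cons] at hQ
    obtain ⟨_, _, p', he₁, hp', h₁⟩ := hp.extract he
    obtain ⟨_, _, q', he₂, hq', h₂⟩ := hq.extract he
    cases he₁ with
    | there _ h => exact absurd h.mem hQ.1
    | here =>
    cases he₂ with
    | there _ h => exact absurd h.mem hQ.1
    | here =>
    rw [ih hQ.2 hp' hq', ← h₂] at h₁
    exact (Category.comp_id p).symm.trans (h₁.trans (Category.comp_id q))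

theorem LabCtx.Valid.nodup {Q : LabCtx W} (h : Q.Valid) : Q.Nodup := List.Nodup.of_map _ h

theorem LabCtx.Valid.perm {Q Q' : LabCtx W} (h : Q.Valid) (h' : Q.Perm Q') : Q'.Valid :=
  (h'.map Prod.fst).nodup_iff.1 h

theorem IsPerm.unique {Q Q' : LabCtx W} (hQ : Q.Valid) {p q : labObj ob Q ⟶ labObj ob Q'}
    (hp : IsPerm ob p) (hq : IsPerm ob q) : p = q :=
  hp.unique_of_nodup (hQ.perm hp.listPerm).nodup hq

/-- Permutation isomorphisms are central. -/
theorem IsPerm.central {Q Q' : LabCtx W} {p : labObj ob Q ⟶ labObj ob Q'} (hp : IsPerm ob p) :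
    Central p := by
  induction hp with
  | nil => exact .id _
  | cons a _ ih => exact ih.lwhisk _
  | swap a b Q => exact .sw _ _ _
  | trans _ _ ih1 ih2 => exact ih1.comp ih2

end Permutations

section Blocks

variable {M : Type u} [StrictSymmPremonoidal.{v} M]

theorem lwhisk_conj_lwhisk (A X : M) {Z Z' U U' : M} (p : Z ⟶ Z')
    (h : U = X * Z) (h' : X * Z' = U') :
    lwhisk A (eqToHom h ≫ lwhisk X p ≫ eqToHom h') =
      eqToHom (by rw [h, mul_assoc]) ≫ lwhisk (A * X) p ≫ eqToHom (by rw [← h', mul_assoc]) := by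
  subst h h'; simp [mul_lwhisk_eq]

theorem lwhisk_conj_rwhisk (A X : M) {Z Z' U U' : M} (p : Z ⟶ Z')
    (h : U = Z * X) (h' : Z' * X = U') :
    lwhisk A (eqToHom h ≫ rwhisk p X ≫ eqToHom h') =
      eqToHom (by rw [h, mul_assoc]) ≫ rwhisk (lwhisk A p) X ≫
        eqToHom (by rw [← h', mul_assoc]) := by
  subst h h'; simp [rwhisk_lwhisk_eq]

theorem rwhisk_sw (X Y Z R : M) {U : M} (h : U = Z * R) :
    eqToHom (by simp only [h, mul_assoc]) ≫ rwhisk (sw X Y Z) R ≫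
      eqToHom (by simp only [h, mul_assoc]) = sw X Y U := by
  subst h; simp [sw, rwhisk_comp, rwhisk_mul_eq]

theorem sw_block_cons_right (A B X Z : M) {U U' : M} (h : U = X * Z) (h' : X * (A * Z) = U') :
    sw A B U ≫ lwhisk B (eqToHom (by rw [h]) ≫ sw A X Z ≫ eqToHom h') =
      eqToHom (by rw [h, mul_assoc]) ≫ sw A (B * X) Z ≫ eqToHom (by rw [← h', mul_assoc]) := by
  subst h h'; simp [sw_mul_right]

theorem sw_block_cons_left (A X Y Z : M) {U V R T : M} (h : U = X * (Y * Z)) (h' : V = X * Z)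
    (h'' : Y * (X * Z) = R) (h3 : R = Y * V) (h4 : Y * (A * V) = T) :
    lwhisk A (eqToHom h ≫ sw X Y Z ≫ eqToHom h'') ≫
        eqToHom (congrArg (A * ·) h3) ≫ sw A Y V ≫ eqToHom h4 =
      eqToHom (by rw [h, mul_assoc]) ≫ sw (A * X) Y Z ≫ eqToHom (by rw [← h4, h', mul_assoc]) := by
  subst h h' h'' h4; simp [sw_mul_left]

theorem conj_one_lwhisk {X Z Z' : M} (hX : X = 1) (p : Z ⟶ Z') (h : Z = X * Z) (h' : X * Z' = Z') :
    eqToHom h ≫ lwhisk X p ≫ eqToHom h' = p := by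
  subst hX; simp [one_lwhisk_eq]

theorem conj_sw_one_right {X Y Z U : M} (hY : Y = 1) (h : U = X * (Y * Z))
    (h' : Y * (X * Z) = U) : eqToHom h ≫ sw X Y Z ≫ eqToHom h' = 𝟙 U := by
  subst hY; simp [sw_one_right]

theorem conj_sw_one_left {X Y Z U : M} (hX : X = 1) (h : U = X * (Y * Z))
    (h' : Y * (X * Z) = U) : eqToHom h ≫ sw X Y Z ≫ eqToHom h' = 𝟙 U := by
  subst hX; simp [sw_one_left]

theorem conj_comp {X Y Z X' Y' Z' : M} (f : X ⟶ Y) (g : Y ⟶ Z) (h : X' = X) (h' : Y = Y')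
    (h'' : Z = Z') :
    (eqToHom h ≫ f ≫ eqToHom h') ≫ eqToHom h'.symm ≫ g ≫ eqToHom h'' =
      eqToHom h ≫ (f ≫ g) ≫ eqToHom h'' := by
  subst h h' h''; simp

variable {W : Type w} {ob : W → M}

theorem IsPerm.of_eq {Q Q' : LabCtx W} {p q : labObj ob Q ⟶ labObj ob Q'} (hp : IsPerm ob p)
    (h : p = q) : IsPerm ob q := h ▸ hp

theorem IsPerm.lwhisk_block {Q Q' : LabCtx W} {p : labObj ob Q ⟶ labObj ob Q'}
    (hp : IsPerm ob p) : (R : LabCtx W) →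
    IsPerm ob (Q := R ++ Q) (Q' := R ++ Q') (CategoryTheory.eqToHom (labObj_append ob R Q) ≫
      lwhisk (labObj ob R) p ≫ CategoryTheory.eqToHom (labObj_append ob R Q').symm)
  | [] => hp.of_eq (conj_one_lwhisk rfl p _ _).symm
  | a :: R => ((hp.lwhisk_block R).cons a).of_eq (lwhisk_conj_lwhisk _ _ _ _ _)

theorem IsPerm.rwhisk_block {Q Q' : LabCtx W} {p : labObj ob Q ⟶ labObj ob Q'}
    (hp : IsPerm ob p) (R : LabCtx W) :
    IsPerm ob (Q := Q ++ R) (Q' := Q' ++ R) (CategoryTheory.eqToHom (labObj_append ob Q R) ≫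
      rwhisk p (labObj ob R) ≫ CategoryTheory.eqToHom (labObj_append ob Q' R).symm) := by
  induction hp with
  | nil => exact (IsPerm.refl ([] ++ R)).of_eq (by simp [rwhisk_id])
  | cons a _ ih => exact (ih.cons a).of_eq (lwhisk_conj_rwhisk _ _ _ _ _)
  | swap a b Q =>
    exact (IsPerm.swap a b (Q ++ R)).of_eq (rwhisk_sw _ _ _ _ (labObj_append ob Q R)).symm
  | trans _ _ ih1 ih2 =>
    exact (ih1.trans ih2).of_eq ((conj_comp _ _ _ _ _).trans (by rw [rwhisk_comp]))

theorem IsPerm.swap_block_one (a : ℕ × W) (R : LabCtx W) : (H : LabCtx W) →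
    IsPerm ob (Q := a :: (H ++ R)) (Q' := H ++ a :: R)
      (CategoryTheory.eqToHom (congrArg (ob a.2 * ·) (labObj_append ob H R)) ≫
        sw (ob a.2) (labObj ob H) (labObj ob R) ≫
        CategoryTheory.eqToHom (labObj_append ob H (a :: R)).symm)
  | [] => (IsPerm.refl _).of_eq (conj_sw_one_right (Y := labObj ob []) rfl _ _).symm
  | b :: H => ((IsPerm.swap a b (H ++ R)).trans ((IsPerm.swap_block_one a R H).cons b)).of_eq
      (sw_block_cons_right _ _ _ _ (labObj_append ob H R) (labObj_append ob H (a :: R)).symm)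

/-- Two adjacent blocks of wires may be exchanged. -/
theorem IsPerm.swap_block (H R : LabCtx W) : (G : LabCtx W) →
    IsPerm ob (Q := G ++ (H ++ R)) (Q' := H ++ (G ++ R))
      (CategoryTheory.eqToHom (by simp only [labObj_append]) ≫
        sw (labObj ob G) (labObj ob H) (labObj ob R) ≫
        CategoryTheory.eqToHom (by simp only [labObj_append]))
  | [] => (IsPerm.refl _).of_eq (conj_sw_one_left (X := labObj ob []) rfl _ _).symm
  | a :: G => (((IsPerm.swap_block H R G).cons a).trans
      (IsPerm.swap_block_one a (G ++ R) H)).of_eq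
      (sw_block_cons_left _ _ _ _ _ (labObj_append ob G R) _ (labObj_append ob H (G ++ R)) _)

end Blocks

section Environments

variable {W : Type w} {M : Type u} [StrictSymmPremonoidal.{v} M] {ob : W → M}

@[simp] theorem split_join : {Γ Δ : Ctx W} → (x : flatCtx ob Γ) → (y : flatCtx ob Δ) →
    split (join x y) = (x, y)
  | [], _, _, _ => rfl
  | _ :: _, _, x, y =>
      have ih := split_join x.2 y
      Prod.ext (Prod.ext rfl (congrArg (fun z => z.1) ih)) ((congrArg (fun z => z.2) ih :))

@[simp] theorem join_split : {Γ Δ : Ctx W} → (x : flatCtx ob (Γ ++ Δ)) →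
    join (split x).1 (split x).2 = x
  | [], _, _ => rfl
  | _ :: Γ, _, x => Prod.ext rfl (join_split (Γ := Γ) x.2)

/-- Environments of equal contexts. -/
def castEnv {Γ Δ : Ctx W} (h : Γ = Δ) (x : flatCtx ob Γ) : flatCtx ob Δ := h ▸ x

@[simp] theorem castEnv_rfl {Γ : Ctx W} (x : flatCtx ob Γ) : castEnv rfl x = x := rfl

theorem castEnv_castEnv {Γ Δ Θ : Ctx W} (h : Γ = Δ) (h' : Δ = Θ) (x : flatCtx ob Γ) :
    castEnv h' (castEnv h x) = castEnv (h.trans h') x := by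
  subst h h'; rfl

theorem castEnv_cons {e : Entry W} {Γ Δ : Ctx W} (h : Γ = Δ) (x : flatCtx ob (e :: Γ)) :
    castEnv (congrArg (e :: ·) h) x = (x.1, castEnv h x.2) := by
  subst h; rfl

theorem join_assoc : {Γ Δ Θ : Ctx W} → (x : flatCtx ob Γ) → (y : flatCtx ob Δ) →
    (z : flatCtx ob Θ) →
    join (join x y) z = castEnv (List.append_assoc Γ Δ Θ).symm (join x (join y z))
  | [], _, _, _, _, _ => rfl
  | e :: Γ, Δ, Θ, x, y, z =>
      Eq.trans (b := ((x.1, castEnv (List.append_assoc Γ Δ Θ).symm (join x.2 (join y z))) :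
          flatCtx ob (e :: (Γ ++ Δ ++ Θ))))
        (congrArg (Prod.mk x.1) (join_assoc (Γ := Γ) x.2 y z))
        (castEnv_cons (List.append_assoc Γ Δ Θ).symm
          (join x (join y z) : flatCtx ob (e :: (Γ ++ (Δ ++ Θ))))).symm

theorem castEnv_join_join {Γ Δ Θ : Ctx W} (h : Γ ++ (Δ ++ Θ) = Γ ++ Δ ++ Θ) (x : flatCtx ob Γ)
    (y : flatCtx ob Δ) (z : flatCtx ob Θ) :
    castEnv h (join x (join y z)) = join (join x y) z := (join_assoc x y z).symm

theorem castEnv_join_join' {Γ Δ Θ : Ctx W} (h : Γ ++ Δ ++ Θ = Γ ++ (Δ ++ Θ)) (x : flatCtx ob Γ)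
    (y : flatCtx ob Δ) (z : flatCtx ob Θ) :
    castEnv h (join (join x y) z) = join x (join y z) := by
  rw [join_assoc, castEnv_castEnv]; rfl

theorem exists_join {Γ Δ : Ctx W} (x : flatCtx ob (Γ ++ Δ)) :
    ∃ (y : flatCtx ob Γ) (z : flatCtx ob Δ), x = join y z :=
  ⟨_, _, (join_split x).symm⟩

end Environments

section Exchange

variable {W : Type w} {M : Type u} [StrictSymmPremonoidal.{v} M] {ob : W → M}

namespace Circ

variable {S T U V : M} {X Y : Type v}

@[simp] theorem pre_id (m : Circ T U X) : pre (𝟙 T) m = m := by simp [pre]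

@[simp] theorem pre_pre (f : S ⟶ T) (g : T ⟶ U) (m : Circ U V X) :
    pre f (pre g m) = pre (f ≫ g) m := by simp [pre]

end Circ

theorem obj_sharp_append (Γ Δ : Ctx W) :
    obj ob (Ctx.sharp (Γ ++ Δ)) = obj ob (Ctx.sharp Γ) * obj ob (Ctx.sharp Δ) := by
  rw [Ctx.sharp_append, obj_append]

theorem obj_sharp_cons (e : Entry W) (Γ : Ctx W) :
    obj ob (Ctx.sharp (e :: Γ)) = obj ob e.ty.sharp * obj ob (Ctx.sharp Γ) :=
  obj_append ob e.ty.sharp (Ctx.sharp Γ)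

/-- The interpretation of a computation judgment as a function. -/
def CTy.run {Γ : Ctx W} {N : Tm ob} {A : Ty W} (d : CTy Γ N A) (x : flatCtx ob Γ) :
    Circ (obj ob (Ctx.sharp Γ)) (obj ob A.sharp) (flat ob A) := d.sem x

/-- Extend an environment. -/
def consEnv {e : Entry W} {Γ : Ctx W} (a : flat ob e.ty) (x : flatCtx ob Γ) : flatCtx ob (e :: Γ) :=
  (a, x)

/-- The environment with one variable. -/
def varEnv (i : ℕ) (A : Ty W) (a : flat ob A) : flatCtx ob [.var i A] := (a, PUnit.unit)

/-- The environment with two variables. -/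
def varEnv₂ (i : ℕ) (A : Ty W) (j : ℕ) (B : Ty W) (a : flat ob A) (b : flat ob B) :
    flatCtx ob [.var i A, .var j B] := (a, b, PUnit.unit)

theorem CTy.exists_cast {Γ Δ : Ctx W} (h : Γ = Δ) {N : Tm ob} {A : Ty W} (d : CTy Γ N A) :
    ∃ d' : CTy Δ N A, ∀ x, d'.run (castEnv h x) = Circ.pre (eqToHom (by rw [h])) (d.run x) := by
  subst h; exact ⟨d, fun x => by simp⟩

/-- `Exch Γ Γ' f p` says that the final part `Γ'` of the context of any computation can be
rearranged into `Γ`, which precomposes its interpretation with `f` and `p`. -/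
def Exch (Γ Γ' : Ctx W) (f : flatCtx ob Γ → flatCtx ob Γ')
    (p : obj ob (Ctx.sharp Γ) ⟶ obj ob (Ctx.sharp Γ')) : Prop :=
  ∀ ⦃Θ : Ctx W⦄ ⦃N : Tm ob⦄ ⦃A : Ty W⦄ (d : CTy (Θ ++ Γ') N A), ∃ d' : CTy (Θ ++ Γ) N A,
    ∀ (x : flatCtx ob Θ) (y : flatCtx ob Γ), d'.run (join x y) =
      Circ.pre (eqToHom (obj_sharp_append Θ Γ) ≫ lwhisk (obj ob (Ctx.sharp Θ)) p ≫
        eqToHom (obj_sharp_append Θ Γ').symm) (d.run (join x (f y)))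

namespace Exch

theorem of_eq {Γ Γ' : Ctx W} {f f' : flatCtx ob Γ → flatCtx ob Γ'}
    {p p' : obj ob (Ctx.sharp Γ) ⟶ obj ob (Ctx.sharp Γ')} (h : Exch Γ Γ' f p)
    (hf : ∀ x, f x = f' x) (hp : p = p') : Exch Γ Γ' f' p' := by
  obtain rfl := funext hf; exact hp ▸ h

theorem refl (Γ : Ctx W) : Exch (ob := ob) Γ Γ (fun x => x) (𝟙 _) := fun Θ N A d =>
  ⟨d, fun x y => by simp [lwhisk_id]⟩

theorem trans {Γ Γ' Γ'' : Ctx W} {f : flatCtx ob Γ → flatCtx ob Γ'}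
    {f' : flatCtx ob Γ' → flatCtx ob Γ''} {p : obj ob (Ctx.sharp Γ) ⟶ obj ob (Ctx.sharp Γ')}
    {p' : obj ob (Ctx.sharp Γ') ⟶ obj ob (Ctx.sharp Γ'')} (h : Exch Γ Γ' f p)
    (h' : Exch Γ' Γ'' f' p') : Exch Γ Γ'' (fun x => f' (f x)) (p ≫ p') := fun Θ N A d => by
  obtain ⟨d', e'⟩ := h' d
  obtain ⟨d'', e''⟩ := h d'
  exact ⟨d'', fun x y => by rw [e'', e']; simp [lwhisk_comp]⟩

theorem cons (e : Entry W) {Γ Γ' : Ctx W} {f : flatCtx ob Γ → flatCtx ob Γ'}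
    {p : obj ob (Ctx.sharp Γ) ⟶ obj ob (Ctx.sharp Γ')} (h : Exch Γ Γ' f p) :
    Exch (e :: Γ) (e :: Γ') (fun x => (x.1, f x.2))
      (eqToHom (obj_sharp_cons e Γ) ≫ lwhisk (obj ob e.ty.sharp) p ≫
        eqToHom (obj_sharp_cons e Γ').symm) := fun Θ N A d => by
  obtain ⟨d₁, e₁⟩ := d.exists_cast (List.append_assoc Θ [e] Γ').symm
  obtain ⟨d₂, e₂⟩ := h d₁
  obtain ⟨d₃, e₃⟩ := d₂.exists_cast (List.append_assoc Θ [e] Γ)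
  refine ⟨d₃, fun x y => ?_⟩
  have h₁ := e₁ (join x (y.1, f y.2))
  have h₂ := e₂ (join x (Δ := [e]) (y.1, PUnit.unit)) y.2
  have h₃ := e₃ (join (join x (Δ := [e]) (y.1, PUnit.unit)) y.2)
  have h₁' : castEnv (List.append_assoc Θ [e] Γ').symm (join x (y.1, f y.2)) =
      join (join x (Δ := [e]) (y.1, PUnit.unit)) (f y.2) :=
    castEnv_join_join _ x (Δ := [e]) (y.1, PUnit.unit) (f y.2)
  rw [h₁'] at h₁
  refine ((congrArg d₃.run (castEnv_join_join' (Δ := [e]) _ x (y.1, PUnit.unit) y.2)).symm.trans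
    h₃).trans ?_
  rw [h₂, h₁]
  have hO : obj ob (Ctx.sharp (Θ ++ [e])) = obj ob (Ctx.sharp Θ) * obj ob e.ty.sharp := by
    rw [obj_sharp_append]; simp [Ctx.sharp]
  simp [lwhisk_congr hO, mul_lwhisk_eq, lwhisk_comp]

theorem swap (a b : Entry W) (Γ : Ctx W) :
    Exch (ob := ob) (b :: a :: Γ) (a :: b :: Γ) (fun x => (x.2.1, x.1, x.2.2))
      (eqToHom (by rw [obj_sharp_cons, obj_sharp_cons]) ≫
        sw (obj ob b.ty.sharp) (obj ob a.ty.sharp) (obj ob (Ctx.sharp Γ)) ≫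
        eqToHom (by rw [obj_sharp_cons, obj_sharp_cons])) := fun Θ N A d => by
  refine ⟨.ex d, fun x y => ?_⟩
  rw [CTy.run, CTy.run, CTy.sem]
  simp [sw, lwhisk_comp]

theorem swap_block_one (b : Entry W) (Γ : Ctx W) : (G : Ctx W) →
    Exch (ob := ob) (b :: (G ++ Γ)) (G ++ b :: Γ)
      (fun x => join (split x.2).1 (Δ := b :: Γ) (x.1, (split x.2).2))
      (eqToHom (by rw [obj_sharp_cons, obj_sharp_append]) ≫
        sw (obj ob b.ty.sharp) (obj ob (Ctx.sharp G)) (obj ob (Ctx.sharp Γ)) ≫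
        eqToHom (by rw [obj_sharp_append, obj_sharp_cons]))
  | [] => (refl (b :: Γ)).of_eq (fun _ => rfl)
      (conj_sw_one_right (Y := obj ob (Ctx.sharp [])) rfl _ _).symm
  | c :: G => ((swap c b (G ++ Γ)).trans ((swap_block_one b Γ G).cons c)).of_eq (fun _ => rfl) (by
      simp [sw_congr rfl (obj_sharp_cons c G) rfl, sw_mul_right, lwhisk_comp,
        sw_congr rfl rfl (obj_sharp_append G Γ)])

/-- Two adjacent blocks of a context may be exchanged. -/
theorem swap_block (G Γ : Ctx W) : (H : Ctx W) →
    Exch (ob := ob) (H ++ (G ++ Γ)) (G ++ (H ++ Γ))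
      (fun x => join (split (split x).2).1 (join (split x).1 (split (split x).2).2))
      (eqToHom (by simp only [obj_sharp_append]) ≫
        sw (obj ob (Ctx.sharp H)) (obj ob (Ctx.sharp G)) (obj ob (Ctx.sharp Γ)) ≫
        eqToHom (by simp only [obj_sharp_append]))
  | [] => (refl (G ++ Γ)).of_eq (fun x => (join_split x).symm)
      (conj_sw_one_left (X := obj ob (Ctx.sharp [])) rfl _ _).symm
  | b :: H => (((swap_block G Γ H).cons b).trans (swap_block_one b (H ++ Γ) G)).of_eq
      (fun x => by simp only [split_join]; rfl) (by
      simp [sw_congr (obj_sharp_cons b H) rfl rfl, sw_mul_left, lwhisk_comp,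
        sw_congr rfl rfl (obj_sharp_append H Γ)])

end Exch

end Exchange

section ContextSubstitution

variable {W : Type w} {M : Type u} [StrictSymmPremonoidal.{v} M] {ob : W → M}

theorem Ctx.shift_append (k : ℕ) (Γ Δ : Ctx W) :
    Ctx.shift k (Γ ++ Δ) = Ctx.shift k Γ ++ Ctx.shift k Δ := List.map_append

theorem castEnv_append_nil : {Γ : Ctx W} → (x : flatCtx ob (Γ ++ [])) →
    castEnv (List.append_nil Γ) x = (split (Γ := Γ) (Δ := []) x).1
  | [], _ => rfl
  | _ :: Γ, x => (castEnv_cons (List.append_nil Γ) x).trans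
      (congrArg (Prod.mk x.1) (castEnv_append_nil (Γ := Γ) x.2))

theorem shiftEnv_cons (k : ℕ) (e : Entry W) (Γ : Ctx W) :
    ∃ φ : flat ob e.ty → flat ob (e.shift k).ty, ∀ x : flatCtx ob (e :: Γ),
      shiftEnv k x = ((φ x.1, shiftEnv k x.2) : flatCtx ob (e.shift k :: Ctx.shift k Γ)) := by
  cases e with
  | lab l a => exact ⟨fun x => x, fun _ => rfl⟩
  | var i A => exact ⟨fun x => x, fun _ => rfl⟩

theorem shiftEnv_join (k : ℕ) {Δ : Ctx W} : {Γ : Ctx W} → (x : flatCtx ob Γ) → (y : flatCtx ob Δ) →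
    castEnv (Ctx.shift_append k Γ Δ) (shiftEnv k (join x y)) = join (shiftEnv k x) (shiftEnv k y)
  | [], _, _ => rfl
  | e :: Γ, x, y => by
      cases e with
      | lab l a =>
        exact (castEnv_cons _ _).trans (congrArg (Prod.mk x.1) (shiftEnv_join k (Γ := Γ) x.2 y))
      | var i A =>
        exact (castEnv_cons _ _).trans (congrArg (Prod.mk x.1) (shiftEnv_join k (Γ := Γ) x.2 y))

/-- Values of parameter types have parameter contexts. -/
theorem VTy.isParam : {Γ : Ctx W} → {V : Val ob} → {A : Ty W} → VTy Γ V A → A.IsParam →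
    Ctx.IsParam Γ
  | _, _, _, .unit hΦ, _ => hΦ
  | _, _, _, .nat hΦ _, _ => hΦ
  | _, _, _, .lab _ _ _, h => h.elim
  | _, _, _, .var hΦ _ _, h => fun e he => by
      rcases List.mem_append.1 he with he | he
      · exact hΦ e he
      · obtain rfl := List.mem_singleton.1 he; exact h
  | _, _, _, .abs _, h => h.elim
  | _, _, _, .lift hΦ _, _ => hΦ
  | _, _, _, .circ hΦ _ _ _ _ _ _ _ _, _ => hΦ
  | _, _, _, .pair _ d d', h => fun e he => by
      rcases List.mem_append.1 he with he | he
      · exact d.isParam h.1 e he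
      · exact d'.isParam h.2 e (List.mem_append_right _ he)

theorem Ctx.IsParam.append {Γ Δ : Ctx W} (h : Ctx.IsParam Γ) (h' : Ctx.IsParam Δ) :
    Ctx.IsParam (Γ ++ Δ) := fun e he => (List.mem_append.1 he).elim (h e) (h' e)

/-- A class of typed values together with their interpretations. -/
abbrev ValClass (ob : W → M) : Type (max w v) :=
  (G : Ctx W) → Val ob → (A : Ty W) → (flatCtx ob G → flat ob A) → Prop

/-- The closure conditions under which the values of a class may be substituted for variables. -/
structure ValClass.Closed (P : ValClass ob) : Prop where
  weaken {G : Ctx W} {V : Val ob} {A : Ty W} {g : flatCtx ob G → flat ob A} : P G V A g →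
    ∀ {Φ : Ctx W}, Ctx.IsParam Φ → ∃ d : VTy (Φ ++ G) V A, ∀ x y, d.fn (join x y) = g y
  shift_one {G : Ctx W} {V : Val ob} {A : Ty W} {g : flatCtx ob G → flat ob A} : P G V A g →
    ∃ g', P (Ctx.shift 1 G) (V.ren Nat.succ) A g' ∧ ∀ x, g' (shiftEnv 1 x) = g x
  shift_two {G : Ctx W} {V : Val ob} {A : Ty W} {g : flatCtx ob G → flat ob A} : P G V A g →
    ∃ g', P (Ctx.shift 2 G) ((V.ren Nat.succ).ren Nat.succ) A g' ∧ ∀ x, g' (shiftEnv 2 x) = g x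
  var (i : ℕ) (A : Ty W) : P [.var i A] (.var i) A fun x => x.1

variable (P : ValClass ob) (s s' : ℕ → Val ob)

/-- `EntrySub P s e G g`: the context `G` types what `s` substitutes for the entry `e`. -/
inductive EntrySub : (e : Entry W) → (G : Ctx W) → (flatCtx ob G → flat ob e.ty) → Prop
  | lab (l : ℕ) (a : W) : EntrySub (.lab l a) [.lab l a] fun x => x.1
  | var (i : ℕ) (A : Ty W) (G : Ctx W) (g : flatCtx ob G → flat ob A) :
      P G (s i) A g → EntrySub (.var i A) G g

/-- `CtxSub P s Γ Δ f`: the context `Δ` types the substitution of `s` for the entries of `Γ`,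
and `f` is its interpretation. -/
inductive CtxSub : (Γ Δ : Ctx W) → (flatCtx ob Δ → flatCtx ob Γ) → Prop
  | nil : CtxSub [] [] fun _ => PUnit.unit
  | cons {e : Entry W} {G Γ Δ : Ctx W} {g : flatCtx ob G → flat ob e.ty}
      {f : flatCtx ob Δ → flatCtx ob Γ} : EntrySub P s e G g → CtxSub Γ Δ f →
      CtxSub (e :: Γ) (G ++ Δ) fun x => consEnv (g (split x).1) (f (split x).2)

/-- `CtxSub` up to additional parameters in front of the context. -/
inductive WkCtxSub : (Γ Δ : Ctx W) → (flatCtx ob Δ → flatCtx ob Γ) → Prop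
  | strict {Γ Δ : Ctx W} {f : flatCtx ob Δ → flatCtx ob Γ} : CtxSub P s Γ Δ f → WkCtxSub Γ Δ f
  | weaken {Γ Δ : Ctx W} {f : flatCtx ob Δ → flatCtx ob Γ} (e : Entry W) : e.ty.IsParam →
      WkCtxSub Γ Δ f → WkCtxSub Γ (e :: Δ) fun x => f x.2

variable {P s s'}

theorem EntrySub.exists_cast {e : Entry W} {G G' : Ctx W} {g : flatCtx ob G → flat ob e.ty}
    (h : EntrySub P s e G g) (hG : G = G') :
    ∃ g', EntrySub P s e G' g' ∧ ∀ x, g' (castEnv hG x) = g x := by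
  subst hG; exact ⟨g, h, fun _ => rfl⟩

theorem CtxSub.exists_cast {Γ Δ Δ' : Ctx W} {f : flatCtx ob Δ → flatCtx ob Γ}
    (h : CtxSub P s Γ Δ f) (hΔ : Δ = Δ') :
    ∃ f', CtxSub P s Γ Δ' f' ∧ ∀ x, f' (castEnv hΔ x) = f x := by
  subst hΔ; exact ⟨f, h, fun _ => rfl⟩

theorem CtxSub.exists_of_append {Γ₂ : Ctx W} : (Γ₁ : Ctx W) → {Δ : Ctx W} →
    {f : flatCtx ob Δ → flatCtx ob (Γ₁ ++ Γ₂)} → CtxSub P s (Γ₁ ++ Γ₂) Δ f →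
    ∃ (Δ₁ Δ₂ : Ctx W) (f₁ : flatCtx ob Δ₁ → flatCtx ob Γ₁) (f₂ : flatCtx ob Δ₂ → flatCtx ob Γ₂)
      (hΔ : Δ = Δ₁ ++ Δ₂), CtxSub P s Γ₁ Δ₁ f₁ ∧ CtxSub P s Γ₂ Δ₂ f₂ ∧
        ∀ x y, f (castEnv hΔ.symm (join x y)) = join (f₁ x) (f₂ y)
  | [], Δ, f, h => ⟨[], Δ, fun _ => PUnit.unit, f, rfl, .nil, h, fun _ _ => rfl⟩
  | e :: Γ₁, _, _, .cons (G := G) (g := g) he h => by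
      obtain ⟨Δ₁, Δ₂, f₁, f₂, rfl, h₁, h₂, hf⟩ := CtxSub.exists_of_append Γ₁ h
      refine ⟨G ++ Δ₁, Δ₂, _, f₂, (List.append_assoc _ _ _).symm, .cons he h₁, h₂, fun x y => ?_⟩
      obtain ⟨x₀, x₁, rfl⟩ := exists_join x
      rw [castEnv_join_join']
      beta_reduce
      rw [split_join, split_join]
      exact congrArg (consEnv (g x₀)) (hf x₁ y)

theorem CtxSub.append {Γ₂ Δ₂ : Ctx W} {f₂ : flatCtx ob Δ₂ → flatCtx ob Γ₂}
    (h₂ : CtxSub P s Γ₂ Δ₂ f₂) {Γ₁ Δ₁ : Ctx W} {f₁ : flatCtx ob Δ₁ → flatCtx ob Γ₁}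
    (h₁ : CtxSub P s Γ₁ Δ₁ f₁) :
    ∃ f, CtxSub P s (Γ₁ ++ Γ₂) (Δ₁ ++ Δ₂) f ∧ ∀ x y, f (join x y) = join (f₁ x) (f₂ y) := by
  induction h₁ with
  | nil => exact ⟨f₂, h₂, fun _ _ => rfl⟩
  | @cons e G Γ Δ g f he _ ih =>
    obtain ⟨f', h', hf'⟩ := ih
    obtain ⟨f'', h'', hf''⟩ := (CtxSub.cons he h').exists_cast (List.append_assoc _ _ _).symm
    refine ⟨f'', h'', fun x y => ?_⟩
    obtain ⟨x₀, x₁, rfl⟩ := exists_join x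
    beta_reduce
    rw [split_join, ← castEnv_join_join (List.append_assoc _ _ _).symm, hf'', split_join]
    exact congrArg (consEnv (g x₀)) (hf' x₁ y)

theorem CtxSub.exists_of_singleton {e : Entry W} {Δ : Ctx W} {f : flatCtx ob Δ → flatCtx ob [e]}
    (h : CtxSub P s [e] Δ f) : ∃ g, EntrySub P s e Δ g ∧ ∀ x, f x = (g x, PUnit.unit) := by
  cases h with
  | cons he h =>
    cases h with
    | nil =>
      obtain ⟨g', he', hg'⟩ := he.exists_cast (List.append_nil _).symm
      refine ⟨g', he', fun x => ?_⟩
      have h := hg' (castEnv (List.append_nil _) x)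
      rw [castEnv_castEnv, castEnv_append_nil] at h
      exact congrArg (Prod.mk · PUnit.unit) h.symm

theorem EntrySub.exists_singleton {e : Entry W} {G : Ctx W} {g : flatCtx ob G → flat ob e.ty}
    (h : EntrySub P s e G g) : ∃ f, CtxSub P s [e] G f ∧ ∀ x, f x = (g x, PUnit.unit) := by
  obtain ⟨f, h', hf⟩ := (CtxSub.cons h .nil).exists_cast (List.append_nil G)
  refine ⟨f, h', fun x => ?_⟩
  have := hf (castEnv (List.append_nil G).symm x)
  rw [castEnv_castEnv] at this
  rw [← castEnv_append_nil, castEnv_castEnv] at this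
  exact this

theorem EntrySub.exists_shift {k : ℕ} {e : Entry W} {G : Ctx W} {g : flatCtx ob G → flat ob e.ty}
    (hs : ∀ {G : Ctx W} {i : ℕ} {A : Ty W} {g : flatCtx ob G → flat ob A}, P G (s i) A g →
      ∃ g', P (Ctx.shift k G) (s' (i + k)) A g' ∧ ∀ x, g' (shiftEnv k x) = g x)
    (h : EntrySub P s e G g) (Γ : Ctx W) :
    ∃ g', EntrySub P s' (e.shift k) (Ctx.shift k G) g' ∧
      ∀ x (y : flatCtx ob Γ), consEnv (g' (shiftEnv k x)) (shiftEnv k y) =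
        shiftEnv k (consEnv (g x) y) := by
  cases h with
  | lab l a => exact ⟨_, .lab l a, fun _ _ => rfl⟩
  | var i A G g h =>
    obtain ⟨g', h', hg'⟩ := hs h
    exact ⟨g', .var _ _ _ _ h', fun x y => congrArg (Prod.mk · (shiftEnv k y)) (hg' x)⟩

theorem CtxSub.exists_shift {k : ℕ} {Γ Δ : Ctx W} {f : flatCtx ob Δ → flatCtx ob Γ}
    (hs : ∀ {G : Ctx W} {i : ℕ} {A : Ty W} {g : flatCtx ob G → flat ob A}, P G (s i) A g →
      ∃ g', P (Ctx.shift k G) (s' (i + k)) A g' ∧ ∀ x, g' (shiftEnv k x) = g x)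
    (h : CtxSub P s Γ Δ f) :
    ∃ f', CtxSub P s' (Ctx.shift k Γ) (Ctx.shift k Δ) f' ∧
      ∀ x, f' (shiftEnv k x) = shiftEnv k (f x) := by
  induction h with
  | nil => exact ⟨_, .nil, fun _ => rfl⟩
  | @cons e G Γ Δ g f he _ ih =>
    obtain ⟨f', h', hf'⟩ := ih
    obtain ⟨g', he', hg'⟩ := he.exists_shift hs Γ
    obtain ⟨f'', h'', hf''⟩ := (CtxSub.cons he' h').exists_cast
      (Ctx.shift_append k G Δ).symm
    refine ⟨f'', h'', fun x => ?_⟩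
    obtain ⟨x₀, x₁, rfl⟩ := exists_join x
    have h := hf'' (join (shiftEnv k x₀) (shiftEnv k x₁))
    rw [split_join, ← shiftEnv_join, castEnv_castEnv, hf', hg'] at h
    beta_reduce
    rw [split_join]
    exact h

theorem WkCtxSub.exists_of_eq_append {Γ Γ₁ Γ₂ Δ : Ctx W} {f : flatCtx ob Δ → flatCtx ob Γ}
    (h : WkCtxSub P s Γ Δ f) (hΓ : Γ = Γ₁ ++ Γ₂) :
    ∃ (Δ₁ Δ₂ : Ctx W) (f₁ : flatCtx ob Δ₁ → flatCtx ob Γ₁) (f₂ : flatCtx ob Δ₂ → flatCtx ob Γ₂)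
      (hΔ : Δ = Δ₁ ++ Δ₂), WkCtxSub P s Γ₁ Δ₁ f₁ ∧ CtxSub P s Γ₂ Δ₂ f₂ ∧
        ∀ x y, castEnv hΓ (f (castEnv hΔ.symm (join x y))) = join (f₁ x) (f₂ y) := by
  induction h with
  | strict h =>
    subst hΓ
    obtain ⟨Δ₁, Δ₂, f₁, f₂, hΔ, h₁, h₂, hf⟩ := CtxSub.exists_of_append Γ₁ h
    exact ⟨Δ₁, Δ₂, f₁, f₂, hΔ, .strict h₁, h₂, hf⟩
  | weaken e he _ ih =>
    obtain ⟨Δ₁, Δ₂, f₁, f₂, rfl, h₁, h₂, hf⟩ := ih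
    exact ⟨e :: Δ₁, Δ₂, _, f₂, rfl, .weaken e he h₁, h₂, fun x y => hf x.2 y⟩

theorem WkCtxSub.exists_of_append {Γ₁ Γ₂ Δ : Ctx W} {f : flatCtx ob Δ → flatCtx ob (Γ₁ ++ Γ₂)}
    (h : WkCtxSub P s (Γ₁ ++ Γ₂) Δ f) :
    ∃ (Δ₁ Δ₂ : Ctx W) (f₁ : flatCtx ob Δ₁ → flatCtx ob Γ₁) (f₂ : flatCtx ob Δ₂ → flatCtx ob Γ₂)
      (hΔ : Δ = Δ₁ ++ Δ₂), WkCtxSub P s Γ₁ Δ₁ f₁ ∧ CtxSub P s Γ₂ Δ₂ f₂ ∧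
        ∀ x y, f (castEnv hΔ.symm (join x y)) = join (f₁ x) (f₂ y) :=
  h.exists_of_eq_append rfl

theorem WkCtxSub.append {Γ₁ Γ₂ Δ₁ Δ₂ : Ctx W} {f₁ : flatCtx ob Δ₁ → flatCtx ob Γ₁}
    {f₂ : flatCtx ob Δ₂ → flatCtx ob Γ₂} (h₁ : WkCtxSub P s Γ₁ Δ₁ f₁) (h₂ : CtxSub P s Γ₂ Δ₂ f₂) :
    ∃ f, WkCtxSub P s (Γ₁ ++ Γ₂) (Δ₁ ++ Δ₂) f ∧ ∀ x y, f (join x y) = join (f₁ x) (f₂ y) := by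
  induction h₁ with
  | strict h₁ =>
    obtain ⟨f, h, hf⟩ := h₂.append h₁
    exact ⟨f, .strict h, hf⟩
  | weaken e he _ ih =>
    obtain ⟨f, h, hf⟩ := ih
    exact ⟨_, .weaken e he h, fun x y => hf x.2 y⟩

theorem Entry.isParam_shift {k : ℕ} {e : Entry W} (h : e.ty.IsParam) :
    (e.shift k).ty.IsParam := by cases e <;> exact h

theorem WkCtxSub.exists_shift {k : ℕ} {Γ Δ : Ctx W} {f : flatCtx ob Δ → flatCtx ob Γ}
    (hs : ∀ {G : Ctx W} {i : ℕ} {A : Ty W} {g : flatCtx ob G → flat ob A}, P G (s i) A g →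
      ∃ g', P (Ctx.shift k G) (s' (i + k)) A g' ∧ ∀ x, g' (shiftEnv k x) = g x)
    (h : WkCtxSub P s Γ Δ f) :
    ∃ f', WkCtxSub P s' (Ctx.shift k Γ) (Ctx.shift k Δ) f' ∧
      ∀ x, f' (shiftEnv k x) = shiftEnv k (f x) := by
  induction h with
  | strict h =>
    obtain ⟨f', h', hf'⟩ := h.exists_shift hs
    exact ⟨f', .strict h', hf'⟩
  | weaken e he _ ih =>
    obtain ⟨f', h', hf'⟩ := ih
    obtain ⟨φ, hφ⟩ := shiftEnv_cons (ob := ob) k e _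
    exact ⟨_, .weaken (e.shift k) (Entry.isParam_shift he) h', fun x => by
      rw [hφ]; exact hf' x.2⟩

theorem EntrySub.sharp_eq (hP : P.Closed) {e : Entry W} {G : Ctx W}
    {g : flatCtx ob G → flat ob e.ty} (h : EntrySub P s e G g) : Ctx.sharp G = e.ty.sharp := by
  cases h with
  | lab l a => rfl
  | var i A G g h =>
    obtain ⟨d, -⟩ := hP.weaken h (Φ := []) (by simp [Ctx.IsParam])
    exact d.sharp_eq

theorem EntrySub.isParam (hP : P.Closed) {e : Entry W} {G : Ctx W}
    {g : flatCtx ob G → flat ob e.ty} (h : EntrySub P s e G g) (he : e.ty.IsParam) :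
    Ctx.IsParam G := by
  cases h with
  | lab l a => exact he.elim
  | var i A G g h =>
    obtain ⟨d, -⟩ := hP.weaken h (Φ := []) (by simp [Ctx.IsParam])
    exact d.isParam he

theorem CtxSub.sharp_eq (hP : P.Closed) {Γ Δ : Ctx W} {f : flatCtx ob Δ → flatCtx ob Γ}
    (h : CtxSub P s Γ Δ f) : Ctx.sharp Δ = Ctx.sharp Γ := by
  induction h with
  | nil => rfl
  | cons he _ ih => rw [Ctx.sharp_append, ih, he.sharp_eq hP]; rfl

theorem CtxSub.isParam (hP : P.Closed) {Γ Δ : Ctx W} {f : flatCtx ob Δ → flatCtx ob Γ}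
    (h : CtxSub P s Γ Δ f) (hΓ : Ctx.IsParam Γ) : Ctx.IsParam Δ := by
  induction h with
  | nil => exact hΓ
  | cons he _ ih =>
    exact (he.isParam hP (hΓ _ (by simp))).append (ih fun e h => hΓ e (List.mem_cons_of_mem _ h))

theorem WkCtxSub.sharp_eq (hP : P.Closed) {Γ Δ : Ctx W} {f : flatCtx ob Δ → flatCtx ob Γ}
    (h : WkCtxSub P s Γ Δ f) : Ctx.sharp Δ = Ctx.sharp Γ := by
  induction h with
  | strict h => exact h.sharp_eq hP
  | weaken e he _ ih =>
    rw [← ih]; exact (congrArg (· ++ _) he.sharp_eq).trans (List.nil_append _)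

theorem WkCtxSub.isParam (hP : P.Closed) {Γ Δ : Ctx W} {f : flatCtx ob Δ → flatCtx ob Γ}
    (h : WkCtxSub P s Γ Δ f) (hΓ : Ctx.IsParam Γ) : Ctx.IsParam Δ := by
  induction h with
  | strict h => exact h.isParam hP hΓ
  | weaken e he _ ih =>
    intro e' he'
    rcases List.mem_cons.1 he' with rfl | h
    · exact he
    · exact ih e' h

theorem WkCtxSub.bind_one (hP : P.Closed) (A : Ty W) {Γ Δ : Ctx W}
    {f : flatCtx ob Δ → flatCtx ob Γ} (h : WkCtxSub P s Γ Δ f) :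
    ∃ f', WkCtxSub P (liftSub s) (Ctx.shift 1 Γ ++ [.var 0 A]) (Ctx.shift 1 Δ ++ [.var 0 A]) f' ∧
      ∀ x (a : flat ob A), f' (join (shiftEnv 1 x) (varEnv 0 A a)) =
        join (shiftEnv 1 (f x)) (varEnv 0 A a) := by
  obtain ⟨f₁, h₁, hf₁⟩ := h.exists_shift (s' := liftSub s) (k := 1) hP.shift_one
  obtain ⟨f₂, h₂, hf₂⟩ := (EntrySub.var (s := liftSub s) 0 A _ _ (hP.var 0 A)).exists_singleton
  obtain ⟨f', h', hf'⟩ := h₁.append h₂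
  exact ⟨f', h', fun x a => by rw [hf', hf₁, hf₂]; rfl⟩

theorem WkCtxSub.bind_two (hP : P.Closed) (A B : Ty W) {Γ Δ : Ctx W}
    {f : flatCtx ob Δ → flatCtx ob Γ} (h : WkCtxSub P s Γ Δ f) :
    ∃ f', WkCtxSub P (liftSub (liftSub s)) (Ctx.shift 2 Γ ++ [.var 1 A, .var 0 B])
        (Ctx.shift 2 Δ ++ [.var 1 A, .var 0 B]) f' ∧
      ∀ x (a : flat ob A) (b : flat ob B), f' (join (shiftEnv 2 x) (varEnv₂ 1 A 0 B a b)) =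
        join (shiftEnv 2 (f x)) (varEnv₂ 1 A 0 B a b) := by
  obtain ⟨f₁, h₁, hf₁⟩ := h.exists_shift (s' := liftSub (liftSub s)) (k := 2) hP.shift_two
  obtain ⟨f₂, h₂, hf₂⟩ :=
    (EntrySub.var (s := liftSub (liftSub s)) 0 B _ _ (hP.var 0 B)).exists_singleton
  have h₃ := CtxSub.cons (EntrySub.var (s := liftSub (liftSub s)) 1 A _ _ (hP.var 1 A)) h₂
  obtain ⟨f', h', hf'⟩ := h₁.append h₃
  refine ⟨f', h', fun x a b => ?_⟩
  have h := hf' (shiftEnv 2 x) (varEnv₂ 1 A 0 B a b)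
  rw [hf₁] at h
  refine h.trans (congrArg (join _) ?_)
  exact congrArg (Prod.mk a) (hf₂ (b, PUnit.unit))

end ContextSubstitution

section Evaluation

variable {W : Type w} {M : Type u} [StrictSymmPremonoidal.{v} M] {ob : W → M}

/-- The elements of the parameter part of an arrow type are functions. -/
def arrowFn {A B : Ty W} {T : List W} (f : flat ob (.arrow A B T)) (a : flat ob A) :
    Circ (obj ob T * obj ob A.sharp) (obj ob B.sharp) (flat ob B) := f a

/-- The elements of the parameter part of `!A` are suspended computations. -/
def bangFn {A : Ty W} (f : flat ob (.bang A)) : Circ 1 (obj ob A.sharp) (flat ob A) := f PUnit.unit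

/-- The elements of the parameter part of a circuit type are morphisms. -/
def circFn {T U : BTy W} (f : flat ob (.circ T U)) :
    obj ob T.toTy.sharp ⟶ obj ob U.toTy.sharp := f

/-- The elements of the parameter part of a tensor type are pairs. -/
def pairFn {A B : Ty W} (a : flat ob (.tensor A B)) : flat ob A × flat ob B := a

theorem arrow_ext {A B : Ty W} {T : List W} {f g : flat ob (.arrow A B T)}
    (h : ∀ a, arrowFn f a = arrowFn g a) : f = g := funext h

theorem bang_ext {A : Ty W} {f g : flat ob (.bang A)} (h : bangFn f = bangFn g) : f = g :=
  funext fun _ => h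

namespace VTy

theorem fn_var {Φ : Ctx W} (hΦ : Ctx.IsParam Φ) (i : ℕ) {A : Ty W} (x : flatCtx ob Φ)
    (a : flat ob A) : (VTy.var hΦ i A).fn (join x (varEnv i A a)) = a :=
  congrArg (fun z => z.2.1) (split_join x (varEnv i A a))

theorem fn_abs {Γ : Ctx W} {A B : Ty W} {N : Tm ob} (d : CTy (Ctx.shift 1 Γ ++ [.var 0 A]) N B)
    (e : obj ob (Ctx.sharp Γ) * obj ob A.sharp = obj ob (Ctx.sharp (Ctx.shift 1 Γ ++ [.var 0 A])))
    (x : flatCtx ob Γ) (a : flat ob A) :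
    arrowFn ((VTy.abs d).fn x) a =
      Circ.pre (eqToHom e) (d.run (join (shiftEnv 1 x) (varEnv 0 A a))) := rfl

theorem fn_lift {Φ : Ctx W} (hΦ : Ctx.IsParam Φ) {A : Ty W} {N : Tm ob} (d : CTy Φ N A)
    (e : (1 : M) = obj ob (Ctx.sharp Φ)) (x : flatCtx ob Φ) :
    bangFn ((VTy.lift hΦ d).fn x) = Circ.pre (eqToHom e) (d.run x) := rfl

theorem fn_pair {Φ Γ₁ Γ₂ : Ctx W} (hΦ : Ctx.IsParam Φ) {V V' : Val ob} {A B : Ty W}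
    (d₁ : VTy (Φ ++ Γ₁) V A) (d₂ : VTy (Φ ++ Γ₂) V' B) (x : flatCtx ob Φ) (y : flatCtx ob Γ₁)
    (z : flatCtx ob Γ₂) : pairFn ((VTy.pair hΦ d₁ d₂).fn (join (join x y) z)) =
      (d₁.fn (join x y), d₂.fn (join x z)) := by
  have h : pairFn ((VTy.pair hΦ d₁ d₂).fn (join (join x y) z)) =
      (d₁.fn (split (join (join x y) z)).1, d₂.fn (join
        (split (split (join (join x y) z)).1).1 (split (join (join x y) z)).2)) := rfl
  rw [h]
  simp only [split_join]

theorem exists_abs {Γ : Ctx W} {A B : Ty W} {T : List W} {N : Tm ob} (h : T = Ctx.sharp Γ)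
    (d : CTy (Ctx.shift 1 Γ ++ [.var 0 A]) N B)
    (e : obj ob T * obj ob A.sharp = obj ob (Ctx.sharp (Ctx.shift 1 Γ ++ [.var 0 A]))) :
    ∃ d' : VTy Γ (.lam A N) (.arrow A B T), ∀ x a, arrowFn (d'.fn x) a =
      Circ.pre (eqToHom e) (d.run (join (shiftEnv 1 x) (varEnv 0 A a))) := by
  subst h; exact ⟨.abs d, fun _ _ => rfl⟩

end VTy

namespace CTy

theorem run_app {Φ Γ₁ Γ₂ : Ctx W} (hΦ : Ctx.IsParam Φ) {V V' : Val ob} {A B : Ty W} {T : List W}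
    (d₁ : VTy (Φ ++ Γ₁) V (.arrow A B T)) (d₂ : VTy (Φ ++ Γ₂) V' A)
    (e : obj ob (Ctx.sharp (Φ ++ Γ₁ ++ Γ₂)) = obj ob T * obj ob A.sharp)
    (x : flatCtx ob Φ) (y : flatCtx ob Γ₁) (z : flatCtx ob Γ₂) :
    (CTy.app hΦ d₁ d₂).run (join (join x y) z) =
      Circ.pre (eqToHom e) (arrowFn (d₁.fn (join x y)) (d₂.fn (join x z))) := by
  have h : (CTy.app hΦ d₁ d₂).run (join (join x y) z) = Circ.pre (eqToHom e)
      (arrowFn (d₁.fn (split (join (join x y) z)).1) (d₂.fn (join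
        (split (split (join (join x y) z)).1).1 (split (join (join x y) z)).2))) := rfl
  rw [h]
  simp only [split_join]

theorem run_force {Φ : Ctx W} (hΦ : Ctx.IsParam Φ) {V : Val ob} {A : Ty W} (d : VTy Φ V (.bang A))
    (e : obj ob (Ctx.sharp Φ) = 1) (x : flatCtx ob Φ) :
    (CTy.force hΦ d).run x = Circ.pre (eqToHom e) (bangFn (d.fn x)) := rfl

theorem run_box {Φ : Ctx W} (hΦ : Ctx.IsParam Φ) {V : Val ob} {T U : BTy W}
    (d : VTy Φ V (.arrow T.toTy U.toTy []))
    (e : obj ob (Ctx.sharp Φ) = obj ob (Ty.circ T U).sharp) (x : flatCtx ob Φ) :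
    (CTy.box hΦ d).run x = (boxMap (d.fn x), eqToHom e) :=
  Prod.ext rfl (Category.comp_id _)

theorem run_apply {Φ Γ₁ Γ₂ : Ctx W} (hΦ : Ctx.IsParam Φ) {V V' : Val ob} {T U : BTy W}
    (d₁ : VTy (Φ ++ Γ₁) V (.circ T U)) (d₂ : VTy (Φ ++ Γ₂) V' T.toTy)
    (e : obj ob (Ctx.sharp (Φ ++ Γ₁ ++ Γ₂)) = obj ob T.toTy.sharp)
    (x : flatCtx ob Φ) (y : flatCtx ob Γ₁) (z : flatCtx ob Γ₂) :
    (CTy.apply hΦ d₁ d₂).run (join (join x y) z) =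
      (BTy.pt ob U, eqToHom e ≫ circFn (d₁.fn (join x y))) := by
  have h : (CTy.apply hΦ d₁ d₂).run (join (join x y) z) = (BTy.pt ob U, eqToHom e ≫
      circFn (d₁.fn (split (join (join x y) z)).1)) := rfl
  rw [h]
  simp only [split_join]

theorem run_dest {Φ Γ₁ Γ₂ : Ctx W} (hΦ : Ctx.IsParam Φ) {V : Val ob} {N : Tm ob} {A B C : Ty W}
    (d₁ : VTy (Φ ++ Γ₁) V (.tensor A B))
    (d₂ : CTy (Ctx.shift 2 (Φ ++ Γ₂) ++ [.var 1 A, .var 0 B]) N C)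
    (e : obj ob (Ctx.sharp (Φ ++ Γ₂ ++ Γ₁)) =
      obj ob (Ctx.sharp (Ctx.shift 2 (Φ ++ Γ₂) ++ [.var 1 A, .var 0 B])))
    (x : flatCtx ob Φ) (y : flatCtx ob Γ₂) (z : flatCtx ob Γ₁) :
    (CTy.dest hΦ d₁ d₂).run (join (join x y) z) = Circ.pre (eqToHom e)
      (d₂.run (join (shiftEnv 2 (join x y)) (varEnv₂ 1 A 0 B (pairFn (d₁.fn (join x z))).1
        (pairFn (d₁.fn (join x z))).2))) := by
  have h : (CTy.dest hΦ d₁ d₂).run (join (join x y) z) = Circ.pre (eqToHom e)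
      (d₂.run (join (shiftEnv 2 (split (join (join x y) z)).1) (varEnv₂ 1 A 0 B
        (pairFn (d₁.fn (join (split (split (join (join x y) z)).1).1
          (split (join (join x y) z)).2))).1
        (pairFn (d₁.fn (join (split (split (join (join x y) z)).1).1
          (split (join (join x y) z)).2))).2))) := rfl
  rw [h]
  simp only [split_join]

theorem run_ifz_zero {Φ Γ : Ctx W} (hΦ : Ctx.IsParam Φ) {V : Val ob} {N N' : Tm ob} {A : Ty W}
    (d : VTy Φ V .nat) (d₁ : CTy (Φ ++ Γ) N A) (d₂ : CTy (Φ ++ Γ) N' A) {x : flatCtx ob Φ}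
    (h : d.fn x = (ULift.up 0 : ULift.{v} ℕ)) (y : flatCtx ob Γ) :
    (CTy.ifz hΦ d d₁ d₂).run (join x y) = d₁.run (join x y) := by
  have h' : (CTy.ifz hΦ d d₁ d₂).run (join x y) =
      match (show ULift.{v} ℕ from d.fn (split (join x y)).1).down with
      | 0 => d₁.run (join x y)
      | _ + 1 => d₂.run (join x y) := rfl
  rw [h', split_join, h]

theorem run_ifz_succ {Φ Γ : Ctx W} (hΦ : Ctx.IsParam Φ) {V : Val ob} {N N' : Tm ob} {A : Ty W}
    (d : VTy Φ V .nat) (d₁ : CTy (Φ ++ Γ) N A) (d₂ : CTy (Φ ++ Γ) N' A) {x : flatCtx ob Φ} {n : ℕ}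
    (h : d.fn x = (ULift.up (n + 1) : ULift.{v} ℕ)) (y : flatCtx ob Γ) :
    (CTy.ifz hΦ d d₁ d₂).run (join x y) = d₂.run (join x y) := by
  have h' : (CTy.ifz hΦ d d₁ d₂).run (join x y) =
      match (show ULift.{v} ℕ from d.fn (split (join x y)).1).down with
      | 0 => d₁.run (join x y)
      | _ + 1 => d₂.run (join x y) := rfl
  rw [h', split_join, h]

theorem run_ret {Γ : Ctx W} {V : Val ob} {A : Ty W} (d : VTy Γ V A)
    (e : obj ob (Ctx.sharp Γ) = obj ob A.sharp) (x : flatCtx ob Γ) :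
    (CTy.ret d).run x = (d.fn x, eqToHom e) :=
  Prod.ext rfl (Category.comp_id _)

theorem run_letin {Φ Γ₁ Γ₂ : Ctx W} (hΦ : Ctx.IsParam Φ) {N N' : Tm ob} {A B : Ty W}
    (d₁ : CTy (Φ ++ Γ₁) N A) (d₂ : CTy (Ctx.shift 1 (Φ ++ Γ₂) ++ [.var 0 A]) N' B)
    (e : obj ob (Ctx.sharp (Φ ++ Γ₂ ++ Γ₁)) =
      obj ob (Ctx.sharp Γ₂) * obj ob (Ctx.sharp (Φ ++ Γ₁)))
    (e' : obj ob (Ctx.sharp Γ₂) * obj ob A.sharp =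
      obj ob (Ctx.sharp (Ctx.shift 1 (Φ ++ Γ₂) ++ [.var 0 A])))
    (x : flatCtx ob Φ) (y : flatCtx ob Γ₂) (z : flatCtx ob Γ₁) :
    (CTy.letin hΦ d₁ d₂).run (join (join x y) z) =
      Circ.pre (eqToHom e ≫ lwhisk (obj ob (Ctx.sharp Γ₂)) (d₁.run (join x z)).2 ≫ eqToHom e')
        (d₂.run (join (shiftEnv 1 (join x y)) (varEnv 0 A (d₁.run (join x z)).1))) := by
  have h : (CTy.letin hΦ d₁ d₂).run (join (join x y) z) = Circ.pre (eqToHom e)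
      (Circ.bind (Circ.liftL (obj ob (Ctx.sharp Γ₂)) (d₁.run
        (join (split (split (join (join x y) z)).1).1 (split (join (join x y) z)).2))) fun a =>
          Circ.pre (eqToHom e')
            (d₂.run (join (shiftEnv 1 (split (join (join x y) z)).1) (varEnv 0 A a)))) := rfl
  rw [h]
  simp only [split_join]
  simp [Circ.pre, Circ.bind, Circ.mu, Circ.map, Circ.liftL]

end CTy

end Evaluation

section Substitution

variable {W : Type w} {M : Type u} [StrictSymmPremonoidal.{v} M] {ob : W → M}
  {P : ValClass ob} {s : ℕ → Val ob}

theorem CtxSub.exists_of_cons {e : Entry W} {Γ Δ : Ctx W} {f : flatCtx ob Δ → flatCtx ob (e :: Γ)}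
    (h : CtxSub P s (e :: Γ) Δ f) :
    ∃ (G Δ' : Ctx W) (g : flatCtx ob G → flat ob e.ty) (f' : flatCtx ob Δ' → flatCtx ob Γ)
      (hΔ : Δ = G ++ Δ'), EntrySub P s e G g ∧ CtxSub P s Γ Δ' f' ∧
        ∀ x y, f (castEnv hΔ.symm (join x y)) = consEnv (g x) (f' y) := by
  cases h with
  | cons he h => exact ⟨_, _, _, _, rfl, he, h, fun x y => by
      rw [castEnv_rfl]; beta_reduce; rw [split_join]⟩

theorem sharp_param_append {Φ : Ctx W} (hΦ : Ctx.IsParam Φ) (Γ : Ctx W) :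
    Ctx.sharp (Φ ++ Γ) = Ctx.sharp Γ := by
  rw [Ctx.sharp_append, hΦ.sharp_eq, List.nil_append]

theorem obj_sharp_var (i : ℕ) (A : Ty W) :
    obj ob (Ctx.sharp [.var i A]) = obj ob A.sharp := by
  simp [Ctx.sharp, Entry.ty]

theorem obj_sharp_of_app {Φ Γ₁ Γ₂ : Ctx W} (hΦ : Ctx.IsParam Φ) {V V' : Val ob} {A B : Ty W}
    {T : List W} (d₁ : VTy (Φ ++ Γ₁) V (.arrow A B T)) (d₂ : VTy (Φ ++ Γ₂) V' A) :
    obj ob (Ctx.sharp (Φ ++ Γ₁ ++ Γ₂)) = obj ob T * obj ob A.sharp := by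
  rw [obj_sharp_append, d₁.sharp_eq, ← sharp_param_append hΦ Γ₂, d₂.sharp_eq]
  rfl

theorem obj_sharp_of_apply {Φ Γ₁ Γ₂ : Ctx W} (hΦ : Ctx.IsParam Φ) {V V' : Val ob} {T U : BTy W}
    (d₁ : VTy (Φ ++ Γ₁) V (.circ T U)) (d₂ : VTy (Φ ++ Γ₂) V' T.toTy) :
    obj ob (Ctx.sharp (Φ ++ Γ₁ ++ Γ₂)) = obj ob T.toTy.sharp := by
  rw [obj_sharp_append, d₁.sharp_eq, ← sharp_param_append hΦ Γ₂, d₂.sharp_eq]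
  exact one_mul _

theorem obj_sharp_of_dest {Φ Γ₁ : Ctx W} (hΦ : Ctx.IsParam Φ) {V : Val ob} {A B : Ty W}
    (d : VTy (Φ ++ Γ₁) V (.tensor A B)) (Γ₂ : Ctx W) :
    obj ob (Ctx.sharp (Φ ++ Γ₂ ++ Γ₁)) =
      obj ob (Ctx.sharp (Ctx.shift 2 (Φ ++ Γ₂) ++ [.var 1 A, .var 0 B])) := by
  rw [obj_sharp_append, ← sharp_param_append hΦ Γ₁, d.sharp_eq, obj_sharp_append (Ctx.shift 2 _),
    Ctx.sharp_shift, obj_sharp_cons, obj_sharp_var, Ty.sharp, obj_append]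
  rfl

theorem obj_sharp_letin {Φ : Ctx W} (hΦ : Ctx.IsParam Φ) (Γ₁ Γ₂ : Ctx W) :
    obj ob (Ctx.sharp (Φ ++ Γ₂ ++ Γ₁)) =
      obj ob (Ctx.sharp Γ₂) * obj ob (Ctx.sharp (Φ ++ Γ₁)) := by
  rw [obj_sharp_append, sharp_param_append hΦ, sharp_param_append hΦ]

theorem obj_sharp_letin' {Φ : Ctx W} (hΦ : Ctx.IsParam Φ) (Γ₂ : Ctx W) (A : Ty W) :
    obj ob (Ctx.sharp Γ₂) * obj ob A.sharp =
      obj ob (Ctx.sharp (Ctx.shift 1 (Φ ++ Γ₂) ++ [.var 0 A])) := by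
  rw [obj_sharp_append, Ctx.sharp_shift, sharp_param_append hΦ, obj_sharp_var]

theorem CTy.run_ex {Γ₁ Γ₂ : Ctx W} {a b : Entry W} {N : Tm ob} {A : Ty W}
    (d : CTy (Γ₁ ++ a :: b :: Γ₂) N A) (x : flatCtx ob Γ₁) (p : flat ob b.ty) (q : flat ob a.ty)
    (y : flatCtx ob Γ₂) :
    (CTy.ex d).run (join x (consEnv p (consEnv q y))) = Circ.pre
      (eqToHom (by rw [obj_sharp_append, obj_sharp_cons, obj_sharp_cons]) ≫
        lwhisk (obj ob (Ctx.sharp Γ₁))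
          (sw (obj ob b.ty.sharp) (obj ob a.ty.sharp) (obj ob (Ctx.sharp Γ₂))) ≫
        eqToHom (by rw [obj_sharp_append, obj_sharp_cons, obj_sharp_cons]))
      (d.run (join x (consEnv q (consEnv p y)))) := by
  rw [CTy.run, CTy.sem]
  simp [sw, lwhisk_comp]
  rfl

theorem WkCtxSub.obj_eq (hP : P.Closed) {Γ Δ : Ctx W} {f : flatCtx ob Δ → flatCtx ob Γ}
    (h : WkCtxSub P s Γ Δ f) : obj ob (Ctx.sharp Δ) = obj ob (Ctx.sharp Γ) := by
  rw [h.sharp_eq hP]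

/-- A derivation in a context `Φ, Γ₁, Γ₂` substitutes to a context of the same form. -/
theorem WkCtxSub.exists_of_append_append (hP : P.Closed) {Φ Γ₁ Γ₂ Δ : Ctx W}
    {f : flatCtx ob Δ → flatCtx ob (Φ ++ Γ₁ ++ Γ₂)} (hΦ : Ctx.IsParam Φ)
    (h : WkCtxSub P s (Φ ++ Γ₁ ++ Γ₂) Δ f) :
    ∃ (Ψ Δ₁ Δ₂ : Ctx W) (φ : flatCtx ob Ψ → flatCtx ob Φ) (f₁ : flatCtx ob Δ₁ → flatCtx ob Γ₁)
      (f₂ : flatCtx ob Δ₂ → flatCtx ob Γ₂) (f₁' : flatCtx ob (Ψ ++ Δ₁) → flatCtx ob (Φ ++ Γ₁))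
      (f₂' : flatCtx ob (Ψ ++ Δ₂) → flatCtx ob (Φ ++ Γ₂)) (hΔ : Δ = Ψ ++ Δ₁ ++ Δ₂),
      Ctx.IsParam Ψ ∧ WkCtxSub P s (Φ ++ Γ₁) (Ψ ++ Δ₁) f₁' ∧
      WkCtxSub P s (Φ ++ Γ₂) (Ψ ++ Δ₂) f₂' ∧ CtxSub P s Γ₁ Δ₁ f₁ ∧ CtxSub P s Γ₂ Δ₂ f₂ ∧
      (∀ x y, f₁' (join x y) = join (φ x) (f₁ y)) ∧ (∀ x y, f₂' (join x y) = join (φ x) (f₂ y)) ∧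
      ∀ x y z, f (castEnv hΔ.symm (join (join x y) z)) = join (join (φ x) (f₁ y)) (f₂ z) := by
  obtain ⟨Δ', Δ₂, f', f₂, rfl, h', h₂, hf⟩ := h.exists_of_append
  obtain ⟨Ψ, Δ₁, φ, f₁, rfl, hφ, h₁, hf'⟩ := h'.exists_of_append
  obtain ⟨f₁', h₁', hf₁'⟩ := hφ.append h₁
  obtain ⟨f₂', h₂', hf₂'⟩ := hφ.append h₂
  exact ⟨Ψ, Δ₁, Δ₂, φ, f₁, f₂, f₁', f₂', rfl, hφ.isParam hP hΦ, h₁', h₂', h₁, h₂, hf₁', hf₂',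
    fun x y z => (hf _ z).trans (by rw [← hf' x y]; rfl)⟩

mutual

theorem VTy.subst (hP : P.Closed) : {Γ : Ctx W} → {V : Val ob} → {A : Ty W} → (d : VTy Γ V A) →
    {s : ℕ → Val ob} → {Δ : Ctx W} → {f : flatCtx ob Δ → flatCtx ob Γ} → WkCtxSub P s Γ Δ f →
    ∃ d' : VTy Δ (V.sub s) A, ∀ x, d'.fn x = d.fn (f x)
  | _, _, _, .unit hΦ, s, Δ, f, h => by
      rw [Val.sub]
      exact ⟨.unit (h.isParam hP hΦ), fun _ => rfl⟩
  | _, _, _, .nat hΦ n, s, Δ, f, h => by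
      rw [Val.sub]
      exact ⟨.nat (h.isParam hP hΦ) n, fun _ => rfl⟩
  | _, _, _, .lab hΦ l a, s, Δ, f, h => by
      rw [Val.sub]
      obtain ⟨Ψ, Δ', φ, f', rfl, hφ, h', -⟩ := h.exists_of_append
      obtain ⟨g, hg, -⟩ := h'.exists_of_singleton
      cases hg
      exact ⟨.lab (hφ.isParam hP hΦ) l a, fun _ => rfl⟩
  | _, _, _, .var hΦ i A, s, Δ, f, h => by
      rw [Val.sub]
      obtain ⟨Ψ, G, φ, f', rfl, hφ, h', hf⟩ := h.exists_of_append
      obtain ⟨g, hg, hg'⟩ := h'.exists_of_singleton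
      cases hg with
      | var _ _ _ _ hg =>
        obtain ⟨d, hd⟩ := hP.weaken hg (hφ.isParam hP hΦ)
        refine ⟨d, fun x => ?_⟩
        obtain ⟨x, y, rfl⟩ := exists_join x
        have hf := hf x y
        rw [castEnv_rfl] at hf
        rw [hd, hf]
        exact ((VTy.fn_var hΦ i _ _).symm.trans (congrArg (fun z => (VTy.var hΦ i A).fn (join _ z))
          (hg' y).symm))
  | _, _, _, .abs (Γ := Γ) (A := A) d, s, Δ, f, h => by
      rw [Val.sub]
      obtain ⟨f', h', hf'⟩ := h.bind_one hP A
      obtain ⟨d', hd'⟩ := d.subst hP h'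
      have e := h.sharp_eq hP
      obtain ⟨d'', hd''⟩ := VTy.exists_abs e.symm d' (by
        rw [obj_sharp_append, Ctx.sharp_shift, e]; simp [Ctx.sharp, Entry.ty])
      refine ⟨d'', fun x => arrow_ext fun a => ?_⟩
      rw [hd'', VTy.fn_abs d (by
        rw [obj_sharp_append, Ctx.sharp_shift]; simp [Ctx.sharp, Entry.ty]), hd', hf',
        Circ.pre_pre, eqToHom_trans]
  | _, _, _, .lift hΦ d, s, Δ, f, h => by
      rw [Val.sub]
      obtain ⟨d', hd'⟩ := d.subst hP h
      refine ⟨.lift (h.isParam hP hΦ) d', fun x => bang_ext ?_⟩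
      rw [VTy.fn_lift _ _ (by rw [(h.isParam hP hΦ).sharp_eq]; rfl),
        VTy.fn_lift _ _ (by rw [hΦ.sharp_eq]; rfl), hd', Circ.pre_pre, eqToHom_trans]
  | _, _, _, .circ hΦ h₁ h₂ hb hc p hp q hq, s, Δ, f, h => by
      rw [Val.sub]
      exact ⟨.circ (h.isParam hP hΦ) h₁ h₂ hb hc p hp q hq, fun _ => by rw [VTy.fn, VTy.fn]⟩
  | _, _, _, .pair hΦ d₁ d₂, s, Δ, f, h => by
      rw [Val.sub]
      obtain ⟨Ψ, Δ₁, Δ₂, φ, f₁, f₂, f₁', f₂', rfl, hΨ, h₁', h₂', h₁, h₂, hf₁', hf₂', hf⟩ :=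
        h.exists_of_append_append hP hΦ
      obtain ⟨d₁', hd₁'⟩ := d₁.subst hP h₁'
      obtain ⟨d₂', hd₂'⟩ := d₂.subst hP h₂'
      refine ⟨.pair hΨ d₁' d₂', fun x => ?_⟩
      obtain ⟨x', z, rfl⟩ := exists_join x
      obtain ⟨x, y, rfl⟩ := exists_join x'
      have hf := hf x y z
      rw [castEnv_rfl] at hf
      rw [hf]
      refine (VTy.fn_pair hΨ d₁' d₂' x y z).trans
        (Eq.trans ?_ (VTy.fn_pair hΦ d₁ d₂ (φ x) (f₁ y) (f₂ z)).symm)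
      rw [hd₁', hd₂', hf₁', hf₂']

theorem CTy.subst (hP : P.Closed) : {Γ : Ctx W} → {N : Tm ob} → {A : Ty W} → (d : CTy Γ N A) →
    {s : ℕ → Val ob} → {Δ : Ctx W} → {f : flatCtx ob Δ → flatCtx ob Γ} →
    (h : WkCtxSub P s Γ Δ f) →
    ∃ d' : CTy Δ (N.sub s) A, ∀ x, d'.run x = Circ.pre (eqToHom (h.obj_eq hP)) (d.run (f x))
  | _, _, _, .app hΦ d₁ d₂, s, Δ, f, h => by
      rw [Tm.sub]
      obtain ⟨Ψ, Δ₁, Δ₂, φ, f₁, f₂, f₁', f₂', rfl, hΨ, h₁', h₂', h₁, h₂, hf₁', hf₂', hf⟩ :=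
        h.exists_of_append_append hP hΦ
      obtain ⟨d₁', hd₁'⟩ := d₁.subst hP h₁'
      obtain ⟨d₂', hd₂'⟩ := d₂.subst hP h₂'
      refine ⟨.app hΨ d₁' d₂', fun x => ?_⟩
      obtain ⟨x', z, rfl⟩ := exists_join x
      obtain ⟨x, y, rfl⟩ := exists_join x'
      have hf := hf x y z
      rw [castEnv_rfl] at hf
      have e := obj_sharp_of_app hΦ d₁ d₂
      rw [hf, CTy.run_app hΨ d₁' d₂' ((h.obj_eq hP).trans e), CTy.run_app hΦ d₁ d₂ e]
      simp only [hd₁', hd₂', hf₁', hf₂', Circ.pre_pre, eqToHom_trans]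
  | _, _, _, .force hΦ d, s, Δ, f, h => by
      rw [Tm.sub]
      obtain ⟨d', hd'⟩ := d.subst hP h
      refine ⟨.force (h.isParam hP hΦ) d', fun x => ?_⟩
      have e : obj ob (Ctx.sharp _) = 1 := congrArg (obj ob) hΦ.sharp_eq
      rw [CTy.run_force _ _ ((h.obj_eq hP).trans e), CTy.run_force _ _ e, hd', Circ.pre_pre,
        eqToHom_trans]
  | _, _, _, .box (T := T) (U := U) hΦ d, s, Δ, f, h => by
      rw [Tm.sub]
      obtain ⟨d', hd'⟩ := d.subst hP h
      refine ⟨.box (h.isParam hP hΦ) d', fun x => ?_⟩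
      have e : obj ob (Ctx.sharp _) = obj ob (Ty.circ T U).sharp := congrArg (obj ob) hΦ.sharp_eq
      rw [CTy.run_box _ _ ((h.obj_eq hP).trans e), CTy.run_box _ _ e, hd']
      exact Prod.ext rfl (eqToHom_trans _ e).symm
  | _, _, _, .apply hΦ d₁ d₂, s, Δ, f, h => by
      rw [Tm.sub]
      obtain ⟨Ψ, Δ₁, Δ₂, φ, f₁, f₂, f₁', f₂', rfl, hΨ, h₁', h₂', h₁, h₂, hf₁', hf₂', hf⟩ :=
        h.exists_of_append_append hP hΦ
      obtain ⟨d₁', hd₁'⟩ := d₁.subst hP h₁'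
      obtain ⟨d₂', hd₂'⟩ := d₂.subst hP h₂'
      refine ⟨.apply hΨ d₁' d₂', fun x => ?_⟩
      obtain ⟨x', z, rfl⟩ := exists_join x
      obtain ⟨x, y, rfl⟩ := exists_join x'
      have hf := hf x y z
      rw [castEnv_rfl] at hf
      have e := obj_sharp_of_apply hΦ d₁ d₂
      rw [hf, CTy.run_apply hΨ d₁' d₂' ((h.obj_eq hP).trans e), CTy.run_apply hΦ d₁ d₂ e]
      simp only [hd₁', hf₁', Circ.pre, eqToHom_trans_assoc]
  | _, _, _, .dest (Γ₂ := Γ₂) (A := A) (B := B) hΦ d₁ d₂, s, Δ, f, h => by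
      rw [Tm.sub]
      obtain ⟨Ψ, Δ₂, Δ₁, φ, f₂, f₁, f₂', f₁', rfl, hΨ, h₂', h₁', h₂, h₁, hf₂', hf₁', hf⟩ :=
        h.exists_of_append_append hP hΦ
      obtain ⟨f', h', hf'⟩ := h₂'.bind_two hP A B
      obtain ⟨d₁', hd₁'⟩ := d₁.subst hP h₁'
      obtain ⟨d₂', hd₂'⟩ := d₂.subst hP h'
      refine ⟨.dest hΨ d₁' d₂', fun x => ?_⟩
      obtain ⟨x', z, rfl⟩ := exists_join x
      obtain ⟨x, y, rfl⟩ := exists_join x'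
      have hf := hf x y z
      rw [castEnv_rfl] at hf
      have e := obj_sharp_of_dest hΦ d₁ Γ₂
      rw [hf, CTy.run_dest hΨ d₁' d₂' (obj_sharp_of_dest hΨ d₁' Δ₂), CTy.run_dest hΦ d₁ d₂ e]
      simp only [hd₁', hf₁', hd₂', hf', hf₂', Circ.pre_pre, eqToHom_trans]
  | _, _, _, .ifz (Γ := Γ) hΦ d d₁ d₂, s, Δ, f, h => by
      rw [Tm.sub]
      obtain ⟨Ψ, Δ', φ, f', rfl, hφ, h', hf⟩ := h.exists_of_append
      obtain ⟨d', hd'⟩ := d.subst hP hφ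
      obtain ⟨d₁', hd₁'⟩ := d₁.subst hP h
      obtain ⟨d₂', hd₂'⟩ := d₂.subst hP h
      refine ⟨.ifz (hφ.isParam hP hΦ) d' d₁' d₂', fun x => ?_⟩
      obtain ⟨x, y, rfl⟩ := exists_join x
      have hf := hf x y
      rw [castEnv_rfl] at hf
      rw [hf]
      obtain ⟨n, hn⟩ : ∃ n : ℕ, d.fn (φ x) = (ULift.up n : ULift.{v} ℕ) := ⟨_, rfl⟩
      have hn' : d'.fn x = (ULift.up n : ULift.{v} ℕ) := (hd' x).trans hn
      cases n with
      | zero => rw [CTy.run_ifz_zero _ _ _ _ hn, CTy.run_ifz_zero _ _ _ _ hn', hd₁', hf]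
      | succ n => rw [CTy.run_ifz_succ _ _ _ _ hn, CTy.run_ifz_succ _ _ _ _ hn', hd₂', hf]
  | _, _, _, .ret d, s, Δ, f, h => by
      rw [Tm.sub]
      obtain ⟨d', hd'⟩ := d.subst hP h
      refine ⟨.ret d', fun x => ?_⟩
      have e : obj ob (Ctx.sharp _) = obj ob _ := congrArg (obj ob) d.sharp_eq
      rw [CTy.run_ret _ ((h.obj_eq hP).trans e), CTy.run_ret _ e, hd', Circ.pre, eqToHom_trans]
  | _, _, _, .letin (Γ₂ := Γ₂) (A := A) hΦ d₁ d₂, s, Δ, f, h => by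
      rw [Tm.sub]
      obtain ⟨Ψ, Δ₂, Δ₁, φ, f₂, f₁, f₂', f₁', rfl, hΨ, h₂', h₁', h₂, h₁, hf₂', hf₁', hf⟩ :=
        h.exists_of_append_append hP hΦ
      obtain ⟨f', h', hf'⟩ := h₂'.bind_one hP A
      obtain ⟨d₁', hd₁'⟩ := d₁.subst hP h₁'
      obtain ⟨d₂', hd₂'⟩ := d₂.subst hP h'
      refine ⟨.letin hΨ d₁' d₂', fun x => ?_⟩
      obtain ⟨x', z, rfl⟩ := exists_join x
      obtain ⟨x, y, rfl⟩ := exists_join x'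
      have hf := hf x y z
      rw [castEnv_rfl] at hf
      have hO : obj ob (Ctx.sharp Δ₂) = obj ob (Ctx.sharp Γ₂) := by rw [h₂.sharp_eq hP]
      rw [hf, CTy.run_letin hΨ d₁' d₂' (obj_sharp_letin hΨ _ _) (obj_sharp_letin' hΨ _ _),
        CTy.run_letin hΦ d₁ d₂ (obj_sharp_letin hΦ _ _) (obj_sharp_letin' hΦ _ _)]
      simp only [hd₁', hf₁', hd₂', Circ.pre, hf', hf₂', lwhisk_comp, lwhisk_eqToHom,
        lwhisk_congr hO, Category.assoc, eqToHom_trans_assoc]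
  | _, _, _, .ex (Γ₁ := Γ₁) (Γ₂ := Γ₂) (a := a) (b := b) d, s, Δ, f, h => by
      obtain ⟨Δ₁, Δ', f₁, f', rfl, h₁, h', hf⟩ := h.exists_of_append
      obtain ⟨B, Δ'', g, f'', rfl, hb, h'', hf'⟩ := h'.exists_of_cons
      obtain ⟨A, Δ₂, g', f₂, rfl, ha, h₂, hf''⟩ := h''.exists_of_cons
      obtain ⟨F, H, hF⟩ := h₁.append (CtxSub.cons ha (CtxSub.cons hb h₂))
      obtain ⟨d', hd'⟩ := d.subst hP H
      obtain ⟨d'', hd''⟩ := Exch.swap_block A Δ₂ B d'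
      refine ⟨d'', fun x => ?_⟩
      obtain ⟨x, y, rfl⟩ := exists_join x
      obtain ⟨y, z, rfl⟩ := exists_join y
      obtain ⟨z, t, rfl⟩ := exists_join z
      have hf := hf x (join y (join z t))
      have hf' := hf' y (join z t)
      have hf'' := hf'' z t
      rw [castEnv_rfl] at hf hf' hf''
      rw [hf', hf''] at hf
      rw [hf, CTy.run_ex, hd'', hd', hF]
      simp only [split_join, Circ.pre_pre]
      congr 1
      simp [lwhisk_comp, lwhisk_congr (congrArg (obj ob) (h₁.sharp_eq hP)),
        sw_congr (congrArg (obj ob) (hb.sharp_eq hP)) (congrArg (obj ob) (ha.sharp_eq hP))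
          (congrArg (obj ob) (h₂.sharp_eq hP))]

end

end Substitution

section Renaming

variable {W : Type w} {M : Type u} [StrictSymmPremonoidal.{v} M] {ob : W → M}

theorem liftSub_var (r : ℕ → ℕ) :
    liftSub (fun i => (.var (r i) : Val ob)) = fun i => .var (liftRen r i) := by
  funext i
  cases i with
  | zero => rfl
  | succ i => simp only [liftSub, liftRen, Val.ren]

theorem liftRen_comp (r r' : ℕ → ℕ) :
    (fun i => liftRen r' (liftRen r i)) = liftRen fun i => r' (r i) := by
  funext i; cases i <;> rfl

theorem liftRen_id : liftRen (fun i => i) = fun i => i := by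
  funext i; cases i <;> rfl

mutual

theorem Val.sub_var : (V : Val ob) → (r : ℕ → ℕ) → V.sub (fun i => .var (r i)) = V.ren r
  | .var _, _ => by rw [Val.sub, Val.ren]
  | .lab _, _ => by rw [Val.sub, Val.ren]
  | .unit, _ => by rw [Val.sub, Val.ren]
  | .nat _, _ => by rw [Val.sub, Val.ren]
  | .lam _ N, r => by rw [Val.sub, Val.ren, liftSub_var, N.sub_var]
  | .lift N, r => by rw [Val.sub, Val.ren, N.sub_var]
  | .boxed _ _ _, _ => by rw [Val.sub, Val.ren]
  | .pair V V', r => by rw [Val.sub, Val.ren, V.sub_var, V'.sub_var]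

theorem Tm.sub_var : (N : Tm ob) → (r : ℕ → ℕ) → N.sub (fun i => .var (r i)) = N.ren r
  | .app V V', r => by rw [Tm.sub, Tm.ren, V.sub_var, V'.sub_var]
  | .force V, r => by rw [Tm.sub, Tm.ren, V.sub_var]
  | .box T V, r => by rw [Tm.sub, Tm.ren, V.sub_var]
  | .apply V V', r => by rw [Tm.sub, Tm.ren, V.sub_var, V'.sub_var]
  | .dest V N, r => by rw [Tm.sub, Tm.ren, V.sub_var, liftSub_var, liftSub_var, N.sub_var]
  | .ifz V N N', r => by rw [Tm.sub, Tm.ren, V.sub_var, N.sub_var, N'.sub_var]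
  | .ret V, r => by rw [Tm.sub, Tm.ren, V.sub_var]
  | .letin N N', r => by rw [Tm.sub, Tm.ren, N.sub_var, liftSub_var, N'.sub_var]

end

mutual

theorem Val.ren_ren : (V : Val ob) → (r r' : ℕ → ℕ) →
    (V.ren r).ren r' = V.ren fun i => r' (r i)
  | .var _, _, _ => by simp only [Val.ren]
  | .lab _, _, _ => by simp only [Val.ren]
  | .unit, _, _ => by simp only [Val.ren]
  | .nat _, _, _ => by simp only [Val.ren]
  | .lam _ N, r, r' => by simp only [Val.ren, N.ren_ren, liftRen_comp]
  | .lift N, r, r' => by simp only [Val.ren, N.ren_ren]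
  | .boxed _ _ _, _, _ => by simp only [Val.ren]
  | .pair V V', r, r' => by simp only [Val.ren, V.ren_ren, V'.ren_ren]

theorem Tm.ren_ren : (N : Tm ob) → (r r' : ℕ → ℕ) → (N.ren r).ren r' = N.ren fun i => r' (r i)
  | .app V V', r, r' => by simp only [Tm.ren, V.ren_ren, V'.ren_ren]
  | .force V, r, r' => by simp only [Tm.ren, V.ren_ren]
  | .box T V, r, r' => by simp only [Tm.ren, V.ren_ren]
  | .apply V V', r, r' => by simp only [Tm.ren, V.ren_ren, V'.ren_ren]
  | .dest V N, r, r' => by simp only [Tm.ren, V.ren_ren, N.ren_ren, liftRen_comp]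
  | .ifz V N N', r, r' => by simp only [Tm.ren, V.ren_ren, N.ren_ren, N'.ren_ren]
  | .ret V, r, r' => by simp only [Tm.ren, V.ren_ren]
  | .letin N N', r, r' => by simp only [Tm.ren, N.ren_ren, N'.ren_ren, liftRen_comp]

end

mutual

theorem Val.ren_id : (V : Val ob) → V.ren (fun i => i) = V
  | .var _ => by rw [Val.ren]
  | .lab _ => by rw [Val.ren]
  | .unit => by rw [Val.ren]
  | .nat _ => by rw [Val.ren]
  | .lam _ N => by rw [Val.ren, liftRen_id, N.ren_id]
  | .lift N => by rw [Val.ren, N.ren_id]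
  | .boxed _ _ _ => by rw [Val.ren]
  | .pair V V' => by rw [Val.ren, V.ren_id, V'.ren_id]

theorem Tm.ren_id : (N : Tm ob) → N.ren (fun i => i) = N
  | .app V V' => by rw [Tm.ren, V.ren_id, V'.ren_id]
  | .force V => by rw [Tm.ren, V.ren_id]
  | .box T V => by rw [Tm.ren, V.ren_id]
  | .apply V V' => by rw [Tm.ren, V.ren_id, V'.ren_id]
  | .dest V N => by rw [Tm.ren, V.ren_id, liftRen_id, liftRen_id, N.ren_id]
  | .ifz V N N' => by rw [Tm.ren, V.ren_id, N.ren_id, N'.ren_id]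
  | .ret V => by rw [Tm.ren, V.ren_id]
  | .letin N N' => by rw [Tm.ren, N.ren_id, liftRen_id, N'.ren_id]

end

/-- The class of variables. -/
inductive VarClass : (G : Ctx W) → Val ob → (A : Ty W) → (flatCtx ob G → flat ob A) → Prop
  | mk (i : ℕ) (A : Ty W) : VarClass [.var i A] (.var i) A fun x => x.1

theorem VarClass.closed : ValClass.Closed (VarClass (ob := ob)) where
  weaken := by
    rintro _ _ _ _ ⟨i, _⟩ Φ hΦ
    exact ⟨.var hΦ i _, fun x y => VTy.fn_var hΦ i x y.1⟩
  shift_one := by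
    rintro _ _ _ _ ⟨i, _⟩
    rw [Val.ren]
    exact ⟨_, .mk (i + 1) _, fun _ => rfl⟩
  shift_two := by
    rintro _ _ _ _ ⟨i, _⟩
    rw [Val.ren, Val.ren]
    exact ⟨_, .mk (i + 2) _, fun _ => rfl⟩
  var i A := .mk i A

theorem CtxSub.ren (k : ℕ) : (Γ : Ctx W) → ∃ f : flatCtx ob (Ctx.shift k Γ) → flatCtx ob Γ,
    CtxSub VarClass (fun i => .var (i + k)) Γ (Ctx.shift k Γ) f ∧ ∀ x, f (shiftEnv k x) = x
  | [] => ⟨_, .nil, fun _ => rfl⟩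
  | .lab l a :: Γ => by
      obtain ⟨f, h, hf⟩ := CtxSub.ren k Γ
      exact ⟨_, .cons (.lab l a) h, fun x => congrArg (Prod.mk x.1) (hf x.2)⟩
  | .var i A :: Γ => by
      obtain ⟨f, h, hf⟩ := CtxSub.ren k Γ
      exact ⟨_, .cons (.var i A _ _ (.mk (i + k) A)) h, fun x => congrArg (Prod.mk x.1) (hf x.2)⟩

theorem CtxSub.id : (Γ : Ctx W) → ∃ f : flatCtx ob Γ → flatCtx ob Γ,
    CtxSub VarClass (fun i => .var i) Γ Γ f ∧ ∀ x, f x = x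
  | [] => ⟨_, .nil, fun _ => rfl⟩
  | .lab l a :: Γ => by
      obtain ⟨f, h, hf⟩ := CtxSub.id Γ
      exact ⟨_, .cons (.lab l a) h, fun x => congrArg (Prod.mk x.1) (hf x.2)⟩
  | .var i A :: Γ => by
      obtain ⟨f, h, hf⟩ := CtxSub.id Γ
      exact ⟨_, .cons (.var i A _ _ (.mk i A)) h, fun x => congrArg (Prod.mk x.1) (hf x.2)⟩

theorem CtxSub.weaken {P : ValClass ob} {s : ℕ → Val ob} {Γ Δ : Ctx W}
    {f : flatCtx ob Δ → flatCtx ob Γ} (h : CtxSub P s Γ Δ f) : {Φ : Ctx W} → Ctx.IsParam Φ →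
    ∃ f', WkCtxSub P s Γ (Φ ++ Δ) f' ∧ ∀ x y, f' (join x y) = f y
  | [], _ => ⟨f, .strict h, fun _ _ => rfl⟩
  | e :: Φ, hΦ => by
      obtain ⟨f', h', hf'⟩ := h.weaken (Φ := Φ) fun e he => hΦ e (List.mem_cons_of_mem _ he)
      exact ⟨_, .weaken e (hΦ e (by simp)) h', fun x y => hf' x.2 y⟩

theorem VTy.weaken {Γ : Ctx W} {V : Val ob} {A : Ty W} (d : VTy Γ V A) {Φ : Ctx W}
    (hΦ : Ctx.IsParam Φ) : ∃ d' : VTy (Φ ++ Γ) V A, ∀ x y, d'.fn (join x y) = d.fn y := by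
  obtain ⟨f, h, hf⟩ := CtxSub.id (ob := ob) Γ
  obtain ⟨f', h', hf'⟩ := h.weaken hΦ
  have key := d.subst VarClass.closed h'
  rw [Val.sub_var V (fun i => i), Val.ren_id] at key
  obtain ⟨d', hd'⟩ := key
  exact ⟨d', fun x y => by rw [hd', hf', hf]⟩

theorem VTy.shift {Γ : Ctx W} {V : Val ob} {A : Ty W} (d : VTy Γ V A) (k : ℕ) :
    ∃ d' : VTy (Ctx.shift k Γ) (V.ren fun i => i + k) A, ∀ x, d'.fn (shiftEnv k x) = d.fn x := by
  obtain ⟨f, h, hf⟩ := CtxSub.ren (ob := ob) k Γ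
  have key := d.subst VarClass.closed (.strict h)
  rw [Val.sub_var V (fun i => i + k)] at key
  obtain ⟨d', hd'⟩ := key
  exact ⟨d', fun x => by rw [hd', hf]⟩

/-- The class of all values. -/
def TypedClass (G : Ctx W) (V : Val ob) (A : Ty W) (g : flatCtx ob G → flat ob A) : Prop :=
  ∃ d : VTy G V A, ∀ x, d.fn x = g x

theorem TypedClass.closed : ValClass.Closed (TypedClass (ob := ob)) where
  weaken := by
    rintro _ _ _ _ ⟨d, hd⟩ Φ hΦ
    obtain ⟨d', hd'⟩ := d.weaken hΦ
    exact ⟨d', fun x y => (hd' x y).trans (hd y)⟩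
  shift_one := by
    rintro _ _ _ _ ⟨d, hd⟩
    obtain ⟨d', hd'⟩ := d.shift 1
    exact ⟨d'.fn, ⟨d', fun _ => rfl⟩, fun x => (hd' x).trans (hd x)⟩
  shift_two := by
    rintro _ _ _ _ ⟨d, hd⟩
    obtain ⟨d', hd'⟩ := d.shift 2
    rw [Val.ren_ren]
    exact ⟨d'.fn, ⟨d', fun _ => rfl⟩, fun x => (hd' x).trans (hd x)⟩
  var i A := ⟨.var (Φ := []) (by simp [Ctx.IsParam]) i A, fun _ => rfl⟩

end Renaming

section LabelContexts

variable {W : Type w} {M : Type u} [StrictSymmPremonoidal.{v} M] {ob : W → M}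

theorem LabCtx.toCtx_append (Q R : LabCtx W) : (Q ++ R).toCtx = Q.toCtx ++ R.toCtx :=
  List.map_append

theorem eq_labEnv : (Q : LabCtx W) → (x : flatCtx ob Q.toCtx) → x = labEnv Q
  | [], _ => rfl
  | _ :: Q, x => congrArg (Prod.mk PUnit.unit) (eq_labEnv Q x.2)

theorem eq_shiftEnv_labEnv (k : ℕ) : (Q : LabCtx W) → (x : flatCtx ob (Ctx.shift k Q.toCtx)) →
    x = shiftEnv k (labEnv Q)
  | [], _ => rfl
  | _ :: Q, x => congrArg (Prod.mk PUnit.unit) (eq_shiftEnv_labEnv k Q x.2)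

theorem CtxSub.labels (P : ValClass ob) (s : ℕ → Val ob) (k : ℕ) : (Q : LabCtx W) →
    ∃ f, CtxSub P s (Ctx.shift k Q.toCtx) Q.toCtx f
  | [] => ⟨_, .nil⟩
  | (l, a) :: Q => by
      obtain ⟨f, h⟩ := CtxSub.labels P s k Q
      exact ⟨_, .cons (.lab l a) h⟩

/-- Substitution of a value for the last variable. -/
theorem CTy.subst_one {L K : LabCtx W} {N : Tm ob} {V : Val ob} {A B : Ty W}
    (d : CTy (Ctx.shift 1 L.toCtx ++ [.var 0 A]) N B) (dV : VTy K.toCtx V A) :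
    ∃ (d' : CTy (L ++ K).toCtx (N.sub (single V)) B)
      (e : obj ob (Ctx.sharp (L ++ K).toCtx) =
        obj ob (Ctx.sharp (Ctx.shift 1 L.toCtx ++ [.var 0 A]))),
      d'.run (labEnv (L ++ K)) = Circ.pre (eqToHom e)
        (d.run (join (shiftEnv 1 (labEnv L)) (varEnv 0 A (dV.fn (labEnv K))))) := by
  obtain ⟨f₁, h₁⟩ := CtxSub.labels (ob := ob) TypedClass (single V) 1 L
  obtain ⟨f₂, h₂, hf₂⟩ := (EntrySub.var (P := TypedClass) (s := single V) 0 A K.toCtx dV.fn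
    ⟨dV, fun _ => rfl⟩).exists_singleton
  obtain ⟨f, h, hf⟩ := h₂.append h₁
  obtain ⟨d', hd'⟩ := d.subst TypedClass.closed (.strict h)
  obtain ⟨d'', hd''⟩ := d'.exists_cast (LabCtx.toCtx_append L K).symm
  have h := hd'' (join (labEnv L) (labEnv K))
  rw [eq_labEnv (L ++ K) (castEnv _ _), hd', hf, Circ.pre_pre, eqToHom_trans,
    eq_shiftEnv_labEnv 1 L (f₁ _), hf₂] at h
  exact ⟨d'', _, h⟩

/-- Substitution of two values for the last two variables. -/
theorem CTy.subst_two {L K K' : LabCtx W} {N : Tm ob} {V V' : Val ob} {A B C : Ty W}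
    (d : CTy (Ctx.shift 2 L.toCtx ++ [.var 1 A, .var 0 B]) N C) (dV : VTy K.toCtx V A)
    (dV' : VTy K'.toCtx V' B) :
    ∃ (d' : CTy (L ++ (K ++ K')).toCtx (N.sub (double V V')) C)
      (e : obj ob (Ctx.sharp (L ++ (K ++ K')).toCtx) =
        obj ob (Ctx.sharp (Ctx.shift 2 L.toCtx ++ [.var 1 A, .var 0 B]))),
      d'.run (labEnv (L ++ (K ++ K'))) = Circ.pre (eqToHom e)
        (d.run (join (shiftEnv 2 (labEnv L))
          (varEnv₂ 1 A 0 B (dV.fn (labEnv K)) (dV'.fn (labEnv K'))))) := by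
  obtain ⟨f₁, h₁⟩ := CtxSub.labels (ob := ob) TypedClass (double V V') 2 L
  obtain ⟨f₂, h₂, hf₂⟩ := (EntrySub.var (P := TypedClass) (s := double V V') 0 B K'.toCtx dV'.fn
    ⟨dV', fun _ => rfl⟩).exists_singleton
  have h₃ := CtxSub.cons (EntrySub.var (P := TypedClass) (s := double V V') 1 A K.toCtx dV.fn
    ⟨dV, fun _ => rfl⟩) h₂
  obtain ⟨f, h, hf⟩ := h₃.append h₁
  obtain ⟨d', hd'⟩ := d.subst TypedClass.closed (.strict h)
  have hK : L.toCtx ++ (K.toCtx ++ K'.toCtx) = (L ++ (K ++ K')).toCtx := by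
    rw [LabCtx.toCtx_append, LabCtx.toCtx_append]
  obtain ⟨d'', hd''⟩ := d'.exists_cast hK
  have h := hd'' (join (labEnv L) (join (labEnv K) (labEnv K')))
  rw [eq_labEnv (L ++ (K ++ K')) (castEnv _ _), hd', hf, Circ.pre_pre, eqToHom_trans,
    eq_shiftEnv_labEnv 2 L (f₁ _)] at h
  rw [split_join, hf₂] at h
  exact ⟨d'', _, h⟩

end LabelContexts

section Bundles

variable {W : Type w} {M : Type u} [StrictSymmPremonoidal.{v} M] {ob : W → M}

theorem labObj_eq_obj_sharp (L : LabCtx W) : labObj ob L = obj ob (Ctx.sharp L.toCtx) :=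
  congrArg (obj ob) L.sharp_toCtx.symm

theorem VTy.labObj_eq {L : LabCtx W} {V : Val ob} {A : Ty W} (d : VTy L.toCtx V A) :
    labObj ob L = obj ob A.sharp :=
  (labObj_eq_obj_sharp L).trans (congrArg (obj ob) d.sharp_eq)

theorem eq_of_labels {L : LabCtx W} {Γ : Ctx W} (h : L.toCtx = Γ) (x y : flatCtx ob Γ) : x = y := by
  subst h; rw [eq_labEnv L x, eq_labEnv L y]

theorem LabCtx.eq_nil_of_isParam {L : LabCtx W} (h : Ctx.IsParam L.toCtx) : L = [] := by
  cases L with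
  | nil => rfl
  | cons a L => exact (h (.lab a.1 a.2) (by simp [LabCtx.toCtx])).elim

theorem LabCtx.eq_nil_of_sharp {L : LabCtx W} {Γ : Ctx W} (h : L.toCtx = Γ)
    (hΓ : Ctx.sharp Γ = []) : L = [] ∧ Γ = [] := by
  subst h
  rw [LabCtx.sharp_toCtx] at hΓ
  obtain rfl := List.map_eq_nil_iff.1 hΓ
  exact ⟨rfl, rfl⟩

theorem LabCtx.exists_of_append {L : LabCtx W} {Γ Δ : Ctx W} (h : L.toCtx = Γ ++ Δ) :
    ∃ L₁ L₂ : LabCtx W, L = L₁ ++ L₂ ∧ L₁.toCtx = Γ ∧ L₂.toCtx = Δ :=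
  List.map_eq_append_iff.1 h

theorem LabCtx.exists_of_param_append {L : LabCtx W} {Φ Γ : Ctx W} (hΦ : Ctx.IsParam Φ)
    (h : L.toCtx = Φ ++ Γ) : Φ = [] ∧ L.toCtx = Γ := by
  obtain ⟨K, L, rfl, rfl, rfl⟩ := LabCtx.exists_of_append h
  obtain rfl := LabCtx.eq_nil_of_isParam hΦ
  exact ⟨rfl, rfl⟩

theorem LabCtx.exists_of_append_append {L : LabCtx W} {Φ Γ Δ : Ctx W} (hΦ : Ctx.IsParam Φ)
    (h : L.toCtx = Φ ++ Γ ++ Δ) :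
    ∃ L₁ L₂ : LabCtx W, Φ = [] ∧ L = L₁ ++ L₂ ∧ L₁.toCtx = Γ ∧ L₂.toCtx = Δ := by
  obtain ⟨L₁, L₂, rfl, h₁, rfl⟩ := LabCtx.exists_of_append h
  obtain ⟨rfl, rfl⟩ := LabCtx.exists_of_param_append hΦ h₁
  exact ⟨L₁, L₂, rfl, rfl, rfl, rfl⟩

theorem LabCtx.exists_of_append_cons_cons {L : LabCtx W} {Γ Δ : Ctx W} {a b : Entry W}
    (h : L.toCtx = Γ ++ a :: b :: Δ) :
    ∃ (L₁ L₂ : LabCtx W) (p q : ℕ × W), L = L₁ ++ p :: q :: L₂ ∧ L₁.toCtx = Γ ∧ L₂.toCtx = Δ ∧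
      a = .lab p.1 p.2 ∧ b = .lab q.1 q.2 := by
  obtain ⟨L₁, L₂, rfl, rfl, h₂⟩ := LabCtx.exists_of_append h
  obtain ⟨p, L₃, rfl, rfl, h₃⟩ := List.map_eq_cons_iff.1 h₂
  obtain ⟨q, L₄, rfl, rfl, rfl⟩ := List.map_eq_cons_iff.1 h₃
  exact ⟨L₁, L₄, p, q, rfl, rfl, rfl, rfl, rfl⟩

theorem BTy.eq_pt : (T : BTy W) → (x : flat ob T.toTy) → x = BTy.pt ob T
  | .unit, _ => rfl
  | .wire _, _ => rfl
  | .tensor T U, x => Prod.ext (BTy.eq_pt T x.1) (BTy.eq_pt U x.2)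

/-- The environment of the empty context. -/
def nilEnv : flatCtx ob [] := PUnit.unit

theorem VTy.exists_of_pair {L : LabCtx W} {V V' : Val ob} {A B : Ty W}
    (d : VTy L.toCtx (.pair V V') (.tensor A B)) :
    ∃ (K K' : LabCtx W) (d₁ : VTy K.toCtx V A) (d₂ : VTy K'.toCtx V' B), L = K ++ K' ∧
      ∀ x, pairFn (d.fn x) = (d₁.fn (labEnv K), d₂.fn (labEnv K')) := by
  generalize h : L.toCtx = Γ at d
  cases d with
  | pair hΦ d₁ d₂ =>
    obtain ⟨K, K', rfl, rfl, rfl, rfl⟩ := LabCtx.exists_of_append_append hΦ h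
    refine ⟨K, K', d₁, d₂, rfl, fun x => ?_⟩
    rw [eq_of_labels h x (join (join nilEnv (labEnv K)) (labEnv K')), VTy.fn_pair]
    rfl

theorem VTy.bdlTy : {b : Bdl} → {T : BTy W} → {L : LabCtx W} →
    VTy (ob := ob) L.toCtx b.toVal T.toTy → BdlTy L b T
  | .unit, T, L, d => by
      rw [Bdl.toVal] at d
      generalize h : L.toCtx = Γ at d
      generalize hT : T.toTy = A at d
      cases d with
      | unit hΦ =>
        subst h
        obtain rfl := LabCtx.eq_nil_of_isParam hΦ
        cases T <;> first | exact .unit | cases hT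
  | .lab l, T, L, d => by
      rw [Bdl.toVal] at d
      generalize h : L.toCtx = Γ at d
      generalize hT : T.toTy = A at d
      cases d with
      | lab hΦ l a =>
        obtain ⟨rfl, h⟩ := LabCtx.exists_of_param_append hΦ h
        obtain ⟨p, L, rfl, h₁, h₂⟩ := List.map_eq_cons_iff.1 h
        obtain rfl := List.map_eq_nil_iff.1 h₂
        cases h₁
        cases T <;> cases hT
        exact .lab _ _
  | .pair b c, T, L, d => by
      rw [Bdl.toVal] at d
      cases T with
      | unit => generalize L.toCtx = Γ at d; cases d
      | wire a => generalize L.toCtx = Γ at d; cases d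
      | tensor T U =>
        obtain ⟨K, K', d₁, d₂, rfl, -⟩ := VTy.exists_of_pair d
        exact .pair d₁.bdlTy d₂.bdlTy

theorem isParam_nil : Ctx.IsParam ([] : Ctx W) := by simp [Ctx.IsParam]

theorem BdlTy.exists_vTy (ob : W → M) {Q : LabCtx W} {b : Bdl} {T : BTy W} (h : BdlTy Q b T) :
    Nonempty (VTy (ob := ob) Q.toCtx b.toVal T.toTy) := by
  induction h with
  | unit => rw [Bdl.toVal]; exact ⟨.unit isParam_nil⟩
  | lab l a => rw [Bdl.toVal]; exact ⟨.lab (Φ := []) isParam_nil l a⟩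
  | pair _ _ ih₁ ih₂ =>
    rw [Bdl.toVal, LabCtx.toCtx_append]
    exact ⟨.pair (Φ := []) isParam_nil ih₁.some ih₂.some⟩

theorem BdlTy.map_fst_eq {Q Q' : LabCtx W} {b : Bdl} {T T' : BTy W} (h : BdlTy Q b T)
    (h' : BdlTy Q' b T') : Q.map Prod.fst = Q'.map Prod.fst := by
  induction h generalizing Q' T' with
  | unit => cases h'; rfl
  | lab l a => cases h'; rfl
  | pair _ _ ih₁ ih₂ =>
    cases h' with
    | pair h₁ h₂ => rw [List.map_append, List.map_append, ih₁ h₁, ih₂ h₂]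

theorem BdlTy.ctx_unique {Q Q' : LabCtx W} {b : Bdl} {T : BTy W} (h : BdlTy Q b T)
    (h' : BdlTy Q' b T) : Q = Q' := by
  induction h generalizing Q' with
  | unit => cases h'; rfl
  | lab l a => cases h'; rfl
  | pair _ _ ih₁ ih₂ =>
    cases h' with
    | pair h₁ h₂ => rw [ih₁ h₁, ih₂ h₂]

theorem BdlTy.ty_unique {Q : LabCtx W} {b : Bdl} {T T' : BTy W} (h : BdlTy Q b T)
    (h' : BdlTy Q b T') : T = T' := by
  induction h generalizing T' with
  | unit => generalize [] = Q' at h'; cases h'; rfl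
  | lab l a =>
    generalize hQ : [_] = Q' at h'
    cases h'
    cases hQ
    rfl
  | pair h₁ _ ih₁ ih₂ =>
    generalize hQ : (_ ++ _ : LabCtx W) = Q' at h'
    cases h' with
    | pair h₁' h₂' =>
      have hl := congrArg List.length (h₁.map_fst_eq h₁')
      rw [List.length_map, List.length_map] at hl
      obtain ⟨rfl, rfl⟩ := List.append_inj hQ hl
      rw [ih₁ h₁', ih₂ h₂']

theorem LabCtx.eq_of_perm : {Q Q' : LabCtx W} → Q.Valid → Q.Perm Q' →
    Q.map Prod.fst = Q'.map Prod.fst → Q = Q'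
  | [], _, _, h, _ => h.nil_eq
  | (l, a) :: Q, Q', hQ, h, h' => by
      obtain ⟨⟨l', a'⟩, R, rfl, h₁, h₂⟩ := List.map_eq_cons_iff.1 h'.symm
      obtain rfl : l' = l := h₁
      have hQ' := hQ.perm h
      simp only [LabCtx.Valid, List.map_cons, List.nodup_cons] at hQ hQ'
      have hm : (l', a) ∈ (l', a') :: R := h.mem_iff.1 (by simp)
      rcases List.mem_cons.1 hm with e | hm
      · obtain rfl : a = a' := congrArg Prod.snd e
        rw [LabCtx.eq_of_perm hQ.2 (List.perm_cons _ |>.1 h) h₂.symm]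
      · exact (hQ'.1 (List.mem_map_of_mem hm)).elim

end Bundles

section Shapes

variable {W : Type w} {M : Type u} [StrictSymmPremonoidal.{v} M] {ob : W → M}

/-- `Shape L N A m`: the judgment `L ⊢ N : A` is derived without a final exchange, and `m` is its
interpretation. -/
inductive Shape : (L : LabCtx W) → Tm ob → (A : Ty W) →
    Circ (labObj ob L) (obj ob A.sharp) (flat ob A) → Prop
  | app {L₁ L₂ : LabCtx W} {V V' : Val ob} {A B : Ty W} {T : List W}
      (d₁ : VTy L₁.toCtx V (.arrow A B T)) (d₂ : VTy L₂.toCtx V' A)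
      (e : labObj ob (L₁ ++ L₂) = obj ob T * obj ob A.sharp) :
      Shape (L₁ ++ L₂) (.app V V') B
        (Circ.pre (eqToHom e) (arrowFn (d₁.fn (labEnv L₁)) (d₂.fn (labEnv L₂))))
  | force {V : Val ob} {A : Ty W} (d : VTy [] V (.bang A)) (e : labObj ob [] = 1) :
      Shape [] (.force V) A (Circ.pre (eqToHom e) (bangFn (d.fn nilEnv)))
  | box {V : Val ob} {T U : BTy W} (d : VTy [] V (.arrow T.toTy U.toTy []))
      (e : labObj ob [] = obj ob (Ty.circ T U).sharp) :
      Shape [] (.box T V) (.circ T U) (boxMap (d.fn nilEnv), eqToHom e)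
  | apply {L : LabCtx W} {V V' : Val ob} {T U : BTy W} (d₁ : VTy [] V (.circ T U))
      (d₂ : VTy L.toCtx V' T.toTy) (e : labObj ob L = obj ob T.toTy.sharp) :
      Shape L (.apply V V') U.toTy (BTy.pt ob U, eqToHom e ≫ circFn (d₁.fn nilEnv))
  | dest {L₁ L₂ : LabCtx W} {V : Val ob} {N : Tm ob} {A B C : Ty W}
      (d₁ : VTy L₁.toCtx V (.tensor A B))
      (d₂ : CTy (Ctx.shift 2 L₂.toCtx ++ [.var 1 A, .var 0 B]) N C)
      (e : labObj ob (L₂ ++ L₁) =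
        obj ob (Ctx.sharp (Ctx.shift 2 L₂.toCtx ++ [.var 1 A, .var 0 B]))) :
      Shape (L₂ ++ L₁) (.dest V N) C (Circ.pre (eqToHom e)
        (d₂.run (join (shiftEnv 2 (labEnv L₂)) (varEnv₂ 1 A 0 B (pairFn (d₁.fn (labEnv L₁))).1
          (pairFn (d₁.fn (labEnv L₁))).2))))
  | ifz_zero {L : LabCtx W} {V : Val ob} {N N' : Tm ob} {A : Ty W} (d : VTy [] V .nat)
      (h : d.fn nilEnv = (ULift.up 0 : ULift.{v} ℕ)) (d₁ : CTy L.toCtx N A) (d₂ : CTy L.toCtx N' A)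
      (e : labObj ob L = obj ob (Ctx.sharp L.toCtx)) :
      Shape L (.ifz V N N') A (Circ.pre (eqToHom e) (d₁.run (labEnv L)))
  | ifz_succ {L : LabCtx W} {V : Val ob} {N N' : Tm ob} {A : Ty W} (d : VTy [] V .nat) {n : ℕ}
      (h : d.fn nilEnv = (ULift.up (n + 1) : ULift.{v} ℕ)) (d₁ : CTy L.toCtx N A)
      (d₂ : CTy L.toCtx N' A) (e : labObj ob L = obj ob (Ctx.sharp L.toCtx)) :
      Shape L (.ifz V N N') A (Circ.pre (eqToHom e) (d₂.run (labEnv L)))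
  | ret {L : LabCtx W} {V : Val ob} {A : Ty W} (d : VTy L.toCtx V A)
      (e : labObj ob L = obj ob A.sharp) : Shape L (.ret V) A (d.fn (labEnv L), eqToHom e)
  | letin {L₁ L₂ : LabCtx W} {N N' : Tm ob} {A B : Ty W} (d₁ : CTy L₁.toCtx N A)
      (d₂ : CTy (Ctx.shift 1 L₂.toCtx ++ [.var 0 A]) N' B)
      (e : labObj ob (L₂ ++ L₁) = obj ob (Ctx.sharp L₂.toCtx) * obj ob (Ctx.sharp L₁.toCtx))
      (e' : obj ob (Ctx.sharp L₂.toCtx) * obj ob A.sharp =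
        obj ob (Ctx.sharp (Ctx.shift 1 L₂.toCtx ++ [.var 0 A]))) :
      Shape (L₂ ++ L₁) (.letin N N') B
        (Circ.pre (eqToHom e ≫ lwhisk (obj ob (Ctx.sharp L₂.toCtx)) (d₁.run (labEnv L₁)).2 ≫
            eqToHom e')
          (d₂.run (join (shiftEnv 1 (labEnv L₂)) (varEnv 0 A (d₁.run (labEnv L₁)).1))))

/-- A derivation in a label context `L` is a derivation without a final exchange, up to a
permutation of the context. -/
def CTy.HasShape {Γ : Ctx W} {N : Tm ob} {A : Ty W} (d : CTy Γ N A) (L : LabCtx W) : Prop :=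
  ∃ (L' : LabCtx W) (p : labObj ob L ⟶ labObj ob L')
      (m : Circ (labObj ob L') (obj ob A.sharp) (flat ob A)), IsPerm ob p ∧ Shape L' N A m ∧
        ∀ x (e : obj ob (Ctx.sharp Γ) = labObj ob L), d.run x = Circ.pre (eqToHom e ≫ p) m

theorem Shape.hasShape {L : LabCtx W} {Γ : Ctx W} (h : L.toCtx = Γ) {N : Tm ob} {A : Ty W}
    {m : Circ (labObj ob L) (obj ob A.sharp) (flat ob A)} (hm : Shape L N A m) {d : CTy Γ N A}
    (x : flatCtx ob Γ) (e : obj ob (Ctx.sharp Γ) = labObj ob L)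
    (hd : d.run x = Circ.pre (eqToHom e) m) : d.HasShape L :=
  ⟨L, 𝟙 _, m, .refl L, hm, fun y e => by rw [eq_of_labels h y x, hd, Category.comp_id]⟩

/-- The unique element of the parameter part of a label. -/
def labPt (l : ℕ) (a : W) : flat ob (Entry.lab l a).ty := PUnit.unit

theorem obj_sharp_lab (l : ℕ) (a : W) : obj ob (Entry.lab l a).ty.sharp = ob a := mul_one _

theorem conj_lwhisk_sw_congr {A A' X X' Y Y' Z Z' S T R R' U : M} (hA : A = A') (hX : X = X')
    (hY : Y = Y') (hZ : Z = Z') (h₁ : S = A * (X * (Y * Z))) (h₂ : A * (Y * (X * Z)) = T)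
    (h₃ : T = R) (h₄ : S = R') (h₅ : R' = A' * (X' * (Y' * Z'))) (h₆ : A' * (Y' * (X' * Z')) = R)
    (r : R ⟶ U) :
    (eqToHom h₁ ≫ lwhisk A (sw X Y Z) ≫ eqToHom h₂) ≫ eqToHom h₃ ≫ r =
      eqToHom h₄ ≫ (eqToHom h₅ ≫ lwhisk A' (sw X' Y' Z') ≫ eqToHom h₆) ≫ r := by
  subst hA hX hY hZ; simp

theorem CTy.hasShape_ex {Γ₁ Γ₂ : Ctx W} {a b : Entry W} {N : Tm ob} {C : Ty W}
    (d : CTy (Γ₁ ++ a :: b :: Γ₂) N C)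
    (ih : ∀ {L : LabCtx W}, L.toCtx = Γ₁ ++ a :: b :: Γ₂ → d.HasShape L) {L : LabCtx W}
    (h : L.toCtx = Γ₁ ++ b :: a :: Γ₂) : (CTy.ex d).HasShape L := by
  obtain ⟨L₁, L₂, p, q, rfl, rfl, rfl, rfl, rfl⟩ := LabCtx.exists_of_append_cons_cons h
  obtain ⟨L', r, m, hr, hm, hd⟩ := ih (L := L₁ ++ q :: p :: L₂) (List.map_append)
  refine ⟨L', _, m, ((IsPerm.swap p q L₂).lwhisk_block L₁).trans hr, hm, fun x e => ?_⟩
  rw [eq_of_labels h x (join (labEnv L₁) (consEnv (labPt p.1 p.2)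
    (consEnv (labPt q.1 q.2) (labEnv L₂)))), CTy.run_ex, hd _ (by
      rw [labObj_eq_obj_sharp, LabCtx.toCtx_append]; rfl), Circ.pre_pre]
  exact congrArg (Prod.mk m.1) (congrArg (· ≫ m.2)
    (conj_lwhisk_sw_congr (labObj_eq_obj_sharp L₁).symm (obj_sharp_lab p.1 p.2)
      (obj_sharp_lab q.1 q.2) (labObj_eq_obj_sharp L₂).symm _ _ _ _ _ _ r))

/-- In a label context, exchanges can be moved to the end of a derivation. -/
theorem CTy.exists_shape : {Γ : Ctx W} → {N : Tm ob} → {A : Ty W} → (d : CTy Γ N A) →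
    {L : LabCtx W} → L.toCtx = Γ → d.HasShape L
  | _, _, _, .app hΦ d₁ d₂, L, h => by
      obtain ⟨L₁, L₂, rfl, rfl, rfl, rfl⟩ := LabCtx.exists_of_append_append hΦ h
      have e := obj_sharp_of_app hΦ d₁ d₂
      have e' := labObj_eq_obj_sharp (ob := ob) (L₁ ++ L₂)
      rw [h] at e'
      refine (Shape.app (L₁ := L₁) (L₂ := L₂) d₁ d₂ (e'.trans e)).hasShape h
        (join (join nilEnv (labEnv L₁)) (labEnv L₂)) e'.symm ?_
      rw [CTy.run_app hΦ d₁ d₂ e, Circ.pre_pre, eqToHom_trans]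
      rfl
  | _, _, _, .force hΦ d, L, h => by
      obtain ⟨rfl, rfl⟩ := LabCtx.eq_nil_of_sharp h hΦ.sharp_eq
      have e : obj ob (Ctx.sharp []) = labObj ob [] := rfl
      have e' : labObj ob [] = 1 := rfl
      refine (Shape.force d e').hasShape h nilEnv e ?_
      rw [CTy.run_force hΦ d (e.trans e'), Circ.pre_pre, eqToHom_trans]
  | _, _, _, .box (T := T) (U := U) hΦ d, L, h => by
      obtain ⟨rfl, rfl⟩ := LabCtx.eq_nil_of_sharp h hΦ.sharp_eq
      have e : obj ob (Ctx.sharp []) = labObj ob [] := rfl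
      have e' : labObj ob [] = obj ob (Ty.circ T U).sharp := rfl
      refine (Shape.box d e').hasShape h nilEnv e ?_
      rw [CTy.run_box hΦ d (e.trans e'), Circ.pre, eqToHom_trans]
  | _, _, _, .apply hΦ d₁ d₂, L, h => by
      obtain ⟨L₁, L₂, rfl, rfl, h₁, rfl⟩ := LabCtx.exists_of_append_append hΦ h
      obtain ⟨rfl, rfl⟩ := LabCtx.eq_nil_of_sharp h₁ d₁.sharp_eq
      have e := obj_sharp_of_apply hΦ d₁ d₂
      have e' := labObj_eq_obj_sharp (ob := ob) ([] ++ L₂)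
      rw [h] at e'
      refine (Shape.apply (L := L₂) d₁ d₂ (e'.trans e)).hasShape h
        (join (join nilEnv nilEnv) (labEnv L₂)) e'.symm ?_
      rw [CTy.run_apply hΦ d₁ d₂ e, Circ.pre, eqToHom_trans_assoc]
      rfl
  | _, _, _, .dest (A := A) (B := B) hΦ d₁ d₂, L, h => by
      obtain ⟨L₂, L₁, rfl, rfl, rfl, rfl⟩ := LabCtx.exists_of_append_append hΦ h
      have e := obj_sharp_of_dest hΦ d₁ L₂.toCtx
      have e' := labObj_eq_obj_sharp (ob := ob) (L₂ ++ L₁)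
      rw [h] at e'
      refine (Shape.dest (L₁ := L₁) (L₂ := L₂) d₁ d₂ (e'.trans e)).hasShape h
        (join (join nilEnv (labEnv L₂)) (labEnv L₁)) e'.symm ?_
      rw [CTy.run_dest hΦ d₁ d₂ e, Circ.pre_pre, eqToHom_trans]
      rfl
  | _, _, _, .ifz hΦ d d₁ d₂, L, h => by
      obtain ⟨rfl, rfl⟩ := LabCtx.exists_of_param_append hΦ h
      have e := labObj_eq_obj_sharp (ob := ob) L
      obtain ⟨n, hn⟩ : ∃ n : ℕ, d.fn nilEnv = (ULift.up n : ULift.{v} ℕ) := ⟨_, rfl⟩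
      cases n with
      | zero =>
        refine (Shape.ifz_zero d hn d₁ d₂ e).hasShape h (join nilEnv (labEnv L)) e.symm ?_
        rw [CTy.run_ifz_zero hΦ d d₁ d₂ hn, Circ.pre_pre, eqToHom_trans, eqToHom_refl]
        exact (Circ.pre_id _).symm
      | succ n =>
        refine (Shape.ifz_succ d hn d₁ d₂ e).hasShape h (join nilEnv (labEnv L)) e.symm ?_
        rw [CTy.run_ifz_succ hΦ d d₁ d₂ hn, Circ.pre_pre, eqToHom_trans, eqToHom_refl]
        exact (Circ.pre_id _).symm
  | _, _, _, .ret d, L, h => by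
      subst h
      refine (Shape.ret d d.labObj_eq).hasShape rfl (labEnv L)
        (labObj_eq_obj_sharp L).symm ?_
      rw [CTy.run_ret d (congrArg (obj ob) d.sharp_eq), Circ.pre, eqToHom_trans]
  | _, _, _, .letin (A := A) hΦ d₁ d₂, L, h => by
      obtain ⟨L₂, L₁, rfl, rfl, rfl, rfl⟩ := LabCtx.exists_of_append_append hΦ h
      have e := obj_sharp_letin (ob := ob) hΦ L₁.toCtx L₂.toCtx
      have e₁ := obj_sharp_letin' (ob := ob) hΦ L₂.toCtx A
      have e' := labObj_eq_obj_sharp (ob := ob) (L₂ ++ L₁)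
      rw [h] at e'
      refine (Shape.letin (L₁ := L₁) (L₂ := L₂) d₁ d₂ (e'.trans e) e₁).hasShape h
        (join (join nilEnv (labEnv L₂)) (labEnv L₁)) e'.symm ?_
      rw [CTy.run_letin hΦ d₁ d₂ e e₁, Circ.pre_pre, eqToHom_trans_assoc]
      rfl
  | _, _, _, .ex d, _, h => d.hasShape_ex (fun h' => d.exists_shape h') h

end Shapes

section Inversion

variable {W : Type w} {M : Type u} [StrictSymmPremonoidal.{v} M] {ob : W → M}

theorem VTy.exists_of_lam {Γ : Ctx W} {A A' B : Ty W} {T : List W} {N : Tm ob}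
    (d : VTy Γ (.lam A N) (.arrow A' B T)) :
    ∃ (d' : CTy (Ctx.shift 1 Γ ++ [.var 0 A']) N B)
      (e : obj ob T * obj ob A'.sharp = obj ob (Ctx.sharp (Ctx.shift 1 Γ ++ [.var 0 A']))),
      ∀ x a, arrowFn (d.fn x) a =
        Circ.pre (eqToHom e) (d'.run (join (shiftEnv 1 x) (varEnv 0 A' a))) := by
  cases d with
  | abs d =>
    have e : obj ob (Ctx.sharp Γ) * obj ob A.sharp =
        obj ob (Ctx.sharp (Ctx.shift 1 Γ ++ [.var 0 A])) := by
      rw [obj_sharp_append, Ctx.sharp_shift, obj_sharp_var]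
    exact ⟨d, e, VTy.fn_abs d e⟩

theorem VTy.exists_of_lift {Γ : Ctx W} {A : Ty W} {N : Tm ob} (d : VTy Γ (.lift N) (.bang A)) :
    ∃ (d' : CTy Γ N A) (e : 1 = obj ob (Ctx.sharp Γ)),
      ∀ x, bangFn (d.fn x) = Circ.pre (eqToHom e) (d'.run x) := by
  cases d with
  | lift hΦ d =>
    have e : 1 = obj ob (Ctx.sharp Γ) := by rw [hΦ.sharp_eq]; rfl
    exact ⟨d, e, VTy.fn_lift hΦ d e⟩

theorem VTy.fn_of_nat {Γ : Ctx W} {n : ℕ} (d : VTy (ob := ob) Γ (.nat n) .nat)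
    (x : flatCtx ob Γ) : d.fn x = (ULift.up n : ULift.{v} ℕ) := by
  cases d; rfl

theorem VTy.exists_of_boxed {Γ : Ctx W} {b c : Bdl} {D : Circuit ob} {T U : BTy W}
    (d : VTy Γ (.boxed b D c) (.circ T U)) :
    D.dom.Valid ∧ D.cod.Valid ∧ ∃ (Q L : LabCtx W) (hb : BdlTy Q b T) (hc : BdlTy L c U)
      (p : labObj ob Q ⟶ labObj ob D.dom) (q : labObj ob D.cod ⟶ labObj ob L),
      IsPerm ob p ∧ IsPerm ob q ∧ ∀ x, circFn (d.fn x) = boxHom hb hc p q := by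
  cases d with
  | circ hΦ hdom hcod hb hc p hp q hq =>
    exact ⟨hdom, hcod, _, _, hb, hc, p, q, hp, hq, fun _ => rfl⟩

end Inversion

section Soundness

variable {W : Type w} {M : Type u} [StrictSymmPremonoidal.{v} M] {ob : W → M}
  {Q L₀ L₁ : LabCtx W}

/-- The configuration `(C, V)` has type `A`, with remaining wires `Q'`, and it denotes `(a, f)`. -/
def Reaches (C : labObj ob Q ⟶ labObj ob L₁) (V : Val ob) (A : Ty W) (Q' : LabCtx W)
    (a : flat ob A) (f : labObj ob Q ⟶ obj ob A.sharp * labObj ob Q') : Prop :=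
  L₁.Valid ∧ ∃ (L : LabCtx W) (p : labObj ob L₁ ⟶ labObj ob (L ++ Q')) (t : VTy L.toCtx V A),
    IsPerm ob p ∧ t.fn (labEnv L) = a ∧
      ∀ e : labObj ob (L ++ Q') = obj ob A.sharp * labObj ob Q', C ≫ p ≫ eqToHom e = f

/-- Every meaning of `(C, N)` is a meaning of `(C', V)`. -/
def Sound (C : labObj ob Q ⟶ labObj ob L₀) (N : Tm ob) (C' : labObj ob Q ⟶ labObj ob L₁)
    (V : Val ob) : Prop :=
  ∀ ⦃L Q' : LabCtx W⦄ ⦃A : Ty W⦄ ⦃p : labObj ob L₀ ⟶ labObj ob (L ++ Q')⦄, IsPerm ob p →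
    ∀ t : CTy L.toCtx N A, L₀.Valid →
    ∀ e : labObj ob (L ++ Q') = obj ob (Ctx.sharp L.toCtx) * labObj ob Q',
      Reaches C' V A Q' (t.run (labEnv L)).1
        (C ≫ p ≫ eqToHom e ≫ rwhisk (t.run (labEnv L)).2 (labObj ob Q'))

theorem labObj_append_eq (L Q' : LabCtx W) :
    labObj ob (L ++ Q') = obj ob (Ctx.sharp L.toCtx) * labObj ob Q' := by
  rw [labObj_append, labObj_eq_obj_sharp L]

theorem Reaches.of_eq {C : labObj ob Q ⟶ labObj ob L₁} {V : Val ob} {A : Ty W} {Q' : LabCtx W}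
    {a a' : flat ob A} {f f' : labObj ob Q ⟶ obj ob A.sharp * labObj ob Q'}
    (h : Reaches C V A Q' a f) (ha : a = a') (hf : f = f') : Reaches C V A Q' a' f' :=
  ha ▸ hf ▸ h

variable {C : labObj ob Q ⟶ labObj ob L₀} {N : Tm ob} {C' : labObj ob Q ⟶ labObj ob L₁}
  {V : Val ob}

theorem Sound.reaches (h : Sound C N C' V) {L Q' : LabCtx W} {A : Ty W}
    {p : labObj ob L₀ ⟶ labObj ob (L ++ Q')} (hp : IsPerm ob p) (t : CTy L.toCtx N A)
    (hL₀ : L₀.Valid) {m : Circ (labObj ob L) (obj ob A.sharp) (flat ob A)}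
    (ht : ∀ e, t.run (labEnv L) = Circ.pre (eqToHom e) m)
    (e : labObj ob (L ++ Q') = labObj ob L * labObj ob Q') :
    Reaches C' V A Q' m.1 (C ≫ p ≫ eqToHom e ≫ rwhisk m.2 (labObj ob Q')) := by
  refine (h hp t hL₀ (labObj_append_eq L Q')).of_eq ?_ ?_
  · rw [ht (labObj_eq_obj_sharp L).symm, Circ.pre]
  · rw [ht (labObj_eq_obj_sharp L).symm, Circ.pre, rwhisk_comp, rwhisk_eqToHom,
      eqToHom_trans_assoc]

theorem Sound.of_shape (h : ∀ ⦃L Q' : LabCtx W⦄ ⦃A : Ty W⦄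
    ⦃p : labObj ob L₀ ⟶ labObj ob (L ++ Q')⦄ ⦃m : Circ (labObj ob L) (obj ob A.sharp) (flat ob A)⦄,
    IsPerm ob p → Shape L N A m → L₀.Valid →
    ∀ e : labObj ob (L ++ Q') = labObj ob L * labObj ob Q',
      Reaches C' V A Q' m.1 (C ≫ p ≫ eqToHom e ≫ rwhisk m.2 (labObj ob Q'))) :
    Sound C N C' V := fun L Q' A p hp t hL₀ e => by
  obtain ⟨L', r, m, hr, hm, ht⟩ := t.exists_shape rfl
  have e' := (labObj_eq_obj_sharp (ob := ob) L).symm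
  refine (h (hp.trans (hr.rwhisk_block Q')) hm hL₀ (labObj_append ob L' Q')).of_eq ?_ ?_
  · rw [ht _ e', Circ.pre]
  · rw [ht _ e', Circ.pre]
    simp only [rwhisk_comp, rwhisk_eqToHom, Category.assoc, eqToHom_trans_assoc, eqToHom_refl,
      Category.id_comp]

theorem Sound.app {A : Ty W} {X : Val ob} {N : Tm ob} (h : Sound C (N.sub (single V)) C' X) :
    Sound C (.app (.lam A N) V) C' X := .of_shape fun L Q' B p m hp hm hL₀ e => by
  cases hm with
  | app d₁ d₂ e₁ =>
    obtain ⟨d, e₂, hd⟩ := d₁.exists_of_lam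
    obtain ⟨d', e₃, hd'⟩ := d.subst_one d₂
    exact h.reaches hp d' hL₀ (fun e => by
      rw [hd', hd, Circ.pre_pre, Circ.pre_pre, eqToHom_trans, eqToHom_trans]) e

theorem Sound.dest {V V' X : Val ob} {N : Tm ob} (h : Sound C (N.sub (double V V')) C' X) :
    Sound C (.dest (.pair V V') N) C' X := .of_shape fun L Q' B p m hp hm hL₀ e => by
  cases hm with
  | dest d₁ d₂ e₁ =>
    obtain ⟨K, K', d, d', rfl, hd⟩ := d₁.exists_of_pair
    obtain ⟨t, e₂, ht⟩ := d₂.subst_two d d'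
    exact h.reaches hp t hL₀ (fun e => by rw [ht, hd, Circ.pre_pre, eqToHom_trans]) e

theorem Sound.force {X : Val ob} {N : Tm ob} (h : Sound C N C' X) :
    Sound C (.force (.lift N)) C' X := .of_shape fun L Q' B p m hp hm hL₀ e => by
  cases hm with
  | force d e₁ =>
    obtain ⟨d', e₂, hd⟩ := d.exists_of_lift
    refine h.reaches (L := []) hp d' hL₀ (fun e => ?_) e
    rw [hd, Circ.pre_pre, Circ.pre_pre, eqToHom_trans, eqToHom_trans]
    exact (Circ.pre_id _).symm

theorem Sound.ifz_zero {X : Val ob} {N N' : Tm ob} (h : Sound C N C' X) :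
    Sound C (.ifz (.nat 0) N N') C' X := .of_shape fun L Q' B p m hp hm hL₀ e => by
  cases hm with
  | ifz_zero d hd d₁ d₂ e₁ =>
    exact h.reaches hp d₁ hL₀ (fun e => by
      rw [Circ.pre_pre, eqToHom_trans, eqToHom_refl, Circ.pre_id]) e
  | ifz_succ d hd d₁ d₂ e₁ =>
    exact absurd (ULift.up_injective ((d.fn_of_nat _).symm.trans hd)) (Nat.succ_ne_zero _).symm

theorem Sound.ifz_succ {X : Val ob} {n : ℕ} {N N' : Tm ob} (h : Sound C N' C' X) :
    Sound C (.ifz (.nat (n + 1)) N N') C' X := .of_shape fun L Q' B p m hp hm hL₀ e => by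
  cases hm with
  | ifz_zero d hd d₁ d₂ e₁ =>
    exact absurd (ULift.up_injective ((d.fn_of_nat _).symm.trans hd)) (Nat.succ_ne_zero _)
  | ifz_succ d hd d₁ d₂ e₁ =>
    exact h.reaches hp d₂ hL₀ (fun e => by
      rw [Circ.pre_pre, eqToHom_trans, eqToHom_refl, Circ.pre_id]) e

theorem Sound.ret : Sound C (.ret V) C V := .of_shape fun L Q' B p m hp hm hL₀ e => by
  cases hm with
  | ret d e₁ =>
    exact ⟨hL₀, L, p, d, hp, rfl, fun e => by rw [rwhisk_eqToHom, eqToHom_trans]⟩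

theorem letin_coherence {X L₀ L₁ P K₀ l₁ l₂ s₁ s₂ a k r U R T y z : M} {c : X ⟶ L₀} {p : L₀ ⟶ P}
    {c' : X ⟶ L₁} {q : L₁ ⟶ K₀} {g : s₁ ⟶ a} (h₁ : l₁ = s₁) (h₂ : l₂ = s₂) (hk : k = a)
    (hU : U = l₂ * r) (hP : P = l₂ * (l₁ * r)) (hK : K₀ = a * U)
    (hE : l₁ * (l₂ * r) = s₁ * U)
    (hf : c' ≫ q ≫ eqToHom hK =
      c ≫ p ≫ eqToHom hP ≫ sw l₂ l₁ r ≫ eqToHom hE ≫ rwhisk g U)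
    (hK' : K₀ = k * (l₂ * r)) (hR : l₂ * (k * r) = R * r) (hT : R = T) (f : T ⟶ z)
    (hP' : P = y * r) (hy : y = s₂ * s₁) (hT' : s₂ * a = T) :
    c' ≫ q ≫ eqToHom hK' ≫ sw k l₂ r ≫ eqToHom hR ≫ rwhisk (eqToHom hT ≫ f) r =
      c ≫ p ≫ eqToHom hP' ≫ rwhisk (eqToHom hy ≫ lwhisk s₂ g ≫ eqToHom hT' ≫ f) r := by
  subst h₁ h₂ hk hU hT hT' hy hK hP
  simp only [eqToHom_refl, Category.id_comp, Category.comp_id] at hf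
  rw [reassoc_of% hf, rwhisk_comp, rwhisk_comp]
  simp only [Category.assoc, rwhisk_comp, eqToHom_refl, Category.id_comp, rwhisk_id,
    eqToHom_trans_assoc, rwhisk_lwhisk_eq]
  rw [reassoc_of% (sw_natural_left g l₂ r), sw_sw_assoc]

theorem Sound.letin {L₂ : LabCtx W} {C'' : labObj ob Q ⟶ labObj ob L₂} {N' : Tm ob} {X : Val ob}
    (h : Sound C N C' V) (h' : Sound C' (N'.sub (single V)) C'' X) :
    Sound C (.letin N N') C'' X := .of_shape fun L Q' B p m hp hm hL₀ e => by
  cases hm with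
  | @letin L₁ L₂ _ _ A _ d₁ d₂ e₁ e₂ =>
    have eP : L₂ ++ L₁ ++ Q' = L₂ ++ (L₁ ++ Q') := List.append_assoc _ _ _
    obtain ⟨hL₁, K, q, t, hq, ht, hf⟩ :=
      h ((hp.trans (.eqToHom eP)).trans (.swap_block _ _ _)) d₁ hL₀ (labObj_append_eq _ _)
    have eK : L₂ ++ (K ++ Q') = L₂ ++ K ++ Q' := (List.append_assoc _ _ _).symm
    obtain ⟨d, e₃, hd⟩ := d₂.subst_one t
    have hf := hf ((labObj_append ob _ _).trans (by rw [t.labObj_eq]))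
    refine (h' ((hq.trans (.swap_block _ _ _)).trans (.eqToHom eK)) d hL₁
      (labObj_append_eq _ _)).of_eq ?_ ?_
    · rw [hd, ht]; rfl
    · rw [hd, ht]
      simp only [Circ.pre, Category.assoc, eqToHom_trans_assoc] at hf ⊢
      exact letin_coherence (labObj_eq_obj_sharp _) (labObj_eq_obj_sharp _) t.labObj_eq
        (labObj_append ob _ _) _ _ _ hf _ _ _ _ _ _ _

theorem box_coherence {K K₁ K' L L₁ T U I S r : M} {D : K ⟶ K'} {q : K' ⟶ L₁} {g : I * T ⟶ U}
    (hr : r = 1) (h₁ : L₁ = U * r) (h₂ : K = K₁) (h₃ : K₁ = S * r) (h₄ : S = I * T)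
    (hf : D ≫ q ≫ eqToHom h₁ = 𝟙 K ≫ eqToHom h₂ ≫ eqToHom h₃ ≫ rwhisk (eqToHom h₄ ≫ g) r)
    (h₅ : T = K) (h₆ : L₁ = L) (h₇ : L = U) (h₈ : T = I * T) :
    eqToHom h₅ ≫ 𝟙 K ≫ D ≫ (q ≫ eqToHom h₆) ≫ eqToHom h₇ = eqToHom h₈ ≫ g := by
  subst hr h₄
  have h := congrArg (· ≫ eqToHom (mul_one U)) hf
  simp only [Category.assoc, eqToHom_trans, Category.id_comp, rwhisk_one_eq, eqToHom_trans_assoc,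
    eqToHom_refl, Category.comp_id] at h ⊢
  rw [h, eqToHom_trans_assoc]

theorem Sound.box {K K' : LabCtx W} {T : BTy W} {b c : Bdl} {D : labObj ob K ⟶ labObj ob K'}
    (hK : K.Valid) (hb : BdlTy K b T) (h : Sound (𝟙 (labObj ob K)) (.app V b.toVal) D c.toVal) :
    Sound C (.box T V) C (.boxed b ⟨K, K', D⟩ c) := .of_shape fun L Q' B p m hp hm hL₀ e => by
  cases hm with
  | @box _ _ U d e₁ =>
    obtain ⟨t⟩ := hb.exists_vTy ob
    obtain ⟨t₀, ht₀⟩ : ∃ t₀ : CTy K.toCtx (.app V b.toVal) U.toTy, ∀ e, t₀.run (labEnv K) =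
        Circ.pre (eqToHom e) (arrowFn (d.fn nilEnv) (BTy.pt ob T)) :=
      ⟨CTy.app (Φ := []) (Γ₁ := []) isParam_nil d t, fun e =>
        (CTy.run_app (Φ := []) (Γ₁ := []) isParam_nil d t e nilEnv nilEnv (labEnv K)).trans
          (congrArg (fun a => Circ.pre (eqToHom e) (arrowFn (d.fn nilEnv) a)) (BTy.eq_pt T _))⟩
    obtain ⟨hK', L, q, t', hq, -, hf⟩ := h (L := K) (Q' := [])
      (.eqToHom (List.append_nil K).symm) t₀ hK (labObj_append_eq _ _)
    have hL : L ++ [] = L := List.append_nil L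
    refine ⟨hL₀, [], p, .circ (D := ⟨K, K', D⟩) isParam_nil hK hK' hb t'.bdlTy (𝟙 _) (.refl K)
      (q ≫ eqToHom (by rw [hL])) (hq.trans (.eqToHom hL)), hp, ?_, fun e => ?_⟩
    · have hf := hf ((labObj_append ob L []).trans (congrArg (· * _) t'.labObj_eq))
      rw [ht₀ (obj_sharp_of_app (Φ := []) (Γ₁ := []) isParam_nil d t), Circ.pre] at hf
      exact box_coherence rfl _ _ _ _ hf _ _ _ _
    · rw [rwhisk_eqToHom, eqToHom_trans]

theorem apply_coherence {X L₀ L₁ P P' R R' S Z T U t k u : M} {c : X ⟶ L₀} {p : L₀ ⟶ P'}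
    {s : L₀ ⟶ P} {s' : S ⟶ L₁} {q : L₁ ⟶ S} {r : R ⟶ R'} (hr : Central r) (ht : t = T)
    (hU : k = U) (hP : P = T * R)
    (hP' : t * R' = P') (hP₂ : P = t * R)
    (hp : s ≫ eqToHom hP₂ ≫ lwhisk t r ≫ eqToHom hP' = p) (hq : s' ≫ q = 𝟙 _)
    (E : T ⟶ U) (hS : U * R = S) (hS' : S = k * R) (hZ : k * R' = Z) (hZ' : Z = U * R')
    (h₁ : P' = u * R') (h₂ : u = T) :
    (c ≫ s ≫ eqToHom hP ≫ rwhisk E R ≫ eqToHom hS ≫ s') ≫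
        (q ≫ eqToHom hS' ≫ lwhisk k r ≫ eqToHom hZ) ≫ eqToHom hZ' =
      c ≫ p ≫ eqToHom h₁ ≫ rwhisk (eqToHom h₂ ≫ E) R' := by
  subst ht hU hP hP' hp hS hZ h₂
  simp only [Category.assoc, reassoc_of% hq, eqToHom_refl, Category.id_comp, Category.comp_id]
  rw [hr E]

theorem Sound.apply {Qb Qc Qt Qk R : LabCtx W} {b c t k : Bdl} {D : Circuit ob} {T U : BTy W}
    (hb : BdlTy Qb b T) (hc : BdlTy Qc c U) (ht : BdlTy Qt t T) (hk : BdlTy Qk k U)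
    {p : labObj ob Qb ⟶ labObj ob D.dom} {q : labObj ob D.cod ⟶ labObj ob Qc}
    {s : labObj ob L₀ ⟶ labObj ob (Qt ++ R)} {s' : labObj ob (Qk ++ R) ⟶ labObj ob L₁}
    (hp : IsPerm ob p) (hq : IsPerm ob q) (hs : IsPerm ob s) (hs' : IsPerm ob s')
    (hL₁ : L₁.Valid) :
    Sound C (.apply (.boxed b D c) t.toVal) (append ht hk C s (boxHom hb hc p q) s') k.toVal :=
      .of_shape fun L Q' B p₀ m hp₀ hm hL₀ e => by
  cases hm with
  | apply d₁ d₂ e₁ =>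
    obtain ⟨hdom, hcod, Q₁, Q₂, hb', hc', p', q', hp', hq', hd₁⟩ := d₁.exists_of_boxed
    have hQb := hdom.perm hp.listPerm.symm
    obtain rfl := LabCtx.eq_of_perm hQb (hp.listPerm.trans hp'.listPerm.symm) (hb.map_fst_eq hb')
    obtain rfl := LabCtx.eq_of_perm (hcod.perm hq.listPerm) (hq.listPerm.symm.trans hq'.listPerm)
      (hc.map_fst_eq hc')
    obtain rfl := hb.ty_unique hb'
    obtain rfl := hc.ty_unique hc'
    obtain rfl := hp.unique hQb hp'
    obtain rfl := hq.unique hcod hq'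
    obtain rfl := ht.ctx_unique d₂.bdlTy
    obtain ⟨r, hr⟩ := exists_isPerm ob ((List.perm_append_left_iff Qt).1
      (hs.listPerm.symm.trans hp₀.listPerm))
    have hsr := (hs.trans (hr.lwhisk_block Qt)).unique hL₀ hp₀
    obtain ⟨v, hv, e'⟩ := hs'.exists_inv
    obtain ⟨tk⟩ := hk.exists_vTy ob
    refine ⟨hL₁, Qk, _, tk, hv.trans (hr.lwhisk_block Qk), BTy.eq_pt _ _, fun e₂ => ?_⟩
    rw [hd₁]
    exact apply_coherence hr.central (ht.labObj_eq ob) (hk.labObj_eq ob) _ _ _ hsr e' _ _ _ _ _ _ _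

theorem Eval.sound {Q L₀ L₁ : LabCtx W} {C : labObj ob Q ⟶ labObj ob L₀} {N : Tm ob}
    {C' : labObj ob Q ⟶ labObj ob L₁} {V : Val ob} (h : Eval C N C' V) : Sound C N C' V := by
  induction h with
  | app _ ih => exact ih.app
  | dest _ ih => exact ih.dest
  | force _ ih => exact ih.force
  | ifz_zero _ ih => exact ih.ifz_zero
  | ifz_succ _ ih => exact ih.ifz_succ
  | ret => exact .ret
  | letin _ _ ih ih' => exact ih.letin ih'
  | box hK hb _ ih => exact .box hK hb ih
  | apply hb hc ht hk hp hq hs hs' hL => exact .apply hb hc ht hk hp hq hs hs' hL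

theorem ConfigTy.sem_apply {Q' : LabCtx W} {A : Ty W} (d : ConfigTy C N A Q')
    (e : labObj ob (d.L ++ Q') = obj ob (Ctx.sharp d.L.toCtx) * labObj ob Q')
    (x : PUnit.{v + 1}) :
    d.sem x = ((d.typing.run (labEnv d.L)).1,
      C ≫ d.perm ≫ eqToHom e ≫ rwhisk (d.typing.run (labEnv d.L)).2 (labObj ob Q')) :=
  Prod.ext rfl (show ((C ≫ d.perm) ≫ eqToHom e) ≫
    rwhisk (d.typing.run (labEnv d.L)).2 (labObj ob Q') = _ by simp only [Category.assoc])

theorem discrete_functor_map_eqToHom {X Y : M} (h : X = Y) :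
    (Discrete.functor (id : M → M)).map (Discrete.eqToHom h : Discrete.mk X ⟶ Discrete.mk Y) =
      eqToHom h := by
  subst h; exact (Discrete.functor (id : M → M)).map_id ⟨X⟩

theorem ValConfigTy.map_sem_apply {Q' : LabCtx W} {A : Ty W} (d : ValConfigTy C V A Q')
    (e : labObj ob (d.L ++ Q') = obj ob A.sharp * labObj ob Q') (x : PUnit.{v + 1}) :
    J.map d.sem x = (d.typing.fn (labEnv d.L), C ≫ d.perm ≫ eqToHom e) := by
  have h : obj ob (Ctx.sharp d.L.toCtx) = obj ob A.sharp := by rw [d.typing.sharp_eq]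
  refine Prod.ext rfl ?_
  change ((C ≫ d.perm) ≫ eqToHom (labObj_append_eq d.L Q')) ≫
    rwhisk ((Discrete.functor (id : M → M)).map (Discrete.eqToHom h)) (labObj ob Q') = _
  rw [discrete_functor_map_eqToHom]
  simp only [rwhisk_eqToHom, Category.assoc, eqToHom_trans]

end Soundness

end ProtoQuipperC

theorem mainTheorem1 {W : Type w} {M : Type u} [StrictSymmPremonoidal.{v} M] (ob : W → M)
    {Q L₀ L₁ Q' : ProtoQuipperC.LabCtx W}
    (C : ProtoQuipperC.labObj ob Q ⟶ ProtoQuipperC.labObj ob L₀)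
    (C' : ProtoQuipperC.labObj ob Q ⟶ ProtoQuipperC.labObj ob L₁)
    (N : ProtoQuipperC.Tm ob) (V : ProtoQuipperC.Val ob) (A : ProtoQuipperC.Ty W)
    (d : ProtoQuipperC.ConfigTy C N A Q') (h : ProtoQuipperC.Eval C N C' V) :
    ∃ d' : ProtoQuipperC.ValConfigTy C' V A Q', d.sem = ProtoQuipperC.J.map d'.sem := by
  obtain ⟨hL₁, L, p, t, hp, ha, hf⟩ := h.sound d.isPerm d.typing d.valid_cod
    (ProtoQuipperC.labObj_append_eq _ _)
  refine ⟨⟨d.valid_dom, hL₁, L, p, hp, t⟩, ?_⟩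
  have e : ProtoQuipperC.labObj ob (L ++ Q') =
      ProtoQuipperC.obj ob A.sharp * ProtoQuipperC.labObj ob Q' := by
    rw [ProtoQuipperC.labObj_append, t.labObj_eq]
  funext x
  refine (d.sem_apply (ProtoQuipperC.labObj_append_eq _ _) x).trans ?_
  refine Eq.trans ?_ (ProtoQuipperC.ValConfigTy.map_sem_apply _ e x).symm
  exact Prod.ext ha.symm (hf e).symm
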